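/- **Theorem 1.1.** Let $H,U$ be separable complex Hilbert spaces, $T>0$; let $A:\mathcal D(A)\subset H\to H$ be the infinitesimal generator of a strongly continuous semigroup $\{e^{tA}\}_{t\ge0}$ on $H$, $K\in L^2(0,T;\mathbb R)$, $B\in\mathcal L(U,H)$, and $Q\in\mathcal L(H)$ with $Q=Q^*\ge0$. For $\tau\in(0,T)$ put $Y_\tau=H\times L^2(0,\tau;H)$. For $X_0=(\xi_0,\xi)\in Y_\tau$ and $u\in L^2(\tau,T;U)$, a mild solution of $$w'(t)=Aw(t)+\int_\tau^tK(t-s)w(s)\,ds+\int_0^\tau K(t-s)\xi(s)\,ds+Bu(t),\quad w(\tau)=\xi_0,$$ is a function $w\in L^2(\tau,T;H)$ such that, for a.e. $t\in(\tau,T)$, $$w(t)=e^{(t-\tau)A}\xi_0+\int_\tau^te^{(t-s)A}\Big[\int_\tau^sK(s-\sigma)w(\sigma)\,d\sigma+\int_0^\tau K(s-\sigma)\xi(\sigma)\,d\sigma+Bu(s)\Big]ds.$$ Let $J_\tau(u,X_0)=\int_\tau^T(\langle Qw(t),w(t)\rangle_H+\|u(t)\|_U^2)\,dt$. An optimal pair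 for $(\tau,X_0)$ is a pair $(u,w)$ with $u\in L^2(\tau,T;U)$ and $w$ a corresponding mild solution, which minimizes this cost over all such pairs. *Notation.* All integrals of operators are in the strong (or weak) sense. For $0\le\sigma\le\tau\le t\le T$ let $$\mu(t)=\int_0^te^{(t-s)A}K(s)\,ds,\qquad R=-\mu-\mu*\mu-\mu*\mu*\mu-\cdots,$$ $$F(t,\tau)=e^{(t-\tau)A}-\int_\tau^tR(t-s)e^{(s-\tau)A}ds,\qquad G(t,\sigma,\tau)=\mu(t-\sigma)-e^{(t-\tau)A}\mu(\tau-\sigma),$$ $$M(t,\sigma,\tau)=G(t,\sigma,\tau)-\int_\tau^tR(t-s)G(s,\sigma,\tau)\,ds,$$ $$L_\tau:L^2(\tau,T;U)\to L^2(\tau,T;H),\quad (L_\tau u)(t)=\int_\tau^tF(t,\sigma)Bu(\sigma)\,d\sigma,\qquad \Lambda_\tau=I+L_\tau^*QL_\tau,$$ $$\Psi_1(\cdot,\tau)=-\Lambda_\tau^{-1}L_\tau^*QF(\cdot,\tau),\qquad \Psi_2(\cdot,s,\tau)=-\Lambda_\tau^{-1}L_\tau^*QM(\cdot,s,\tau),$$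 $$Z_1(t,\tau)=F(t,\tau)+\int_\tau^tF(t,\sigma)B\Psi_1(\sigma,\tau)\,d\sigma,\qquad Z_2(t,s,\tau)=M(t,s,\tau)+\int_\tau^tF(t,\sigma)B\Psi_2(\sigma,s,\tau)\,d\sigma .$$ A point $r\in[0,T)$ is called a Lebesgue point of $K$ if $\frac1h\int_{[0,T]\cap[r-h,r+h]}|K(x)-K(r)|\,dx\to0$ as $h\to0^+$. (Almost every $r$ is one; every $r$ is, if $K$ is continuous on $[0,T]$.) Then the following hold. **S1.** For all $\tau\in(0,T)$ and $X_0\in Y_\tau$: each $u\in L^2(\tau,T;U)$ has a mild solution, unique up to a.e. equality; and there is a unique (up to a.e. equality) optimal pair $(\hat u(\cdot,\tau;X_0),\hat w(\cdot,\tau;X_0))$, which has a representative with $\hat u\in C([\tau,T],U)$, $\hat w\in C([\tau,T],H)$. This representative is used below, with $\hat y=\xi$ on $[0,\tau]$ and $\hat y=\hat w(\cdot,\tau;X_0)$ on $(\tau,T]$. **S2.** For $\tau\in(0,T)$ and $t\in[\tau,T]$, $\Phi(t,\tau)X_0:=(\hat w(t,\tau;X_0),\hat y|_{[0,t]})$ defines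 a bounded linear operator $Y_\tau\to Y_t$; with $\Phi(T,T):=I$ one has $\Phi(t,t)=I$ for $0<t\le T$ and $\Phi(t,\tau)=\Phi(t,\tau_1)\Phi(\tau_1,\tau)$ for $0<\tau\le\tau_1\le t\le T$. **S3.** For $t\in[0,T]$ and $s,q\in[0,t]$ there are bounded operators on $H$ $$P_0(t)=\int_t^T[\Psi_1(p,t)^*\Psi_1(p,t)+Z_1(p,t)^*QZ_1(p,t)]\,dp=\int_t^TF(p,t)^*QZ_1(p,t)\,dp,$$ $$P_1(t,s)=\int_t^T[\Psi_1(p,t)^*\Psi_2(p,s,t)+Z_1(p,t)^*QZ_2(p,s,t)]\,dp=\int_t^TF(p,t)^*QZ_2(p,s,t)\,dp,$$ $$P_2(t,s,q)=\int_t^T[\Psi_2(p,q,t)^*\Psi_2(p,s,t)+Z_2(p,q,t)^*QZ_2(p,s,t)]\,dp=\int_t^TM(p,q,t)^*QZ_2(p,s,t)\,dp,$$ such that for all $\tau\in(0,T)$, $X_0=(\xi_0,\xi)\in Y_\tau$ the optimal cost is $$J_\tau(\hat u,X_0)=\langle P_0(\tau)\xi_0,\xi_0\rangle_H+2\,\mathrm{Re}\int_0^\tau\langle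 P_1(\tau,s)\xi(s),\xi_0\rangle_H\,ds+\int_0^\tau\!\!\int_0^\tau\langle P_2(\tau,s,q)\xi(s),\xi(q)\rangle_H\,ds\,dq=\langle P(\tau)X_0,X_0\rangle_{Y_\tau},$$ where $P(\tau)\in\mathcal L(Y_\tau)$ is given by $P(\tau)(\xi_0,\xi)=\big(P_0(\tau)\xi_0+\int_0^\tau P_1(\tau,s)\xi(s)\,ds,\ P_1(\tau,\cdot)^*\xi_0+\int_0^\tau P_2(\tau,s,\cdot)\xi(s)\,ds\big)$. The operator $P_0(\tau)$ on $H$ and the operator $\xi\mapsto\int_0^\tau P_2(\tau,s,\cdot)\xi(s)\,ds$ on $L^2(0,\tau;H)$ are bounded, self-adjoint and non-negative. **S4.** For all $\tau\in(0,T)$, $X_0\in Y_\tau$ and $t\in[\tau,T]$, $$\hat u(t,\tau;X_0)=-B^*P_0(t)\hat w(t,\tau;X_0)-\int_0^tB^*P_1(t,s)\hat y(s)\,ds.$$ **S5.** For all $x,y\in\mathcal D(A)$ and $s,q\in[0,T)$, the functions $t\mapsto\langle P_0(t)x,y\rangle$, $\langle P_1(t,s)x,y\rangle$, $\langle P_2(t,s,q)x,y\rangle$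 are absolutely continuous on $[0,T]$, $[s,T]$, $[\max(s,q),T]$ respectively. The first of the equations $$\begin{aligned} &\tfrac{d}{dt}\langle P_0(t)x,y\rangle+\langle P_0(t)x,Ay\rangle+\langle Ax,P_0(t)y\rangle+\langle Qx,y\rangle-\langle B^*P_0(t)x,B^*P_0(t)y\rangle+\langle P_1(t,t)x,y\rangle+\langle x,P_1(t,t)y\rangle=0,\\ &\tfrac{\partial}{\partial t}\langle P_1(t,s)x,y\rangle+\langle P_1(t,s)x,Ay\rangle+\langle K(t-s)x,P_0(t)y\rangle+\langle P_2(t,s,t)x,y\rangle-\langle B^*P_1(t,s)x,B^*P_0(t)y\rangle=0,\\ &\tfrac{\partial}{\partial t}\langle P_2(t,s,q)x,y\rangle+\langle P_1(t,s)x,K(t-q)y\rangle+\langle K(t-s)x,P_1(t,q)y\rangle-\langle B^*P_1(t,s)x,B^*P_1(t,q)y\rangle=0 \end{aligned}$$ holds for every $t\in[0,T)$; the second for every $t\in[s,T)$ such that $t-s$ is a Lebesgue point of $K$; the third for every $t\in[\max(s,q),T)$ such that $t-s$ and $t-q$ are Lebesgue points of $K$ (in particular the last two hold for a.e. $t$,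 and for every $t$ if $K$ is continuous on $[0,T]$). Derivatives at the left end point of the respective interval are one-sided. Moreover $P_0(T)=0$, $P_1(T,s)=0$, $P_2(T,s,q)=0$ for all $s,q\in[0,T]$. -/

import Mathlib

open Set Filter MeasureTheory Topology

noncomputable section

namespace VolterraLQ

variable {E E' : Type*} [NormedAddCommGroup E] [NormedSpace ℂ E]
  [NormedAddCommGroup E'] [NormedSpace ℂ E']

/-! ### Strongly continuous semigroups and their generators -/

/-- `S` restricted to `[0, ∞)` is a strongly continuous semigroup of bounded operators on `E`
(values at negative times are irrelevant and are never used). -/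
structure IsC0Semigroup (S : ℝ → E →L[ℂ] E) : Prop where
  map_zero : S 0 = ContinuousLinearMap.id ℂ E
  map_add : ∀ s t : ℝ, 0 ≤ s → 0 ≤ t → S (s + t) = (S s).comp (S t)
  strong_cont : ∀ x : E, ContinuousOn (fun t => S t x) (Ici 0)

/-- The (in general unbounded) operator `A` is the infinitesimal generator of `S`: `x` lies in the
domain of `A` and `A x = y` exactly when `(S h x - x) / h → y` as `h → 0+`. -/
def IsGenerator (S : ℝ → E →L[ℂ] E) (A : E →ₗ.[ℂ] E) : Prop :=
  ∀ x y : E, (∃ hx : x ∈ A.domain, A ⟨x, hx⟩ = y) ↔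
    Tendsto (fun h : ℝ => ((h : ℂ)⁻¹) • (S h x - x)) (𝓝[>] 0) (𝓝 y)

/-! ### Function spaces and operators given by formulas -/

/-- `L²(a,b;E)`. -/
abbrev L2 (E : Type*) [NormedAddCommGroup E] (a b : ℝ) : Type _ :=
  Lp E 2 (volume.restrict (Ioc a b))

/-- `Y_τ = H × L²(0,τ;H)` with its Hilbert product structure. The component `X.fst` is the present
state and `X.snd` is the past history. -/
abbrev Y (H : Type*) [NormedAddCommGroup H] (τ : ℝ) : Type _ :=
  WithLp 2 (H × L2 H 0 τ)

open Classical in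
/-- The class in `L²(a,b;E)` of a square integrable function (and `0` if the function is not square
integrable). -/
def toL2 (a b : ℝ) (f : ℝ → E) : L2 E a b :=
  if h : MemLp f 2 (volume.restrict (Ioc a b)) then h.toLp f else 0

open Classical in
/-- The bounded linear operator whose values are given by the formula `f` (and `0` if the formula
does not define a bounded linear operator). -/
def opOf (f : E → E') : E →L[ℂ] E' :=
  if h : ∃ L : E →L[ℂ] E', ∀ x, L x = f x then h.choose else 0

/-- The integral `∫_a^b f(s) ds` of an operator-valued function in the strong sense, that is, the
operator `x ↦ ∫_a^b f(s) x ds`. -/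
def strongInt (f : ℝ → E →L[ℂ] E') (a b : ℝ) : E →L[ℂ] E' :=
  opOf (fun x => ∫ s in a..b, f s x)

/-- `r ∈ [0,T]` is a Lebesgue point of the function `K` on `[0,T]`. Almost every point of `[0,T]` is
one if `K` is integrable, and so is every point at which `K` is continuous relative to `[0,T]`. -/
def IsLebesguePt (T : ℝ) (K : ℝ → ℝ) (r : ℝ) : Prop :=
  Tendsto (fun h : ℝ => h⁻¹ * ∫ x in Icc 0 T ∩ Icc (r - h) (r + h), |K x - K r|)
    (𝓝[>] 0) (𝓝 0)

variable {H U : Type*}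
  [NormedAddCommGroup H] [InnerProductSpace ℂ H] [CompleteSpace H]
  [NormedAddCommGroup U] [InnerProductSpace ℂ U] [CompleteSpace U]

/-! ### The control problem -/

/-- `w` is a mild solution on `[τ,T]` of
`w'(t) = A w(t) + ∫_τ^t K(t-s) w(s) ds + ∫_0^τ K(t-s) ξ(s) ds + B u(t)`, `w(τ) = ξ₀`,
with `X = (ξ₀, ξ)` and `S` the semigroup generated by `A`. -/
def IsMildSolution (T : ℝ) (S : ℝ → H →L[ℂ] H) (K : ℝ → ℝ) (B : U →L[ℂ] H)
    (τ : ℝ) (X : Y H τ) (u : ℝ → U) (w : ℝ → H) : Prop :=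
  MemLp w 2 (volume.restrict (Ioc τ T)) ∧
  ∀ᵐ t ∂(volume.restrict (Ioc τ T)),
    w t = S (t - τ) X.fst
      + (∫ s in τ..t, S (t - s) (∫ σ in τ..s, (K (s - σ) : ℂ) • w σ))
      + (∫ s in τ..t, S (t - s) (∫ σ in (0 : ℝ)..τ, (K (s - σ) : ℂ) • X.snd σ))
      + ∫ s in τ..t, S (t - s) (B (u s))

/-- The quadratic functional `∫_τ^T (⟨Q w(t), w(t)⟩ + ‖u(t)‖²) dt`. -/
def cost (T : ℝ) (Q : H →L[ℂ] H) (τ : ℝ) (u : ℝ → U) (w : ℝ → H) : ℝ :=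
  ∫ t in τ..T, ((inner ℂ (w t) (Q (w t))).re + ‖u t‖ ^ 2)

/-- `(u, w)` is an optimal pair with initial time `τ` and initial datum `X`: the control `u` is in
`L²(τ,T;U)`, `w` is the corresponding state, and the cost is minimal among all admissible pairs. -/
def IsOptimalPair (T : ℝ) (S : ℝ → H →L[ℂ] H) (K : ℝ → ℝ) (B : U →L[ℂ] H) (Q : H →L[ℂ] H)
    (τ : ℝ) (X : Y H τ) (u : ℝ → U) (w : ℝ → H) : Prop :=
  MemLp u 2 (volume.restrict (Ioc τ T)) ∧ IsMildSolution T S K B τ X u w ∧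
  ∀ (v : ℝ → U) (z : ℝ → H), MemLp v 2 (volume.restrict (Ioc τ T)) →
    IsMildSolution T S K B τ X v z → cost T Q τ u w ≤ cost T Q τ v z

/-- The extended history: `ξ` on `[0,τ]` and `w` on `(τ,T]`. -/
def extHist {τ : ℝ} (X : Y H τ) (w : ℝ → H) : ℝ → H :=
  fun s => if s ≤ τ then X.snd s else w s

/-! ### The operators of the solution formula -/

/-- `μ(t) = ∫_0^t e^{(t-s)A} K(s) ds`. -/
def kerMu (S : ℝ → H →L[ℂ] H) (K : ℝ → ℝ) (t : ℝ) : H →L[ℂ] H :=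
  strongInt (fun s => (K s : ℂ) • S (t - s)) 0 t

/-- The iterated convolutions `μ, μ*μ, μ*μ*μ, …`. -/
def muIter (S : ℝ → H →L[ℂ] H) (K : ℝ → ℝ) : ℕ → ℝ → H →L[ℂ] H
  | 0, t => kerMu S K t
  | n + 1, t => strongInt (fun s => (kerMu S K (t - s)).comp (muIter S K n s)) 0 t

/-- The resolvent kernel `R = - μ - μ*μ - μ*μ*μ - …`, that is, the solution of the Volterra equation
`R(t) - ∫_0^t μ(t-s) R(s) ds = - μ(t)`. -/
def kerR (S : ℝ → H →L[ℂ] H) (K : ℝ → ℝ) (t : ℝ) : H →L[ℂ] H :=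
  - ∑' n : ℕ, muIter S K n t

/-- `F(t,τ) = e^{(t-τ)A} - ∫_τ^t R(t-s) e^{(s-τ)A} ds`. -/
def opF (S : ℝ → H →L[ℂ] H) (K : ℝ → ℝ) (t τ : ℝ) : H →L[ℂ] H :=
  S (t - τ) - strongInt (fun s => (kerR S K (t - s)).comp (S (s - τ))) τ t

/-- `G(t,σ,τ) = μ(t-σ) - e^{(t-τ)A} μ(τ-σ)`. -/
def kerG (S : ℝ → H →L[ℂ] H) (K : ℝ → ℝ) (t σ τ : ℝ) : H →L[ℂ] H :=
  kerMu S K (t - σ) - (S (t - τ)).comp (kerMu S K (τ - σ))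

/-- `M(t,σ,τ) = G(t,σ,τ) - ∫_τ^t R(t-s) G(s,σ,τ) ds`. -/
def opM (S : ℝ → H →L[ℂ] H) (K : ℝ → ℝ) (t σ τ : ℝ) : H →L[ℂ] H :=
  kerG S K t σ τ - strongInt (fun s => (kerR S K (t - s)).comp (kerG S K s σ τ)) τ t

/-! ### The operators of the optimal synthesis -/

/-- `L_τ : L²(τ,T;U) → L²(τ,T;H)`, `(L_τ u)(t) = ∫_τ^t F(t,σ) B u(σ) dσ`. -/
def opL (T : ℝ) (S : ℝ → H →L[ℂ] H) (K : ℝ → ℝ) (B : U →L[ℂ] H) (τ : ℝ) :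
    L2 U τ T →L[ℂ] L2 H τ T :=
  opOf (fun u : L2 U τ T => toL2 τ T (fun t => ∫ σ in τ..t, opF S K t σ (B (u σ))))

/-- `L_τ^* Q : L²(τ,T;H) → L²(τ,T;U)`. -/
def opLadjQ (T : ℝ) (S : ℝ → H →L[ℂ] H) (K : ℝ → ℝ) (B : U →L[ℂ] H) (Q : H →L[ℂ] H)
    (τ : ℝ) : L2 H τ T →L[ℂ] L2 U τ T :=
  (ContinuousLinearMap.adjoint (opL T S K B τ)).comp
    (Q.compLpL 2 (volume.restrict (Ioc τ T)))

/-- `Λ_τ = I + L_τ^* Q L_τ` on `L²(τ,T;U)`. -/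
def opLam (T : ℝ) (S : ℝ → H →L[ℂ] H) (K : ℝ → ℝ) (B : U →L[ℂ] H) (Q : H →L[ℂ] H)
    (τ : ℝ) : L2 U τ T →L[ℂ] L2 U τ T :=
  ContinuousLinearMap.id ℂ (L2 U τ T) + (opLadjQ T S K B Q τ).comp (opL T S K B τ)

/-- `Ψ₁(·,τ) x = - Λ_τ⁻¹ L_τ^* Q F(·,τ) x`, an element of `L²(τ,T;U)`. -/
def psi1 (T : ℝ) (S : ℝ → H →L[ℂ] H) (K : ℝ → ℝ) (B : U →L[ℂ] H) (Q : H →L[ℂ] H)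
    (τ : ℝ) (x : H) : L2 U τ T :=
  - Ring.inverse (opLam T S K B Q τ)
      (opLadjQ T S K B Q τ (toL2 τ T (fun t => opF S K t τ x)))

/-- `Ψ₂(·,s,τ) x = - Λ_τ⁻¹ L_τ^* Q M(·,s,τ) x`, an element of `L²(τ,T;U)`. -/
def psi2 (T : ℝ) (S : ℝ → H →L[ℂ] H) (K : ℝ → ℝ) (B : U →L[ℂ] H) (Q : H →L[ℂ] H)
    (s τ : ℝ) (x : H) : L2 U τ T :=
  - Ring.inverse (opLam T S K B Q τ)
      (opLadjQ T S K B Q τ (toL2 τ T (fun t => opM S K t s τ x)))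

/-- `Z₁(t,τ) x = F(t,τ) x + ∫_τ^t F(t,σ) B Ψ₁(σ,τ) x dσ`. -/
def z1 (T : ℝ) (S : ℝ → H →L[ℂ] H) (K : ℝ → ℝ) (B : U →L[ℂ] H) (Q : H →L[ℂ] H)
    (t τ : ℝ) (x : H) : H :=
  opF S K t τ x + ∫ σ in τ..t, opF S K t σ (B (psi1 T S K B Q τ x σ))

/-- `Z₂(t,s,τ) x = M(t,s,τ) x + ∫_τ^t F(t,σ) B Ψ₂(σ,s,τ) x dσ`. -/
def z2 (T : ℝ) (S : ℝ → H →L[ℂ] H) (K : ℝ → ℝ) (B : U →L[ℂ] H) (Q : H →L[ℂ] H)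
    (t s τ : ℝ) (x : H) : H :=
  opM S K t s τ x + ∫ σ in τ..t, opF S K t σ (B (psi2 T S K B Q s τ x σ))

/-! ### The defining formulas of the optimal cost operators

Operator-valued integrals are written weakly, through `⟨· x, y⟩` for `x, y ∈ H`. Lean's
`inner ℂ y x` is linear in `x`, hence it is `⟨x, y⟩`. -/

/-- `P₀(t) = ∫_t^T [Ψ₁(p,t)^* Ψ₁(p,t) + Z₁(p,t)^* Q Z₁(p,t)] dp = ∫_t^T F(p,t)^* Q Z₁(p,t) dp`. -/
def IsP0 (T : ℝ) (S : ℝ → H →L[ℂ] H) (K : ℝ → ℝ) (B : U →L[ℂ] H) (Q : H →L[ℂ] H)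
    (t : ℝ) (P : H →L[ℂ] H) : Prop :=
  ∀ x y : H,
    inner ℂ y (P x) = (∫ p in t..T,
      (inner ℂ (psi1 T S K B Q t y p) (psi1 T S K B Q t x p)
        + inner ℂ (z1 T S K B Q p t y) (Q (z1 T S K B Q p t x)))) ∧
    inner ℂ y (P x) = ∫ p in t..T, inner ℂ (opF S K p t y) (Q (z1 T S K B Q p t x))

/-- `P₁(t,s) = ∫_t^T [Ψ₁(p,t)^* Ψ₂(p,s,t) + Z₁(p,t)^* Q Z₂(p,s,t)] dp
= ∫_t^T F(p,t)^* Q Z₂(p,s,t) dp`. -/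
def IsP1 (T : ℝ) (S : ℝ → H →L[ℂ] H) (K : ℝ → ℝ) (B : U →L[ℂ] H) (Q : H →L[ℂ] H)
    (t s : ℝ) (P : H →L[ℂ] H) : Prop :=
  ∀ x y : H,
    inner ℂ y (P x) = (∫ p in t..T,
      (inner ℂ (psi1 T S K B Q t y p) (psi2 T S K B Q s t x p)
        + inner ℂ (z1 T S K B Q p t y) (Q (z2 T S K B Q p s t x)))) ∧
    inner ℂ y (P x) = ∫ p in t..T, inner ℂ (opF S K p t y) (Q (z2 T S K B Q p s t x))

/-- `P₂(t,s,q) = ∫_t^T [Ψ₂(p,q,t)^* Ψ₂(p,s,t) + Z₂(p,q,t)^* Q Z₂(p,s,t)] dp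
= ∫_t^T M(p,q,t)^* Q Z₂(p,s,t) dp`. -/
def IsP2 (T : ℝ) (S : ℝ → H →L[ℂ] H) (K : ℝ → ℝ) (B : U →L[ℂ] H) (Q : H →L[ℂ] H)
    (t s q : ℝ) (P : H →L[ℂ] H) : Prop :=
  ∀ x y : H,
    inner ℂ y (P x) = (∫ p in t..T,
      (inner ℂ (psi2 T S K B Q q t y p) (psi2 T S K B Q s t x p)
        + inner ℂ (z2 T S K B Q p q t y) (Q (z2 T S K B Q p s t x)))) ∧
    inner ℂ y (P x) = ∫ p in t..T, inner ℂ (opM S K p q t y) (Q (z2 T S K B Q p s t x))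

end VolterraLQ

end

open VolterraLQ ContinuousLinearMap

/-!
The mild equation is `w = f + μ * w`, where `f` is the response of the semigroup to the initial
state, the history and the control. Since `R * μ = μ * R = R + μ` (`kerR_conv_kerMu`,
`kerMu_conv_kerR`), convolution with `R` inverts it: with `F = S - R * S`, the solution is
`w(t) = F(t,τ) ξ₀ + ∫_τ^t F(t,s) (ψ(s) + B u(s)) ds`, where `ψ` is the forcing by the history
(`isMildSolution_iff`). The same computation gives `M(t,σ,τ) = ∫_τ^t F(t,s) K(s-σ) ds`
(`opM_apply`), so `M(·,σ,τ) x` is the free response to the value `x` of the history at the time `σ`.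

The control problem is now the minimization of `⟨Q (f + L u), f + L u⟩ + ‖u‖²` for a free response
`f` in a Hilbert space. Completing the square with `Λ = I + L^* Q L` gives the unique minimizer
`-Λ⁻¹ L^* Q f` and the minimum `⟨C f, f⟩` with `C = Q (I - L Λ⁻¹ L^* Q)` (`lq_cost_ge`). If `E` and
`M_s` are the operators from `H` to `L²(τ,T;H)` given by `F(·,τ)` and `M(·,s,τ)`, then
`P₀ = E^* C E`, `P₁ = E^* C M_s` and `P₂ = M_q^* C M_s`. The family `M_s` is continuous in norm,
because translation is continuous in `L¹` (`exists_bcf_memResp`); hence integrals over the history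
are Bochner integrals and commute with bounded operators.

The optimal pair is characterized by the optimality system `OptSys`: the state equation together
with `u = -B^* p`, where `p(σ) = ∫_σ^T F(s,σ)^* Q w(s) ds` is the costate. The costate is continuous
in norm (`costate_continuousOn`), so the optimal pair has a continuous representative. The system
restricts to later initial times and its solution is unique, which gives the evolution property
(`stateY_flow`), and the feedback law by evaluating the costate at the initial time
(`ctrlY_feedback`).

For the differential equations, consider free responses `f_τ` and `g_τ`, with `w_τ` the optimal
state of `f_τ`, and differentiate `∫_τ^T ⟨Q w_τ, g_τ⟩` in the initial time. This form is symmetric,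
so its increment involves only increments of `f_τ` and `g_τ`, and the control used between the two
initial times (`costForm_sub`); no derivative of `w_τ` in `τ` is needed. On the domain of the
generator `-∂_τ F(·,τ) x = F(·,τ) A x - R(· - τ) x` (`famF_generator`), where `-R(· - τ) = M(·,τ,τ)`
(`opM_diag`), and `-∂_τ M(·,s,τ) x = K(τ-s) F(·,τ) x`. The Lebesgue points enter because the kernel
need only converge in the mean (`IsLebesguePt.meanTendsto`, `hasDerivWithinAt_costForm`).
-/

set_option linter.unusedSectionVars false

noncomputable section

namespace VolterraLQ

section

variable {E E' E'' : Type*} [NormedAddCommGroup E] [NormedSpace ℂ E]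
  [NormedAddCommGroup E'] [NormedSpace ℂ E'] [NormedAddCommGroup E''] [NormedSpace ℂ E'']

/-! ### Strongly continuous families of operators -/

/-- A strongly continuous and uniformly bounded family of operators, indexed by the whole line.
Families that are only meaningful on `[0,T]` are brought into this form by `clp`. -/
structure StrongCont (G : ℝ → E →L[ℂ] E') : Prop where
  cont : ∀ x, Continuous fun t => G t x
  bdd : ∃ C, 0 ≤ C ∧ ∀ t, ‖G t‖ ≤ C

/-- The retraction of the line onto `[0,T]`. -/
def clp (T r : ℝ) : ℝ := max 0 (min T r)

theorem continuous_clp (T : ℝ) : Continuous (clp T) := by unfold clp; fun_prop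

theorem clp_of_mem {T r : ℝ} (h : r ∈ Icc 0 T) : clp T r = r := by
  unfold clp; rw [min_eq_right h.2, max_eq_right h.1]

theorem clp_mem {T : ℝ} (hT : 0 ≤ T) (r : ℝ) : clp T r ∈ Icc 0 T :=
  ⟨le_max_left _ _, max_le hT (min_le_left _ _)⟩

theorem StrongCont.continuous_uncurry {G : ℝ → E →L[ℂ] E'} (hG : StrongCont G) :
    Continuous fun p : ℝ × E => G p.1 p.2 := by
  obtain ⟨C, hC0, hC⟩ := hG.bdd
  rw [continuous_iff_continuousAt]
  rintro ⟨t, x⟩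
  have h1 : Tendsto (fun p : ℝ × E => G p.1 x) (𝓝 (t, x)) (𝓝 (G t x)) :=
    ((hG.cont x).comp continuous_fst).continuousAt
  have h2 : Tendsto (fun p : ℝ × E => G p.1 (p.2 - x)) (𝓝 (t, x)) (𝓝 0) := by
    refine squeeze_zero_norm (a := fun p => C * ‖p.2 - x‖) (fun p => ?_) ?_
    · exact ((G p.1).le_opNorm _).trans (by gcongr; exact hC _)
    · have : Continuous fun p : ℝ × E => C * ‖p.2 - x‖ := by fun_prop
      simpa using this.tendsto (t, x)
  have := h1.add h2
  simp only [add_zero] at this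
  refine this.congr fun p => ?_
  simp

theorem StrongCont.comp_continuous {X : Type*} [TopologicalSpace X] {G : ℝ → E →L[ℂ] E'}
    (hG : StrongCont G) {g : X → ℝ} {h : X → E} (hg : Continuous g) (hh : Continuous h) :
    Continuous fun p => G (g p) (h p) :=
  hG.continuous_uncurry.comp (hg.prodMk hh)

/-- By the uniform boundedness principle, a family that is strongly continuous on `[0,T]` becomes a
`StrongCont` family when it is frozen outside `[0,T]`. -/
theorem strongCont_clp [CompleteSpace E] {T : ℝ} (hT : 0 ≤ T) {f : ℝ → E →L[ℂ] E'}
    (h : ∀ x, ContinuousOn (fun t => f t x) (Icc 0 T)) : StrongCont fun r => f (clp T r) := by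
  have hc : ∀ x, Continuous fun r => f (clp T r) x := fun x =>
    (h x).comp_continuous (continuous_clp T) (clp_mem hT)
  refine ⟨hc, ?_⟩
  obtain ⟨C, hC⟩ := banach_steinhaus (g := fun r : ℝ => f (clp T r)) (fun x => by
    obtain ⟨C, hC⟩ := (isCompact_Icc (a := (0 : ℝ)) (b := T)).exists_bound_of_continuousOn (h x)
    exact ⟨C, fun r => hC _ (clp_mem hT r)⟩)
  exact ⟨C, (norm_nonneg _).trans (hC 0), hC⟩

theorem StrongCont.apply_le {G : ℝ → E →L[ℂ] E'} {C : ℝ} (hC : ∀ t, ‖G t‖ ≤ C) (t : ℝ) (x : E) :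
    ‖G t x‖ ≤ C * ‖x‖ :=
  ((G t).le_opNorm x).trans (by gcongr; exact hC t)

theorem StrongCont.integrable_comp {X : Type*} [MeasurableSpace X] [TopologicalSpace X]
    [OpensMeasurableSpace X] [SecondCountableTopology X]
    {ν : Measure X} {G : ℝ → E →L[ℂ] E'}
    (hG : StrongCont G) {g : X → ℝ} (hg : Continuous g) {φ : X → E} (hφ : Integrable φ ν) :
    Integrable (fun s => G (g s) (φ s)) ν := by
  obtain ⟨C, hC0, hC⟩ := hG.bdd
  refine (hφ.norm.const_mul C).mono' ?_ (ae_of_all _ fun s => StrongCont.apply_le hC _ _)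
  exact hG.continuous_uncurry.comp_aestronglyMeasurable
    (hg.aestronglyMeasurable.prodMk hφ.aestronglyMeasurable)

theorem StrongCont.intervalIntegrable_conv {G : ℝ → E →L[ℂ] E'} (hG : StrongCont G) {φ : ℝ → E}
    {a b : ℝ} (hφ : IntervalIntegrable φ volume a b) (t : ℝ) :
    IntervalIntegrable (fun s => G (t - s) (φ s)) volume a b := by
  rw [intervalIntegrable_iff] at hφ ⊢
  exact hG.integrable_comp (by fun_prop) hφ

/-- Young's inequality for a bounded family; `g` is the argument of the family,
`t - s` or `s - t`. -/
theorem norm_conv_le {G : ℝ → E →L[ℂ] E'} {C : ℝ} (hC : ∀ t, ‖G t‖ ≤ C) {φ : ℝ → E}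
    {a b : ℝ} (hab : a ≤ b) (hφ : IntervalIntegrable φ volume a b) (g : ℝ → ℝ) :
    ‖∫ s in a..b, G (g s) (φ s)‖ ≤ C * ∫ s in a..b, ‖φ s‖ := by
  rw [← intervalIntegral.integral_const_mul]
  exact intervalIntegral.norm_integral_le_of_norm_le hab
    (ae_of_all _ fun s _ => StrongCont.apply_le hC _ _) (hφ.norm.const_mul C)

theorem intervalIntegrable_init {V : Type*} [NormedAddCommGroup V] {φ : ℝ → V} {a b t : ℝ}
    (hφ : IntervalIntegrable φ volume a b) (ht : t ∈ Icc a b) :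
    IntervalIntegrable φ volume a t :=
  hφ.mono_set (by rw [uIcc_of_le ht.1, uIcc_of_le (ht.1.trans ht.2)]
                  exact Icc_subset_Icc le_rfl ht.2)

theorem intervalIntegrable_tail {V : Type*} [NormedAddCommGroup V] {φ : ℝ → V} {a b t : ℝ}
    (hφ : IntervalIntegrable φ volume a b) (ht : t ∈ Icc a b) :
    IntervalIntegrable φ volume t b :=
  hφ.mono_set (by rw [uIcc_of_le ht.2, uIcc_of_le (ht.1.trans ht.2)]
                  exact Icc_subset_Icc ht.1 le_rfl)

/-- Convolutions `t ↦ ∫_a^t G(t-s) φ(s) ds` are continuous. -/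
theorem StrongCont.continuousOn_conv {G : ℝ → E →L[ℂ] E'} (hG : StrongCont G) {φ : ℝ → E}
    {a b : ℝ} (hφ : IntervalIntegrable φ volume a b) :
    ContinuousOn (fun t => ∫ s in a..t, G (t - s) (φ s)) (Icc a b) := by
  rcases lt_or_ge b a with hab | hab
  · simp [Icc_eq_empty (not_le.2 hab)]
  obtain ⟨C, hC0, hC⟩ := hG.bdd
  have hφ' : IntegrableOn φ (Ioc a b) := by
    rwa [intervalIntegrable_iff_integrableOn_Ioc_of_le hab] at hφ
  have key : ContinuousOn (fun t => ∫ s in Ioc a b, (Iic t).indicator (fun s => G (t - s) (φ s)) s)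
      (Icc a b) := by
    intro t₀ _
    refine Tendsto.mono_left ?_ nhdsWithin_le_nhds
    refine tendsto_integral_filter_of_dominated_convergence (fun s => C * ‖φ s‖) ?_ ?_ ?_ ?_
    · refine Eventually.of_forall fun t => AEStronglyMeasurable.indicator ?_ measurableSet_Iic
      exact (hG.integrable_comp (by fun_prop) hφ').aestronglyMeasurable
    · refine Eventually.of_forall fun t => ae_of_all _ fun s => ?_
      refine (norm_indicator_le_norm_self _ _).trans ?_
      exact StrongCont.apply_le hC _ _
    · exact hφ'.norm.const_mul C
    · have : ∀ᵐ s ∂(volume.restrict (Ioc a b)), s ≠ t₀ :=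
        ae_restrict_of_ae (Measure.ae_ne volume t₀)
      filter_upwards [this] with s hs
      have hcs : Tendsto (fun t => G (t - s) (φ s)) (𝓝 t₀) (𝓝 (G (t₀ - s) (φ s))) :=
        ((hG.cont (φ s)).comp (continuous_id.sub continuous_const)).tendsto t₀
      rcases lt_or_gt_of_ne hs with h | h
      · rw [indicator_of_mem (mem_Iic.2 h.le)]
        refine hcs.congr' ?_
        filter_upwards [Ioi_mem_nhds h] with t ht
        rw [indicator_of_mem (mem_Iic.2 (le_of_lt ht))]
      · rw [indicator_of_notMem (by simpa using h)]
        refine tendsto_const_nhds.congr' ?_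
        filter_upwards [Iio_mem_nhds h] with t ht
        rw [indicator_of_notMem (by simpa using ht)]
  refine key.congr fun t ht => ?_
  change _ = ∫ s in Ioc a b, (Iic t).indicator (fun s => G (t - s) (φ s)) s
  rw [intervalIntegral.integral_of_le ht.1, setIntegral_indicator measurableSet_Iic]
  congr 2
  ext s; simp only [mem_inter_iff, mem_Ioc, mem_Iic]
  exact ⟨fun h => ⟨⟨h.1, h.2.trans ht.2⟩, h.2⟩, fun h => ⟨h.1.1, h.2⟩⟩

/-- Fubini's theorem on the triangle `a < σ ≤ s ≤ b`. -/
theorem integral_triangle_swap {h : ℝ → ℝ → E} {a b : ℝ} (hab : a ≤ b)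
    (hh : Integrable (Function.uncurry h)
      ((volume.restrict (Ioc a b)).prod (volume.restrict (Ioc a b)))) :
    ∫ s in a..b, ∫ σ in a..s, h s σ = ∫ σ in a..b, ∫ s in σ..b, h s σ := by
  have hm : MeasurableSet {p : ℝ × ℝ | p.2 ≤ p.1} := measurableSet_le measurable_snd measurable_fst
  have hi := hh.indicator hm
  have hsw := integral_integral_swap (f := fun s σ => {p : ℝ × ℝ | p.2 ≤ p.1}.indicator
    (Function.uncurry h) (s, σ)) (by simpa [Function.uncurry_def] using hi)
  rw [intervalIntegral.integral_of_le hab, intervalIntegral.integral_of_le hab]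
  convert hsw using 1
  · refine setIntegral_congr_fun measurableSet_Ioc fun s hs => ?_
    rw [intervalIntegral.integral_of_le hs.1.le]
    have : ∀ σ, {p : ℝ × ℝ | p.2 ≤ p.1}.indicator (Function.uncurry h) (s, σ)
        = (Iic s).indicator (fun σ => h s σ) σ := fun σ => by simp [indicator_apply]
    simp only [this]
    rw [setIntegral_indicator measurableSet_Iic]
    congr 2
    ext σ; simp only [mem_inter_iff, mem_Ioc, mem_Iic]
    exact ⟨fun h => ⟨⟨h.1, h.2.trans hs.2⟩, h.2⟩, fun h => ⟨h.1.1, h.2⟩⟩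
  · refine setIntegral_congr_fun measurableSet_Ioc fun σ hσ => ?_
    rw [intervalIntegral.integral_of_le hσ.2, ← integral_Icc_eq_integral_Ioc]
    have : ∀ s, {p : ℝ × ℝ | p.2 ≤ p.1}.indicator (Function.uncurry h) (s, σ)
        = (Ici σ).indicator (fun s => h s σ) s := fun s => by simp [indicator_apply]
    simp only [this]
    rw [setIntegral_indicator measurableSet_Ici]
    congr 2
    ext s; simp only [mem_inter_iff, mem_Ioc, mem_Ici, mem_Icc]
    exact ⟨fun h => ⟨⟨hσ.1.trans_le h.1, h.2⟩, h.1⟩, fun h => ⟨h.2, h.1.2⟩⟩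

theorem intervalIntegral_congr_Ioc {f g : ℝ → E} {a b : ℝ} (hab : a ≤ b)
    (h : ∀ s ∈ Ioc a b, f s = g s) : ∫ s in a..b, f s = ∫ s in a..b, g s :=
  intervalIntegral.integral_congr_ae (ae_of_all _ fun s hs => h s (by rwa [uIoc_of_le hab] at hs))

theorem intervalIntegral_congr_ae_Ioc {f g : ℝ → E} {a b : ℝ} (hab : a ≤ b)
    (h : f =ᵐ[volume.restrict (Ioc a b)] g) : ∫ s in a..b, f s = ∫ s in a..b, g s := by
  rw [intervalIntegral.integral_of_le hab, intervalIntegral.integral_of_le hab]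
  exact integral_congr_ae h

/-- Moving a strongly continuous family through a Volterra integral. -/
theorem StrongCont.conv_volterra [CompleteSpace E] [CompleteSpace E'] {G : ℝ → E →L[ℂ] E'}
    (hG : StrongCont G) {h : ℝ → ℝ → E} {a t : ℝ} (hat : a ≤ t)
    (hh : Integrable (Function.uncurry h)
      ((volume.restrict (Ioc a t)).prod (volume.restrict (Ioc a t)))) :
    ∫ s in a..t, G (t - s) (∫ σ in a..s, h s σ)
      = ∫ σ in a..t, ∫ s in σ..t, G (t - s) (h s σ) := by
  rw [← integral_triangle_swap hat (h := fun s σ => G (t - s) (h s σ))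
    (hG.integrable_comp (g := fun p : ℝ × ℝ => t - p.1) (by fun_prop) hh)]
  refine intervalIntegral_congr_ae_Ioc hat ?_
  filter_upwards [hh.prod_right_ae, ae_restrict_mem measurableSet_Ioc] with s hs hsm
  rw [intervalIntegral.integral_of_le hsm.1.le, intervalIntegral.integral_of_le hsm.1.le]
  refine ((G (t - s)).integral_comp_comm ?_).symm
  exact IntegrableOn.mono_set (t := Ioc a t) hs (Ioc_subset_Ioc_right hsm.2)

/-- Associativity of the convolution with strongly continuous families. -/
theorem StrongCont.conv_assoc [CompleteSpace E] [CompleteSpace E'] [CompleteSpace E'']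
    {f : ℝ → E' →L[ℂ] E''} {g : ℝ → E →L[ℂ] E'} {H : ℝ → E →L[ℂ] E''}
    (hf : StrongCont f) (hg : StrongCont g) {T : ℝ}
    (hH : ∀ t ∈ Icc 0 T, ∀ x, H t x = ∫ s in (0 : ℝ)..t, f (t - s) (g s x))
    {φ : ℝ → E} {a t : ℝ} (hat : a ≤ t) (ht : t - a ≤ T) (hφ : IntervalIntegrable φ volume a t) :
    ∫ s in a..t, f (t - s) (∫ σ in a..s, g (s - σ) (φ σ)) = ∫ σ in a..t, H (t - σ) (φ σ) := by
  have hφ' : IntegrableOn φ (Ioc a t) := by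
    rwa [intervalIntegrable_iff_integrableOn_Ioc_of_le hat] at hφ
  rw [hf.conv_volterra hat (h := fun s σ => g (s - σ) (φ σ))
    (hg.integrable_comp (g := fun p : ℝ × ℝ => p.1 - p.2) (by fun_prop) (hφ'.comp_snd _))]
  refine intervalIntegral_congr_Ioc hat fun σ hσ => ?_
  rw [hH (t - σ) ⟨by linarith [hσ.2], by linarith [hσ.1]⟩]
  have := intervalIntegral.integral_comp_sub_right (a := σ) (b := t)
    (fun r => f (t - σ - r) (g r (φ σ))) σ
  rw [sub_self] at this
  rw [← this]
  refine intervalIntegral.integral_congr fun s _ => ?_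
  simp only [sub_sub_sub_cancel_right]

/-- Associativity of the convolution with an integrable scalar kernel. -/
theorem StrongCont.conv_scalar [CompleteSpace E] [CompleteSpace E']
    {G Gk : ℝ → E →L[ℂ] E'} (hG : StrongCont G) {k : ℝ → ℝ} (hk : Integrable k) {T : ℝ}
    (hGk : ∀ t ∈ Icc 0 T, ∀ x, Gk t x = ∫ s in (0 : ℝ)..t, (k s : ℂ) • G (t - s) x)
    {φ : ℝ → E} {a t : ℝ} (hat : a ≤ t) (ht : t - a ≤ T) (hφ : IntervalIntegrable φ volume a t) :
    ∫ s in a..t, G (t - s) (∫ σ in a..s, (k (s - σ) : ℂ) • φ σ)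
      = ∫ σ in a..t, Gk (t - σ) (φ σ) := by
  have hφ' : Integrable ((Ioc a t).indicator φ) := by
    rw [integrable_indicator_iff measurableSet_Ioc]
    rwa [intervalIntegrable_iff_integrableOn_Ioc_of_le hat] at hφ
  have hint : Integrable (fun p : ℝ × ℝ => (k (p.1 - p.2) : ℂ) • (Ioc a t).indicator φ p.2)
      (volume.prod volume) := by
    have := Integrable.convolution_integrand (ContinuousLinearMap.lsmul ℝ ℂ (E := E)).flip hφ'
      (hk.ofReal (𝕜 := ℂ))
    simpa using this
  rw [hG.conv_volterra hat (h := fun s σ => (k (s - σ) : ℂ) • φ σ)]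
  · refine intervalIntegral_congr_Ioc hat fun σ hσ => ?_
    rw [hGk (t - σ) ⟨by linarith [hσ.2], by linarith [hσ.1]⟩]
    have := intervalIntegral.integral_comp_sub_right (a := σ) (b := t)
      (fun r => (k r : ℂ) • G (t - σ - r) (φ σ)) σ
    rw [sub_self] at this
    rw [← this]
    refine intervalIntegral.integral_congr fun s _ => ?_
    simp only [sub_sub_sub_cancel_right, map_smul]
  · have h2 := hint.mono_measure (μ := (volume.restrict (Ioc a t)).prod
      (volume.restrict (Ioc a t))) (Measure.prod_mono Measure.restrict_le_self
        Measure.restrict_le_self)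
    refine h2.congr ?_
    rw [Measure.prod_restrict]
    filter_upwards [ae_restrict_mem (measurableSet_Ioc.prod measurableSet_Ioc)] with p hp
    simp [Function.uncurry_def, indicator_of_mem hp.2]

end

section

variable {E E' E'' : Type*} [NormedAddCommGroup E] [NormedSpace ℂ E]
  [NormedAddCommGroup E'] [NormedSpace ℂ E'] [NormedAddCommGroup E''] [NormedSpace ℂ E'']

/-! ### Strong integrals of operators -/

/-- `opOf f` has the values prescribed by `f` as soon as some bounded operator has them. -/
theorem opOf_apply {f : E → E'} (L : E →L[ℂ] E') (h : ∀ x, L x = f x) (x : E) :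
    opOf f x = f x := by
  have hex : ∃ L : E →L[ℂ] E', ∀ x, L x = f x := ⟨L, h⟩
  rw [opOf, dif_pos hex]
  exact hex.choose_spec x

theorem strongInt_congr {f g : ℝ → E →L[ℂ] E'} {a b : ℝ} (hab : a ≤ b)
    (h : ∀ s ∈ Ioc a b, f s = g s) : strongInt f a b = strongInt g a b := by
  unfold strongInt
  congr 1
  funext x
  exact intervalIntegral_congr_Ioc hab fun s hs => by rw [h s hs]

/-- The strong integral has its intended values, rather than the default value `0` of `opOf`, if the
integrand is strongly integrable with an integrable bound for its norm. -/
theorem strongInt_apply {f : ℝ → E →L[ℂ] E'} {a b : ℝ} (hab : a ≤ b)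
    (hi : ∀ x, IntervalIntegrable (fun s => f s x) volume a b) {g : ℝ → ℝ}
    (hg : IntervalIntegrable g volume a b) (hb : ∀ s ∈ Ioc a b, ‖f s‖ ≤ g s) (x : E) :
    strongInt f a b x = ∫ s in a..b, f s x := by
  let L : E →ₗ[ℂ] E' :=
    { toFun := fun x => ∫ s in a..b, f s x
      map_add' := fun x y => by
        simp only [map_add]; exact intervalIntegral.integral_add (hi x) (hi y)
      map_smul' := fun c x => by
        simp only [map_smul, RingHom.id_apply]; exact intervalIntegral.integral_smul c _ }
  refine opOf_apply (f := fun x => ∫ s in a..b, f s x)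
    (L.mkContinuous (∫ s in a..b, g s) fun x => ?_) (fun x => rfl) x
  change ‖∫ s in a..b, f s x‖ ≤ _
  rw [← intervalIntegral.integral_mul_const]
  refine intervalIntegral.norm_integral_le_of_norm_le hab (ae_of_all _ fun s hs => ?_)
    (hg.mul_const _)
  exact ((f s).le_opNorm x).trans (by gcongr; exact hb s hs)

theorem exists_bound_of_continuousOn_apply [CompleteSpace E] {g : ℝ → E →L[ℂ] E'} {a b : ℝ}
    (hg : ∀ x, ContinuousOn (fun s => g s x) (Icc a b)) :
    ∃ C, 0 ≤ C ∧ ∀ s ∈ Icc a b, ‖g s‖ ≤ C := by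
  obtain ⟨C, hC⟩ := banach_steinhaus (g := fun r : Icc a b => g r) (fun x => by
    obtain ⟨C, hC⟩ := (isCompact_Icc (a := a) (b := b)).exists_bound_of_continuousOn (hg x)
    exact ⟨C, fun r => hC _ r.2⟩)
  exact ⟨max C 0, le_max_right _ _, fun s hs => (hC ⟨s, hs⟩).trans (le_max_left _ _)⟩

/-- Convolution integrals of strongly continuous families have their intended values. The family
`f'` agrees with `f` where it matters and is defined on the whole line. -/
theorem strongInt_conv [CompleteSpace E] {f f' : ℝ → E' →L[ℂ] E''} (hf' : StrongCont f')
    {g : ℝ → E →L[ℂ] E'} {a t : ℝ} (hat : a ≤ t) (heq : ∀ r ∈ Icc 0 (t - a), f r = f' r)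
    (hg : ∀ x, ContinuousOn (fun s => g s x) (Icc a t)) (x : E) :
    strongInt (fun s => (f (t - s)).comp (g s)) a t x = ∫ s in a..t, f' (t - s) (g s x) := by
  obtain ⟨C, hC0, hC⟩ := exists_bound_of_continuousOn_apply hg
  obtain ⟨D, hD0, hD⟩ := hf'.bdd
  rw [strongInt_congr (g := fun s => (f' (t - s)).comp (g s)) hat
    fun s hs => by rw [heq _ ⟨by linarith [hs.2], by linarith [hs.1]⟩]]
  rw [strongInt_apply hat (g := fun _ => D * C) (fun x => ?_)
    intervalIntegrable_const fun s hs => ?_]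
  · rfl
  · exact hf'.intervalIntegrable_conv ((hg x).intervalIntegrable_of_Icc hat) t
  · refine (ContinuousLinearMap.opNorm_comp_le _ _).trans ?_
    gcongr
    exacts [hD _, hC s ⟨hs.1.le, hs.2⟩]

variable {H : Type*} [NormedAddCommGroup H] [InnerProductSpace ℂ H] [CompleteSpace H]
  {T : ℝ} {S : ℝ → H →L[ℂ] H} {K : ℝ → ℝ}

/-! ### The resolvent kernel -/

/-- A strongly continuous semigroup is bounded on `[0,T]`. -/
theorem IsC0Semigroup.strongCont (hS : IsC0Semigroup S) (hT : 0 ≤ T) :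
    StrongCont fun r => S (clp T r) :=
  strongCont_clp hT fun x => (hS.strong_cont x).mono fun _ h => h.1

/-- The kernel `K`, extended by zero outside `(0,T]`. -/
def kerK (T : ℝ) (K : ℝ → ℝ) : ℝ → ℝ := (Ioc 0 T).indicator K

theorem integrable_kerK (hK : IntegrableOn K (Ioc 0 T)) : Integrable (kerK T K) :=
  (integrable_indicator_iff measurableSet_Ioc).2 hK

theorem kerK_of_mem {r : ℝ} (h : r ∈ Ioc 0 T) : kerK T K r = K r := indicator_of_mem h _

theorem kerMu_apply (hT : 0 ≤ T) (hS : IsC0Semigroup S) (hK : IntegrableOn K (Ioc 0 T))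
    {t : ℝ} (ht : t ∈ Icc 0 T) (x : H) :
    kerMu S K t x = ∫ s in (0 : ℝ)..t, (kerK T K s : ℂ) • S (clp T (t - s)) x := by
  have hSc := hS.strongCont hT
  obtain ⟨C, hC0, hC⟩ := hSc.bdd
  have hk := integrable_kerK hK
  rw [kerMu, strongInt_congr (g := fun s => (kerK T K s : ℂ) • S (clp T (t - s))) ht.1
    fun s hs => by
      rw [kerK_of_mem ⟨hs.1, hs.2.trans ht.2⟩, clp_of_mem ⟨by linarith [hs.2], by
        linarith [hs.1, ht.2]⟩]]
  rw [strongInt_apply ht.1 (g := fun s => ‖kerK T K s‖ * C) (fun x => ?_)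
    (hk.norm.intervalIntegrable.mul_const C) fun s _ => ?_]
  · rfl
  · have := hSc.intervalIntegrable_conv (a := 0) (b := t) (φ := fun s => (kerK T K s : ℂ) • x)
      ((hk.ofReal (𝕜 := ℂ)).smul_const x).intervalIntegrable t
    simpa using this
  · rw [norm_smul, Complex.norm_real]
    gcongr
    exact hC _

theorem kerMu_continuousOn (hT : 0 ≤ T) (hS : IsC0Semigroup S) (hK : IntegrableOn K (Ioc 0 T))
    (x : H) : ContinuousOn (fun t => kerMu S K t x) (Icc 0 T) := by
  have h := (hS.strongCont hT).continuousOn_conv (a := 0) (b := T)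
    (φ := fun s => (kerK T K s : ℂ) • x)
    (((integrable_kerK hK).ofReal (𝕜 := ℂ)).smul_const x).intervalIntegrable
  refine h.congr fun t ht => ?_
  rw [kerMu_apply hT hS hK ht]
  simp

theorem muIter_continuousOn (hT : 0 ≤ T) (hS : IsC0Semigroup S) (hK : IntegrableOn K (Ioc 0 T))
    (n : ℕ) : ∀ x : H, ContinuousOn (fun t => muIter S K n t x) (Icc 0 T) := by
  have hmu := strongCont_clp hT (kerMu_continuousOn hT hS hK)
  induction n with
  | zero => exact kerMu_continuousOn hT hS hK
  | succ n ih =>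
    intro x
    have h := hmu.continuousOn_conv ((ih x).intervalIntegrable_of_Icc hT)
    refine h.congr fun t ht => ?_
    change strongInt (fun s => (kerMu S K (t - s)).comp (muIter S K n s)) 0 t x = _
    rw [strongInt_conv hmu ht.1 (fun r hr => ?_) (fun x => (ih x).mono (Icc_subset_Icc_right ht.2))]
    rw [clp_of_mem ⟨hr.1, by linarith [hr.2, ht.2]⟩]

theorem muIter_succ_apply (hT : 0 ≤ T) (hS : IsC0Semigroup S) (hK : IntegrableOn K (Ioc 0 T))
    (n : ℕ) {t : ℝ} (ht : t ∈ Icc 0 T) (x : H) :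
    muIter S K (n + 1) t x
      = ∫ s in (0 : ℝ)..t, kerMu S K (clp T (t - s)) (muIter S K n s x) := by
  have hmu := strongCont_clp hT (kerMu_continuousOn hT hS hK)
  change strongInt (fun s => (kerMu S K (t - s)).comp (muIter S K n s)) 0 t x = _
  rw [strongInt_conv hmu ht.1 (fun r hr => ?_)
    (fun x => (muIter_continuousOn hT hS hK n x).mono (Icc_subset_Icc_right ht.2))]
  rw [clp_of_mem ⟨hr.1, by linarith [hr.2, ht.2]⟩]

/-- The iterates may also be defined with the factor `μ` on the right. This is the associativity of
the convolution, and gives both resolvent equations. -/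
theorem muIter_succ_apply' (hT : 0 ≤ T) (hS : IsC0Semigroup S) (hK : IntegrableOn K (Ioc 0 T))
    (n : ℕ) : ∀ t ∈ Icc 0 T, ∀ x : H, muIter S K (n + 1) t x
      = ∫ s in (0 : ℝ)..t, muIter S K n (clp T (t - s)) (kerMu S K (clp T s) x) := by
  have hmu := strongCont_clp hT (kerMu_continuousOn hT hS hK)
  induction n with
  | zero =>
    intro t ht x
    rw [muIter_succ_apply hT hS hK 0 ht]
    refine intervalIntegral_congr_Ioc ht.1 fun s hs => ?_
    rw [clp_of_mem (r := s) ⟨hs.1.le, hs.2.trans ht.2⟩]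
    rfl
  | succ n ih =>
    intro t ht x
    rw [muIter_succ_apply hT hS hK (n + 1) ht]
    have hn := strongCont_clp hT (muIter_continuousOn hT hS hK n)
    have := hmu.conv_assoc hn (H := fun r => muIter S K (n + 1) (clp T r)) (T := T)
      (fun t ht x => ?_) (φ := fun s => kerMu S K (clp T s) x) (a := 0) (t := t) ht.1
      (by linarith [ht.2]) ((hmu.cont x).intervalIntegrable _ _)
    · rw [← this]
      refine intervalIntegral_congr_Ioc ht.1 fun s hs => ?_
      rw [ih s ⟨hs.1.le, hs.2.trans ht.2⟩]
    · rw [clp_of_mem ht, muIter_succ_apply hT hS hK n ht]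
      refine intervalIntegral_congr_Ioc ht.1 fun s hs => ?_
      rw [clp_of_mem (r := s) ⟨hs.1.le, hs.2.trans ht.2⟩]

/-- The iterates of a Volterra kernel decay factorially, so that the Neumann series for `R`
converges whatever the size of the kernel. -/
theorem exists_muIter_norm_le (hT : 0 ≤ T) (hS : IsC0Semigroup S)
    (hK : IntegrableOn K (Ioc 0 T)) : ∃ C, 0 ≤ C ∧ (∀ r, ‖kerMu S K (clp T r)‖ ≤ C) ∧
      ∀ n, ∀ t ∈ Icc 0 T, ‖muIter S K n t‖ ≤ C ^ (n + 1) * (t ^ n / n.factorial) := by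
  have hmu := strongCont_clp hT (kerMu_continuousOn hT hS hK)
  obtain ⟨C, hC0, hC⟩ := hmu.bdd
  refine ⟨C, hC0, hC, fun n => ?_⟩
  induction n with
  | zero =>
    intro t ht
    have := hC t
    rw [clp_of_mem ht] at this
    simpa [muIter] using this
  | succ n ih =>
    intro t ht
    refine ContinuousLinearMap.opNorm_le_bound _ (by have := ht.1; positivity) fun x => ?_
    rw [muIter_succ_apply hT hS hK n ht]
    have hint : ∫ s in (0 : ℝ)..t, C ^ (n + 2) * (s ^ n / n.factorial) * ‖x‖
        = C ^ (n + 1 + 1) * (t ^ (n + 1) / (n + 1).factorial) * ‖x‖ := by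
      rw [intervalIntegral.integral_mul_const, intervalIntegral.integral_const_mul,
        intervalIntegral.integral_div, integral_pow, Nat.factorial_succ]
      push_cast
      field_simp
      simp
    rw [← hint]
    refine intervalIntegral.norm_integral_le_of_norm_le ht.1 (ae_of_all _ fun s hs => ?_)
      (Continuous.intervalIntegrable (by fun_prop) _ _)
    refine (StrongCont.apply_le hC _ _).trans ?_
    have h1 := (muIter S K n s).le_of_opNorm_le (ih s ⟨hs.1.le, hs.2.trans ht.2⟩) x
    calc C * ‖muIter S K n s x‖ ≤ C * (C ^ (n + 1) * (s ^ n / n.factorial) * ‖x‖) := by gcongr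
      _ = _ := by ring

theorem summable_muIter_bound (C T c : ℝ) :
    Summable fun n : ℕ => C ^ (n + 1) * (T ^ n / n.factorial) * c := by
  have := (Real.summable_pow_div_factorial (C * T)).mul_left (C * c)
  refine this.congr fun n => ?_
  rw [mul_pow]; ring

/-- The series that defines `R` converges. -/
theorem kerR_hasSum (hT : 0 ≤ T) (hS : IsC0Semigroup S) (hK : IntegrableOn K (Ioc 0 T))
    {t : ℝ} (ht : t ∈ Icc 0 T) (x : H) :
    HasSum (fun n => muIter S K n t x) (-(kerR S K t x)) := by
  obtain ⟨C, hC0, -, hC⟩ := exists_muIter_norm_le hT hS hK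
  have hs : Summable fun n => muIter S K n t :=
    Summable.of_norm_bounded (by simpa using summable_muIter_bound C t 1) fun n => hC n t ht
  have := hs.hasSum.mapL (ContinuousLinearMap.apply ℂ H x)
  simpa [kerR] using this

/-- The series for `R` converges uniformly on `[0,T]`. -/
theorem kerR_continuousOn (hT : 0 ≤ T) (hS : IsC0Semigroup S) (hK : IntegrableOn K (Ioc 0 T))
    (x : H) : ContinuousOn (fun t => kerR S K t x) (Icc 0 T) := by
  obtain ⟨C, hC0, -, hC⟩ := exists_muIter_norm_le hT hS hK
  have h := continuousOn_tsum (fun n => muIter_continuousOn hT hS hK n x)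
    (summable_muIter_bound C T ‖x‖) (fun n t ht => by
      refine ((muIter S K n t).le_of_opNorm_le (hC n t ht) x).trans ?_
      have := ht.1
      gcongr
      exact ht.2)
  refine h.neg.congr fun t ht => ?_
  change kerR S K t x = - ∑' n, muIter S K n t x
  rw [(kerR_hasSum hT hS hK ht x).tsum_eq, neg_neg]

theorem strongCont_kerMu (hT : 0 ≤ T) (hS : IsC0Semigroup S) (hK : IntegrableOn K (Ioc 0 T)) :
    StrongCont fun r => kerMu S K (clp T r) := strongCont_clp hT (kerMu_continuousOn hT hS hK)

theorem strongCont_kerR (hT : 0 ≤ T) (hS : IsC0Semigroup S) (hK : IntegrableOn K (Ioc 0 T)) :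
    StrongCont fun r => kerR S K (clp T r) := strongCont_clp hT (kerR_continuousOn hT hS hK)

theorem kerR_add_kerMu_hasSum (hT : 0 ≤ T) (hS : IsC0Semigroup S)
    (hK : IntegrableOn K (Ioc 0 T)) {t : ℝ} (ht : t ∈ Icc 0 T) (x : H) :
    HasSum (fun n => muIter S K (n + 1) t x) (-(kerR S K t x + kerMu S K t x)) := by
  have := (hasSum_nat_add_iff' 1).2 (kerR_hasSum hT hS hK ht x)
  convert this using 1
  simp [muIter]
  abel

/-- The resolvent equation `μ * R = R + μ`. -/
theorem kerMu_conv_kerR (hT : 0 ≤ T) (hS : IsC0Semigroup S) (hK : IntegrableOn K (Ioc 0 T))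
    {t : ℝ} (ht : t ∈ Icc 0 T) (x : H) :
    ∫ s in (0 : ℝ)..t, kerMu S K (clp T (t - s)) (kerR S K (clp T s) x)
      = kerR S K t x + kerMu S K t x := by
  obtain ⟨C, hC0, hCm, hC⟩ := exists_muIter_norm_le hT hS hK
  have h := intervalIntegral.hasSum_integral_of_dominated_convergence (a := 0) (b := t)
    (μ := volume)
    (F := fun n s => kerMu S K (clp T (t - s)) (muIter S K n (clp T s) x))
    (f := fun s => kerMu S K (clp T (t - s)) (-(kerR S K (clp T s) x)))
    (fun n _ => C * (C ^ (n + 1) * (T ^ n / n.factorial) * ‖x‖)) (fun n => ?_) (fun n => ?_)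
    (ae_of_all _ fun s _ => (summable_muIter_bound C T ‖x‖).mul_left C) ?_
    (ae_of_all _ fun s _ => ?_)
  · have h2 := h.unique ((kerR_add_kerMu_hasSum hT hS hK ht x).congr_fun fun n => by
      rw [muIter_succ_apply hT hS hK n ht]
      refine intervalIntegral_congr_Ioc ht.1 fun s hs => ?_
      rw [clp_of_mem (r := s) ⟨hs.1.le, hs.2.trans ht.2⟩])
    simp only [map_neg, intervalIntegral.integral_neg] at h2
    exact neg_injective h2
  · exact ((strongCont_kerMu hT hS hK).comp_continuous (by fun_prop)
      ((strongCont_clp hT (muIter_continuousOn hT hS hK n)).cont x)).aestronglyMeasurable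
  · refine ae_of_all _ fun s _ => (StrongCont.apply_le hCm _ _).trans ?_
    gcongr
    have hm := clp_mem hT s
    refine ((muIter S K n _).le_of_opNorm_le (hC n _ hm) x).trans ?_
    have := hm.1
    gcongr
    exact hm.2
  · simp
  · exact (kerR_hasSum hT hS hK (clp_mem hT s) x).mapL (kerMu S K (clp T (t - s)))

/-- The resolvent equation `R * μ = R + μ`. -/
theorem kerR_conv_kerMu (hT : 0 ≤ T) (hS : IsC0Semigroup S) (hK : IntegrableOn K (Ioc 0 T))
    {t : ℝ} (ht : t ∈ Icc 0 T) (x : H) :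
    ∫ s in (0 : ℝ)..t, kerR S K (clp T (t - s)) (kerMu S K (clp T s) x)
      = kerR S K t x + kerMu S K t x := by
  obtain ⟨C, hC0, hCm, hC⟩ := exists_muIter_norm_le hT hS hK
  have h := intervalIntegral.hasSum_integral_of_dominated_convergence (a := 0) (b := t)
    (μ := volume)
    (F := fun n s => muIter S K n (clp T (t - s)) (kerMu S K (clp T s) x))
    (f := fun s => -(kerR S K (clp T (t - s)) (kerMu S K (clp T s) x)))
    (fun n _ => C ^ (n + 1) * (T ^ n / n.factorial) * (C * ‖x‖)) (fun n => ?_) (fun n => ?_)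
    (ae_of_all _ fun s _ => (summable_muIter_bound C T _)) ?_ (ae_of_all _ fun s _ => ?_)
  · have h2 := h.unique ((kerR_add_kerMu_hasSum hT hS hK ht x).congr_fun fun n => by
      rw [muIter_succ_apply' hT hS hK n t ht])
    simp only [intervalIntegral.integral_neg] at h2
    exact neg_injective h2
  · exact ((strongCont_clp hT (muIter_continuousOn hT hS hK n)).comp_continuous (by fun_prop)
      ((strongCont_kerMu hT hS hK).cont x)).aestronglyMeasurable
  · refine ae_of_all _ fun s _ => ?_
    have hm := clp_mem hT (t - s)
    refine ((muIter S K n _).le_of_opNorm_le (hC n _ hm) _).trans ?_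
    have := hm.1
    gcongr
    · exact hm.2
    · exact StrongCont.apply_le hCm _ _
  · simp
  · exact kerR_hasSum hT hS hK (clp_mem hT (t - s)) _

end

section

variable {H U : Type*} [NormedAddCommGroup H] [InnerProductSpace ℂ H] [CompleteSpace H]
  [NormedAddCommGroup U] [InnerProductSpace ℂ U] [CompleteSpace U]
  {T : ℝ} {S : ℝ → H →L[ℂ] H} {K : ℝ → ℝ}

/-! ### The solution family `F` and the kernel `M` -/

/-- The solution family `F(r) = F(r,0)`, frozen outside `[0,T]`. -/
def famF (T : ℝ) (S : ℝ → H →L[ℂ] H) (K : ℝ → ℝ) (r : ℝ) : H →L[ℂ] H := opF S K (clp T r) 0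

theorem opF_apply (hT : 0 ≤ T) (hS : IsC0Semigroup S) (hK : IntegrableOn K (Ioc 0 T))
    {τ t : ℝ} (hτt : τ ≤ t) (ht : t - τ ≤ T) (x : H) :
    opF S K t τ x = S (clp T (t - τ)) x
      - ∫ s in τ..t, kerR S K (clp T (t - s)) (S (clp T (s - τ)) x) := by
  have hcl : ∀ s ∈ Icc τ t, clp T (s - τ) = s - τ := fun s hs =>
    clp_of_mem ⟨by linarith [hs.1], by linarith [hs.2]⟩
  rw [opF, sub_apply, hcl t ⟨hτt, le_rfl⟩]
  rw [strongInt_conv (strongCont_kerR hT hS hK) hτt (fun r hr => ?_) (fun x => ?_)]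
  · congr 1
    refine intervalIntegral_congr_Ioc hτt fun s hs => ?_
    rw [hcl s ⟨hs.1.le, hs.2⟩]
  · rw [clp_of_mem ⟨hr.1, by linarith [hr.2]⟩]
  · refine (hS.strong_cont x).comp (by fun_prop) fun s hs => ?_
    simpa using hs.1

/-- The operator `F(t,τ)` depends on `t - τ` only. -/
theorem opF_eq_famF (hT : 0 ≤ T) (hS : IsC0Semigroup S) (hK : IntegrableOn K (Ioc 0 T))
    {τ t : ℝ} (hτt : τ ≤ t) (ht : t - τ ≤ T) : opF S K t τ = famF T S K (t - τ) := by
  ext x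
  rw [famF, clp_of_mem ⟨by linarith, ht⟩, opF_apply hT hS hK hτt ht,
    opF_apply hT hS hK (by linarith) (by linarith), sub_zero]
  have := intervalIntegral.integral_comp_sub_right (a := τ) (b := t)
    (fun s => kerR S K (clp T (t - τ - s)) (S (clp T (s - 0)) x)) τ
  rw [sub_self] at this
  rw [← this]
  simp only [sub_zero, sub_sub_sub_cancel_right]

theorem famF_apply (hT : 0 ≤ T) (hS : IsC0Semigroup S) (hK : IntegrableOn K (Ioc 0 T))
    {t : ℝ} (ht : t ∈ Icc 0 T) (x : H) :
    famF T S K t x = S (clp T t) x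
      - ∫ s in (0 : ℝ)..t, kerR S K (clp T (t - s)) (S (clp T s) x) := by
  rw [famF, clp_of_mem ht, opF_apply hT hS hK ht.1 (by linarith [ht.2])]
  simp [clp_of_mem ht]

theorem strongCont_famF (hT : 0 ≤ T) (hS : IsC0Semigroup S) (hK : IntegrableOn K (Ioc 0 T)) :
    StrongCont (famF T S K) := by
  refine strongCont_clp (f := fun t => opF S K t 0) hT fun x => ?_
  have h := (strongCont_kerR hT hS hK).continuousOn_conv (a := 0) (b := T)
    (((hS.strongCont hT).cont x).intervalIntegrable _ _)
  refine (((hS.strongCont hT).cont x).continuousOn.sub h).congr fun t ht => ?_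
  exact ((by rw [famF, clp_of_mem ht] : opF S K t 0 x = famF T S K t x)).trans
    (famF_apply hT hS hK ht x)

theorem famF_zero (hT : 0 ≤ T) (hS : IsC0Semigroup S) (hK : IntegrableOn K (Ioc 0 T)) :
    famF T S K 0 = ContinuousLinearMap.id ℂ H := by
  ext x
  rw [famF_apply hT hS hK ⟨le_rfl, hT⟩, clp_of_mem ⟨le_rfl, hT⟩, hS.map_zero]
  simp

/-- `S * φ - R * (S * φ) = F * φ`. -/
theorem conv_resolve (hT : 0 ≤ T) (hS : IsC0Semigroup S) (hK : IntegrableOn K (Ioc 0 T))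
    {φ : ℝ → H} {a t : ℝ} (hat : a ≤ t) (ht : t - a ≤ T) (hφ : IntervalIntegrable φ volume a t) :
    (∫ s in a..t, S (clp T (t - s)) (φ s))
      - ∫ s in a..t, kerR S K (clp T (t - s)) (∫ σ in a..s, S (clp T (s - σ)) (φ σ))
      = ∫ s in a..t, famF T S K (t - s) (φ s) := by
  rw [(strongCont_kerR hT hS hK).conv_assoc (hS.strongCont hT)
    (H := fun r => S (clp T r) - famF T S K r) (T := T) (fun t ht x => ?_) hat ht hφ]
  · rw [← intervalIntegral.integral_sub ((hS.strongCont hT).intervalIntegrable_conv hφ t)]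
    · simp
    · simpa using ((hS.strongCont hT).intervalIntegrable_conv hφ t).sub
        ((strongCont_famF hT hS hK).intervalIntegrable_conv hφ t)
  · rw [sub_apply, famF_apply hT hS hK ht]
    simp

/-- The kernel `G` is the response of the semigroup, over `[τ,t]`, to a value of the history at the
time `σ`. -/
theorem kerG_apply (hT : 0 ≤ T) (hS : IsC0Semigroup S) (hK : IntegrableOn K (Ioc 0 T))
    {σ τ t : ℝ} (hσ : 0 ≤ σ) (hστ : σ ≤ τ) (hτt : τ ≤ t) (ht : t ≤ T) (x : H) :
    kerG S K t σ τ x = ∫ s in τ..t, S (clp T (t - s)) ((kerK T K (s - σ) : ℂ) • x) := by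
  have hk := (integrable_kerK hK).ofReal (𝕜 := ℂ)
  have hSc := hS.strongCont hT
  rw [kerG, sub_apply, ContinuousLinearMap.comp_apply,
    kerMu_apply hT hS hK ⟨by linarith, by linarith⟩,
    kerMu_apply hT hS hK (t := τ - σ) ⟨by linarith, by linarith⟩]
  have hi : ∀ a b c : ℝ, IntervalIntegrable
      (fun s => (kerK T K s : ℂ) • S (clp T (c - s)) x) volume a b := fun a b c => by
    have := hSc.intervalIntegrable_conv (a := a) (b := b) (φ := fun s => (kerK T K s : ℂ) • x)
      (hk.smul_const x).intervalIntegrable c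
    simpa using this
  have h1 : S (t - τ) (∫ s in (0 : ℝ)..(τ - σ), (kerK T K s : ℂ) • S (clp T (τ - σ - s)) x)
      = ∫ s in (0 : ℝ)..(τ - σ), (kerK T K s : ℂ) • S (clp T (t - σ - s)) x := by
    rw [← ContinuousLinearMap.intervalIntegral_comp_comm _ (hi _ _ _)]
    refine intervalIntegral_congr_Ioc (by linarith) fun s hs => ?_
    rw [map_smul, clp_of_mem ⟨by linarith [hs.2], by linarith [hs.1]⟩,
      clp_of_mem ⟨by linarith [hs.2], by linarith [hs.1]⟩,
      show t - σ - s = (t - τ) + (τ - σ - s) by ring,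
      hS.map_add _ _ (by linarith) (by linarith [hs.2])]
    rfl
  rw [h1, intervalIntegral.integral_interval_sub_left (hi _ _ _) (hi _ _ _)]
  rw [← intervalIntegral.integral_comp_sub_right
    (fun s => (kerK T K s : ℂ) • S (clp T (t - σ - s)) x) σ]
  simp only [map_smul, sub_sub_sub_cancel_right]

theorem intervalIntegrable_kerK_smul (hK : IntegrableOn K (Ioc 0 T)) (σ a b : ℝ) (x : H) :
    IntervalIntegrable (fun s => (kerK T K (s - σ) : ℂ) • x) volume a b :=
  ((((integrable_kerK hK).comp_sub_right σ).ofReal (𝕜 := ℂ)).smul_const x).intervalIntegrable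

theorem kerG_continuousOn (hT : 0 ≤ T) (hS : IsC0Semigroup S) (hK : IntegrableOn K (Ioc 0 T))
    {σ τ : ℝ} (hσ : 0 ≤ σ) (hστ : σ ≤ τ) (x : H) :
    ContinuousOn (fun t => kerG S K t σ τ x) (Icc τ T) :=
  ((hS.strongCont hT).continuousOn_conv (intervalIntegrable_kerK_smul hK σ τ T x)).congr
    fun _ ht => kerG_apply hT hS hK hσ hστ ht.1 ht.2 x

theorem opM_apply_resolve (hT : 0 ≤ T) (hS : IsC0Semigroup S) (hK : IntegrableOn K (Ioc 0 T))
    {σ τ t : ℝ} (hσ : 0 ≤ σ) (hστ : σ ≤ τ) (hτt : τ ≤ t) (ht : t ≤ T) (x : H) :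
    opM S K t σ τ x = kerG S K t σ τ x
      - ∫ s in τ..t, kerR S K (clp T (t - s)) (kerG S K s σ τ x) := by
  rw [opM, sub_apply]
  rw [strongInt_conv (strongCont_kerR hT hS hK) hτt (fun r hr => ?_) (fun x => ?_)]
  · rw [clp_of_mem ⟨hr.1, by linarith [hr.2]⟩]
  · exact (kerG_continuousOn hT hS hK hσ hστ x).mono (Icc_subset_Icc_right ht)

/-- `M(t,σ,τ) = ∫_τ^t F(t-s) K(s-σ) ds`. -/
theorem opM_apply (hT : 0 ≤ T) (hS : IsC0Semigroup S) (hK : IntegrableOn K (Ioc 0 T))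
    {σ τ t : ℝ} (hσ : 0 ≤ σ) (hστ : σ ≤ τ) (hτt : τ ≤ t) (ht : t ≤ T) (x : H) :
    opM S K t σ τ x = ∫ s in τ..t, famF T S K (t - s) ((kerK T K (s - σ) : ℂ) • x) := by
  rw [opM_apply_resolve hT hS hK hσ hστ hτt ht, ← conv_resolve hT hS hK hτt (by linarith)
    (intervalIntegrable_kerK_smul hK σ τ t x), kerG_apply hT hS hK hσ hστ hτt ht]
  congr 1
  refine intervalIntegral_congr_Ioc hτt fun s hs => ?_
  rw [kerG_apply hT hS hK hσ hστ hs.1.le (hs.2.trans ht)]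

/-- On the diagonal the kernel `M` is the resolvent kernel, up to sign. -/
theorem opM_diag (hT : 0 ≤ T) (hS : IsC0Semigroup S) (hK : IntegrableOn K (Ioc 0 T))
    {σ t : ℝ} (hσ : 0 ≤ σ) (hσt : σ ≤ t) (ht : t ≤ T) (x : H) :
    opM S K t σ σ x = -(kerR S K (clp T (t - σ)) x) := by
  have hG : ∀ s ∈ Icc σ t, kerG S K s σ σ x = kerMu S K (s - σ) x := fun s hs => by
    rw [kerG, sub_self]
    simp [kerMu, strongInt]
    have : opOf (fun _ : H => (0 : H)) = 0 := by
      ext x; rw [opOf_apply (f := fun _ : H => (0 : H)) 0 (fun _ => rfl)]; rfl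
    simp [this]
  have hmem : t - σ ∈ Icc 0 T := ⟨by linarith, by linarith⟩
  rw [opM_apply_resolve hT hS hK hσ le_rfl hσt ht, hG t ⟨hσt, le_rfl⟩, clp_of_mem hmem]
  have h1 := kerR_conv_kerMu hT hS hK hmem x
  have := intervalIntegral.integral_comp_sub_right (a := σ) (b := t)
    (fun s => kerR S K (clp T (t - σ - s)) (kerMu S K (clp T s) x)) σ
  rw [sub_self, h1] at this
  have h2 : ∫ s in σ..t, kerR S K (clp T (t - s)) (kerG S K s σ σ x)
      = ∫ s in σ..t, kerR S K (clp T (t - σ - (s - σ))) (kerMu S K (clp T (s - σ)) x) :=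
    intervalIntegral_congr_Ioc hσt fun s hs => by
      rw [hG s ⟨hs.1.le, hs.2⟩, sub_sub_sub_cancel_right,
        clp_of_mem (r := s - σ) ⟨by linarith [hs.1], by linarith [hs.2]⟩]
  rw [h2, this]
  abel

/-! ### The generator -/

/-- The fundamental theorem of calculus for an orbit that starts in the domain. Only the right
derivative of the orbit is at hand, and it is continuous. -/
theorem IsGenerator.integral_eq {A : H →ₗ.[ℂ] H} (hS : IsC0Semigroup S) (hA : IsGenerator S A)
    (x : A.domain) {t : ℝ} (ht : 0 ≤ t) :
    ∫ s in (0 : ℝ)..t, S s (A x) = S t x - x := by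
  have hA' := (hA x (A x)).1 ⟨x.2, rfl⟩
  have h0 : (S 0 (x : H)) = x := by rw [hS.map_zero]; rfl
  have hmain := intervalIntegral.integral_eq_sub_of_hasDeriv_right (a := 0) (b := t)
    (f := fun s => S s (x : H)) (f' := fun s => S s (A x)) ?_ ?_ ?_
  · rw [hmain, h0]
  · rw [uIcc_of_le ht]
    exact (hS.strong_cont x).mono fun s hs => hs.1
  · intro s hs
    rw [min_eq_left ht, max_eq_right ht] at hs
    rw [hasDerivWithinAt_iff_tendsto_slope' (by simp)]
    have h1 : Tendsto (fun r => r - s) (𝓝[>] s) (𝓝[>] 0) := by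
      refine tendsto_nhdsWithin_iff.2 ⟨?_, ?_⟩
      · have : Tendsto (fun r => r - s) (𝓝 s) (𝓝 (s - s)) := by
          exact (continuous_id.sub continuous_const).tendsto s
        rw [sub_self] at this
        exact this.mono_left nhdsWithin_le_nhds
      · filter_upwards [self_mem_nhdsWithin] with r hr
        simpa using hr
    have h2 := ((S s).continuous.tendsto _).comp (hA'.comp h1)
    refine h2.congr' ?_
    filter_upwards [self_mem_nhdsWithin] with r hr
    have hr' : s < r := hr
    have h3 : S r (x : H) = S s (S (r - s) x) := by
      have := hS.map_add s (r - s) hs.1.le (by linarith)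
      rw [add_sub_cancel] at this
      rw [this]; rfl
    simp only [Function.comp_apply, map_smul, map_sub, slope_def_module, h3]
    rw [← Complex.ofReal_inv, Complex.coe_smul]
  · refine ContinuousOn.intervalIntegrable ?_
    rw [uIcc_of_le ht]
    exact (hS.strong_cont _).mono fun s hs => hs.1

/-- The solution family on the domain of the generator:
`F(t) x = x + ∫_0^t (F(s) A x - R(s) x) ds`. -/
theorem famF_generator (hT : 0 ≤ T) (hS : IsC0Semigroup S) (hK : IntegrableOn K (Ioc 0 T))
    {A : H →ₗ.[ℂ] H} (hA : IsGenerator S A) (x : A.domain) {t : ℝ} (ht : t ∈ Icc 0 T) :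
    famF T S K t x = x + ∫ s in (0 : ℝ)..t,
      (famF T S K s (A x) - kerR S K (clp T s) x) := by
  have hSc := hS.strongCont hT
  have hRc := strongCont_kerR hT hS hK
  have hFc := strongCont_famF hT hS hK
  have hSx : ∀ s ∈ Icc 0 T, S (clp T s) (x : H)
      = x + ∫ σ in (0 : ℝ)..s, S (clp T (s - σ)) (A x) := fun s hs => by
    rw [intervalIntegral.integral_comp_sub_left (fun r => S (clp T r) (A x)), sub_self, sub_zero,
      clp_of_mem hs]
    have : ∫ r in (0 : ℝ)..s, S (clp T r) (A x) = ∫ r in (0 : ℝ)..s, S r (A x) :=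
      intervalIntegral_congr_Ioc hs.1 fun r hr => by rw [clp_of_mem ⟨hr.1.le, hr.2.trans hs.2⟩]
    rw [this, hA.integral_eq hS x hs.1]
    abel
  have hc : IntervalIntegrable (fun _ : ℝ => A x) volume 0 t := intervalIntegrable_const
  have hconv : ContinuousOn (fun s => ∫ σ in (0 : ℝ)..s, S (clp T (s - σ)) (A x)) (Icc 0 t) :=
    hSc.continuousOn_conv hc
  rw [famF_apply hT hS hK ht, hSx t ht]
  have h1 : ∫ s in (0 : ℝ)..t, kerR S K (clp T (t - s)) (S (clp T s) (x : H))
      = (∫ s in (0 : ℝ)..t, kerR S K (clp T (t - s)) (x : H))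
        + ∫ s in (0 : ℝ)..t, kerR S K (clp T (t - s))
          (∫ σ in (0 : ℝ)..s, S (clp T (s - σ)) (A x)) := by
    rw [← intervalIntegral.integral_add
      (hRc.intervalIntegrable_conv intervalIntegrable_const t)
      (hRc.intervalIntegrable_conv (hconv.intervalIntegrable_of_Icc ht.1) t)]
    refine intervalIntegral_congr_Ioc ht.1 fun s hs => ?_
    rw [hSx s ⟨hs.1.le, hs.2.trans ht.2⟩, map_add]
  have h2 := conv_resolve hT hS hK ht.1 (by linarith [ht.2]) hc
  rw [h1, intervalIntegral.integral_sub ((hFc.cont _).intervalIntegrable _ _)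
    ((hRc.cont _).intervalIntegrable _ _)]
  rw [intervalIntegral.integral_comp_sub_left (fun r => famF T S K r (A x)), sub_self, sub_zero]
    at h2
  rw [← h2, intervalIntegral.integral_comp_sub_left (fun r => kerR S K (clp T r) (x : H)),
    sub_self, sub_zero]
  abel

end

section

variable {H U : Type*} [NormedAddCommGroup H] [InnerProductSpace ℂ H] [CompleteSpace H]
  [NormedAddCommGroup U] [InnerProductSpace ℂ U] [CompleteSpace U]
  {T : ℝ} {S : ℝ → H →L[ℂ] H} {K : ℝ → ℝ}

/-! ### Mild solutions -/

/-- The forcing term `s ↦ ∫_a^b K(s-σ) y(σ) dσ` produced by the part of the history on `(a,b]`. -/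
def hist (T : ℝ) (K : ℝ → ℝ) (a b : ℝ) (y : ℝ → H) (s : ℝ) : H :=
  ∫ σ in a..b, (kerK T K (s - σ) : ℂ) • y σ

theorem integrable_kerK_prod (hK : IntegrableOn K (Ioc 0 T)) {a b : ℝ} (hab : a ≤ b) {y : ℝ → H}
    (hy : IntervalIntegrable y volume a b) :
    Integrable (fun p : ℝ × ℝ => (kerK T K (p.1 - p.2) : ℂ) • y p.2)
      (volume.prod (volume.restrict (Ioc a b))) := by
  rw [intervalIntegrable_iff_integrableOn_Ioc_of_le hab] at hy
  have := Integrable.convolution_integrand (ContinuousLinearMap.lsmul ℝ ℂ (E := H)).flip hy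
      ((integrable_kerK hK).ofReal (𝕜 := ℂ))
  simpa using this

theorem integrable_hist (hK : IntegrableOn K (Ioc 0 T)) {a b : ℝ} (hab : a ≤ b) {y : ℝ → H}
    (hy : IntervalIntegrable y volume a b) : Integrable (hist T K a b y) := by
  have := (integrable_kerK_prod hK hab hy).integral_prod_left
  refine this.congr (ae_of_all _ fun s => ?_)
  rw [hist, intervalIntegral.integral_of_le hab]

theorem ae_integrable_kerK (hK : IntegrableOn K (Ioc 0 T)) {a b : ℝ} (hab : a ≤ b) {y : ℝ → H}
    (hy : IntervalIntegrable y volume a b) :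
    ∀ᵐ s, IntervalIntegrable (fun σ => (kerK T K (s - σ) : ℂ) • y σ) volume a b := by
  filter_upwards [(integrable_kerK_prod hK hab hy).prod_right_ae] with s hs
  rw [intervalIntegrable_iff_integrableOn_Ioc_of_le hab]
  exact hs

/-- Causality: the kernel vanishes for negative arguments. -/
theorem hist_eq_of_mem {a b s : ℝ} (y : ℝ → H) (hs : s ∈ Icc a b) :
    hist T K a s y s = hist T K a b y s := by
  rw [hist, hist, intervalIntegral.integral_of_le hs.1,
    intervalIntegral.integral_of_le (hs.1.trans hs.2)]
  refine (setIntegral_eq_of_subset_of_forall_sdiff_eq_zero measurableSet_Ioc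
    (Ioc_subset_Ioc_right hs.2) fun σ hσ => ?_).symm
  have : s < σ := by
    by_contra h
    exact hσ.2 ⟨hσ.1.1, not_lt.1 h⟩
  rw [kerK, indicator_of_notMem (fun h => by linarith [h.1])]
  simp

theorem hist_congr {a b : ℝ} (hab : a ≤ b) {y z : ℝ → H} (h : ∀ σ ∈ Ioc a b, y σ = z σ) (s : ℝ) :
    hist T K a b y s = hist T K a b z s :=
  intervalIntegral_congr_Ioc hab fun σ hσ => by rw [h σ hσ]

/-- The function `t ↦ e^{(t-τ)A} ξ + ∫_τ^t e^{(t-s)A} ψ(s) ds`. -/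
def freeS (T : ℝ) (S : ℝ → H →L[ℂ] H) (τ : ℝ) (ξ : H) (ψ : ℝ → H) (t : ℝ) : H :=
  S (clp T (t - τ)) ξ + ∫ s in τ..t, S (clp T (t - s)) (ψ s)

/-- The function `t ↦ F(t,τ) ξ + ∫_τ^t F(t,s) ψ(s) ds`. -/
def freeF (T : ℝ) (S : ℝ → H →L[ℂ] H) (K : ℝ → ℝ) (τ : ℝ) (ξ : H) (ψ : ℝ → H) (t : ℝ) : H :=
  famF T S K (t - τ) ξ + ∫ s in τ..t, famF T S K (t - s) (ψ s)

theorem freeS_continuousOn (hT : 0 ≤ T) (hS : IsC0Semigroup S) {τ b : ℝ} (ξ : H)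
    {ψ : ℝ → H} (hψ : IntervalIntegrable ψ volume τ b) :
    ContinuousOn (freeS T S τ ξ ψ) (Icc τ b) :=
  ((hS.strongCont hT).comp_continuous (by fun_prop) continuous_const).continuousOn.add
    ((hS.strongCont hT).continuousOn_conv hψ)

theorem freeF_continuousOn (hT : 0 ≤ T) (hS : IsC0Semigroup S) (hK : IntegrableOn K (Ioc 0 T))
    {τ b : ℝ} (ξ : H) {ψ : ℝ → H} (hψ : IntervalIntegrable ψ volume τ b) :
    ContinuousOn (freeF T S K τ ξ ψ) (Icc τ b) :=
  ((strongCont_famF hT hS hK).comp_continuous (by fun_prop) continuous_const).continuousOn.add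
    ((strongCont_famF hT hS hK).continuousOn_conv hψ)

/-- Applying `1 - R *` to a response of the semigroup gives the response of the solution family. -/
theorem freeF_eq (hT : 0 ≤ T) (hS : IsC0Semigroup S) (hK : IntegrableOn K (Ioc 0 T))
    {τ t : ℝ} (ξ : H) {ψ : ℝ → H} (hτt : τ ≤ t) (ht : t - τ ≤ T)
    (hψ : IntervalIntegrable ψ volume τ t) :
    freeF T S K τ ξ ψ t = freeS T S τ ξ ψ t
      - ∫ s in τ..t, kerR S K (clp T (t - s)) (freeS T S τ ξ ψ s) := by
  have hSc := hS.strongCont hT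
  have hR := strongCont_kerR hT hS hK
  have h1 : ∫ s in τ..t, kerR S K (clp T (t - s)) (freeS T S τ ξ ψ s)
      = (∫ s in τ..t, kerR S K (clp T (t - s)) (S (clp T (s - τ)) ξ))
        + ∫ s in τ..t, kerR S K (clp T (t - s)) (∫ σ in τ..s, S (clp T (s - σ)) (ψ σ)) := by
    rw [← intervalIntegral.integral_add]
    · simp only [freeS, map_add]
    · exact hR.intervalIntegrable_conv ((hSc.comp_continuous
        (g := fun s => s - τ) (by fun_prop) continuous_const).intervalIntegrable _ _) t
    · exact hR.intervalIntegrable_conv ((hSc.continuousOn_conv hψ).intervalIntegrable_of_Icc hτt) t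
  rw [h1, freeF, freeS, ← conv_resolve hT hS hK hτt ht hψ, ← opF_eq_famF hT hS hK hτt ht,
    opF_apply hT hS hK hτt ht]
  abel

/-- A solution of the Volterra equation `w = f + μ * w` is given by the solution family. -/
theorem volterra_solution (hT : 0 ≤ T) (hS : IsC0Semigroup S) (hK : IntegrableOn K (Ioc 0 T))
    {τ : ℝ} (hτ : 0 ≤ τ) (ξ : H) {ψ w : ℝ → H} (hψ : IntervalIntegrable ψ volume τ T)
    (hw : IntervalIntegrable w volume τ T)
    (h : w =ᵐ[volume.restrict (Ioc τ T)] fun t => freeS T S τ ξ ψ t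
      + ∫ s in τ..t, kerMu S K (clp T (t - s)) (w s)) {t : ℝ} (ht : t ∈ Icc τ T) :
    freeS T S τ ξ ψ t + ∫ s in τ..t, kerMu S K (clp T (t - s)) (w s) = freeF T S K τ ξ ψ t := by
  have hR := strongCont_kerR hT hS hK
  have hmu := strongCont_kerMu hT hS hK
  have hw' := intervalIntegrable_init hw ht
  have htT : t - τ ≤ T := by linarith [ht.2]
  rw [freeF_eq hT hS hK ξ ht.1 htT (intervalIntegrable_init hψ ht)]
  have h1 : ∫ s in τ..t, kerR S K (clp T (t - s)) (freeS T S τ ξ ψ s)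
      = (∫ s in τ..t, kerR S K (clp T (t - s)) (w s))
        - ∫ s in τ..t, kerR S K (clp T (t - s)) (∫ σ in τ..s, kerMu S K (clp T (s - σ)) (w σ)) := by
    rw [← intervalIntegral.integral_sub (hR.intervalIntegrable_conv hw' t)
      (hR.intervalIntegrable_conv ((hmu.continuousOn_conv hw').intervalIntegrable_of_Icc ht.1) t)]
    refine intervalIntegral_congr_ae_Ioc ht.1 ?_
    filter_upwards [ae_restrict_of_ae_restrict_of_subset (Ioc_subset_Ioc_right ht.2) h] with s hs
    rw [← map_sub]
    congr 1
    rw [eq_sub_iff_add_eq]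
    exact hs.symm
  rw [hR.conv_assoc hmu (H := fun r => kerR S K (clp T r) + kerMu S K (clp T r)) (T := T)
    (fun t ht x => by rw [kerR_conv_kerMu hT hS hK ht]; simp [clp_of_mem ht]) ht.1 htT hw'] at h1
  simp only [_root_.add_apply] at h1
  rw [intervalIntegral.integral_add (hR.intervalIntegrable_conv hw' t)
    (hmu.intervalIntegrable_conv hw' t)] at h1
  rw [h1]
  abel

/-- The function given by the solution family solves the Volterra equation `w = f + μ * w`. -/
theorem volterra_solution' (hT : 0 ≤ T) (hS : IsC0Semigroup S) (hK : IntegrableOn K (Ioc 0 T))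
    {τ : ℝ} (hτ : 0 ≤ τ) (ξ : H) {ψ w : ℝ → H} (hψ : IntervalIntegrable ψ volume τ T)
    (h : w =ᵐ[volume.restrict (Ioc τ T)] freeF T S K τ ξ ψ) {t : ℝ} (ht : t ∈ Icc τ T) :
    freeS T S τ ξ ψ t + ∫ s in τ..t, kerMu S K (clp T (t - s)) (w s) = freeF T S K τ ξ ψ t := by
  have hR := strongCont_kerR hT hS hK
  have hmu := strongCont_kerMu hT hS hK
  have htT : t - τ ≤ T := by linarith [ht.2]
  have hψ' := intervalIntegrable_init hψ ht
  have hfc : ContinuousOn (freeS T S τ ξ ψ) (Icc τ t) := freeS_continuousOn hT hS ξ hψ'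
  have hf := hfc.intervalIntegrable_of_Icc (μ := volume) ht.1
  have h1 : ∫ s in τ..t, kerMu S K (clp T (t - s)) (w s)
      = (∫ s in τ..t, kerMu S K (clp T (t - s)) (freeS T S τ ξ ψ s))
        - ∫ s in τ..t, kerMu S K (clp T (t - s))
          (∫ σ in τ..s, kerR S K (clp T (s - σ)) (freeS T S τ ξ ψ σ)) := by
    rw [← intervalIntegral.integral_sub (hmu.intervalIntegrable_conv hf t)
      (hmu.intervalIntegrable_conv ((hR.continuousOn_conv hf).intervalIntegrable_of_Icc ht.1) t)]
    refine intervalIntegral_congr_ae_Ioc ht.1 ?_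
    filter_upwards [ae_restrict_of_ae_restrict_of_subset (Ioc_subset_Ioc_right ht.2) h,
      ae_restrict_mem measurableSet_Ioc] with s hs hsm
    have hst : s ∈ Icc τ t := ⟨hsm.1.le, hsm.2⟩
    rw [← map_sub, hs, freeF_eq hT hS hK ξ hst.1 (by linarith [hst.2])
      (intervalIntegrable_init hψ' hst)]
  rw [hmu.conv_assoc hR (H := fun r => kerR S K (clp T r) + kerMu S K (clp T r)) (T := T)
    (fun t ht x => by rw [kerMu_conv_kerR hT hS hK ht]; simp [clp_of_mem ht]) ht.1 htT hf] at h1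
  simp only [_root_.add_apply] at h1
  rw [intervalIntegral.integral_add (hR.intervalIntegrable_conv hf t)
    (hmu.intervalIntegrable_conv hf t)] at h1
  rw [h1, freeF_eq hT hS hK ξ ht.1 htT hψ']
  abel

/-- The memory term of the mild equation is a convolution with `μ`. -/
theorem conv_hist (hT : 0 ≤ T) (hS : IsC0Semigroup S) (hK : IntegrableOn K (Ioc 0 T))
    {τ : ℝ} (hτ : 0 ≤ τ) {w : ℝ → H} (hw : IntervalIntegrable w volume τ T)
    {t : ℝ} (ht : t ∈ Icc τ T) :
    ∫ s in τ..t, S (clp T (t - s)) (hist T K τ T w s)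
      = ∫ s in τ..t, kerMu S K (clp T (t - s)) (w s) := by
  rw [← (hS.strongCont hT).conv_scalar (integrable_kerK hK) (T := T)
    (Gk := fun r => kerMu S K (clp T r)) (fun t ht x => ?_) ht.1 (by linarith [ht.2])
    (intervalIntegrable_init hw ht)]
  · refine intervalIntegral_congr_Ioc ht.1 fun s hs => ?_
    rw [← hist_eq_of_mem w ⟨hs.1.le, hs.2.trans ht.2⟩]
    rfl
  · rw [clp_of_mem ht, kerMu_apply hT hS hK ht]

/-- The right-hand side of the mild equation in Volterra form: free response of the semigroup plus
`μ * w`. The kernel is replaced by its extension by zero, which only changes null sets. -/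
theorem mild_rhs_eq (hT : 0 ≤ T) (hS : IsC0Semigroup S) (hK : IntegrableOn K (Ioc 0 T))
    {τ : ℝ} (hτ : 0 ≤ τ) (ξ : H) {y w v : ℝ → H} (hy : IntervalIntegrable y volume 0 τ)
    (hw : IntervalIntegrable w volume τ T) (hv : IntervalIntegrable v volume τ T)
    {t : ℝ} (ht : t ∈ Icc τ T) :
    S (t - τ) ξ + (∫ s in τ..t, S (t - s) (∫ σ in τ..s, (K (s - σ) : ℂ) • w σ))
      + (∫ s in τ..t, S (t - s) (∫ σ in (0 : ℝ)..τ, (K (s - σ) : ℂ) • y σ))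
      + (∫ s in τ..t, S (t - s) (v s))
    = freeS T S τ ξ (fun s => hist T K 0 τ y s + v s) t
      + ∫ s in τ..t, kerMu S K (clp T (t - s)) (w s) := by
  have hSc := hS.strongCont hT
  have hcl : ∀ s ∈ Icc τ t, clp T (t - s) = t - s := fun s hs =>
    clp_of_mem ⟨by linarith [hs.2], by linarith [hs.1, ht.2]⟩
  rw [← conv_hist hT hS hK hτ hw ht, freeS, hcl τ ⟨le_rfl, ht.1⟩]
  simp only [map_add]
  rw [intervalIntegral.integral_add
    (hSc.intervalIntegrable_conv (integrable_hist hK hτ hy).intervalIntegrable t)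
    (hSc.intervalIntegrable_conv (intervalIntegrable_init hv ht) t)]
  -- The extension of the kernel vanishes at `0`, whence the exception `σ = s`.
  have e1 : ∫ s in τ..t, S (t - s) (∫ σ in τ..s, (K (s - σ) : ℂ) • w σ)
      = ∫ s in τ..t, S (clp T (t - s)) (hist T K τ T w s) := by
    refine intervalIntegral_congr_Ioc ht.1 fun s hs => ?_
    rw [hcl s ⟨hs.1.le, hs.2⟩, ← hist_eq_of_mem w ⟨hs.1.le, hs.2.trans ht.2⟩, hist]
    congr 1
    refine intervalIntegral_congr_ae_Ioc hs.1.le ?_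
    filter_upwards [ae_restrict_mem measurableSet_Ioc,
      ae_restrict_of_ae (Measure.ae_ne volume s)] with σ hσ hne
    rw [kerK_of_mem ⟨sub_pos.2 (lt_of_le_of_ne hσ.2 hne), by linarith [hσ.1, hs.2, ht.2]⟩]
  have e2 : ∫ s in τ..t, S (t - s) (∫ σ in (0 : ℝ)..τ, (K (s - σ) : ℂ) • y σ)
      = ∫ s in τ..t, S (clp T (t - s)) (hist T K 0 τ y s) := by
    refine intervalIntegral_congr_Ioc ht.1 fun s hs => ?_
    rw [hcl s ⟨hs.1.le, hs.2⟩, hist]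
    congr 1
    refine intervalIntegral_congr_Ioc hτ fun σ hσ => ?_
    rw [kerK_of_mem ⟨by linarith [hs.1, hσ.2], by linarith [hσ.1, hs.2, ht.2]⟩]
  have e3 : ∫ s in τ..t, S (t - s) (v s) = ∫ s in τ..t, S (clp T (t - s)) (v s) :=
    intervalIntegral_congr_Ioc ht.1 fun s hs => by rw [hcl s ⟨hs.1.le, hs.2⟩]
  rw [e1, e2, e3]
  abel

theorem intervalIntegrable_of_memLp {V : Type*} [NormedAddCommGroup V] {f : ℝ → V} {a b : ℝ}
    (hab : a ≤ b) (hf : MemLp f 2 (volume.restrict (Ioc a b))) :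
    IntervalIntegrable f volume a b := by
  rw [intervalIntegrable_iff_integrableOn_Ioc_of_le hab]
  exact hf.integrable (by norm_num)

theorem L2.intervalIntegrable {V : Type*} [NormedAddCommGroup V] {a b : ℝ} (hab : a ≤ b)
    (f : L2 V a b) : IntervalIntegrable f volume a b :=
  intervalIntegrable_of_memLp hab (Lp.memLp f)

/-- The response to the initial datum `X` and the forcing term `v`. -/
def resp (T : ℝ) (S : ℝ → H →L[ℂ] H) (K : ℝ → ℝ) (τ : ℝ) (X : Y H τ) (v : ℝ → H) : ℝ → H :=
  freeF T S K τ X.fst (fun s => hist T K 0 τ X.snd s + v s)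

/-- The mild solution is given explicitly by the solution family. -/
theorem isMildSolution_iff (hT : 0 ≤ T) (hS : IsC0Semigroup S) (hK : IntegrableOn K (Ioc 0 T))
    (B : U →L[ℂ] H) {τ : ℝ} (hτ : τ ∈ Icc 0 T) (X : Y H τ) {u : ℝ → U}
    (hu : MemLp u 2 (volume.restrict (Ioc τ T))) {w : ℝ → H} :
    IsMildSolution T S K B τ X u w ↔ MemLp w 2 (volume.restrict (Ioc τ T)) ∧
      w =ᵐ[volume.restrict (Ioc τ T)] resp T S K τ X (fun s => B (u s)) := by
  refine and_congr_right fun hw => ?_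
  have hw' := intervalIntegrable_of_memLp hτ.2 hw
  have hu' := intervalIntegrable_of_memLp hτ.2 hu
  have hBu : IntervalIntegrable (fun s => B (u s)) volume τ T := by
    rw [intervalIntegrable_iff] at hu' ⊢
    exact B.integrable_comp hu'
  have hy := L2.intervalIntegrable hτ.1 X.snd
  have hψ : IntervalIntegrable (fun s => hist T K 0 τ X.snd s + B (u s)) volume τ T :=
    (integrable_hist hK hτ.1 hy).intervalIntegrable.add hBu
  have e : ∀ t ∈ Ioc τ T, _ := fun t ht =>
    mild_rhs_eq hT hS hK hτ.1 X.fst hy hw' hBu (Ioc_subset_Icc_self ht)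
  constructor
  · intro h
    have h' : w =ᵐ[volume.restrict (Ioc τ T)] fun t => freeS T S τ X.fst
        (fun s => hist T K 0 τ X.snd s + B (u s)) t
        + ∫ s in τ..t, kerMu S K (clp T (t - s)) (w s) := by
      filter_upwards [h, ae_restrict_mem measurableSet_Ioc] with t h1 h2
      rw [← e t h2, h1]
    filter_upwards [h', ae_restrict_mem measurableSet_Ioc] with t h1 h2
    rw [h1]
    exact volterra_solution hT hS hK hτ.1 X.fst hψ hw' h' (Ioc_subset_Icc_self h2)
  · intro h
    filter_upwards [h, ae_restrict_mem measurableSet_Ioc] with t h1 h2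
    rw [e t h2, h1]
    exact (volterra_solution' hT hS hK hτ.1 X.fst hψ h (Ioc_subset_Icc_self h2)).symm

/-- The flow property: the state may be restarted at a later time, from its value and its history
at that time. -/
theorem freeF_flow (hT : 0 ≤ T) (hS : IsC0Semigroup S) (hK : IntegrableOn K (Ioc 0 T))
    {τ τ₁ : ℝ} (hτ : 0 ≤ τ) (hτ₁ : τ₁ ∈ Icc τ T) {ξ : H} {y w v : ℝ → H}
    (hy : IntervalIntegrable y volume 0 τ) (hyw : ∀ s ∈ Ioc τ T, y s = w s)
    (hv : IntervalIntegrable v volume τ T) (hwc : ContinuousOn w (Icc τ T))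
    (hw : ∀ t ∈ Icc τ T, w t = freeF T S K τ ξ (fun s => hist T K 0 τ y s + v s) t) :
    ∀ t ∈ Icc τ₁ T,
      w t = freeF T S K τ₁ (w τ₁) (fun s => hist T K 0 τ₁ y s + v s) t := by
  have hSc := hS.strongCont hT
  have hτT := hτ₁.1.trans hτ₁.2
  have hwi : IntervalIntegrable w volume τ T := hwc.intervalIntegrable_of_Icc hτT
  have hwi₁ : IntervalIntegrable w volume τ₁ T := intervalIntegrable_tail hwi hτ₁
  have hyi₁ : IntervalIntegrable y volume τ τ₁ :=
    (intervalIntegrable_init hwi hτ₁).congr_ae (by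
      rw [uIoc_of_le hτ₁.1]
      filter_upwards [ae_restrict_mem measurableSet_Ioc] with s hs
      exact (hyw s ⟨hs.1, hs.2.trans hτ₁.2⟩).symm)
  have hh := integrable_hist hK hτ hy
  have hψ : IntervalIntegrable (fun s => hist T K 0 τ y s + v s) volume τ T :=
    hh.intervalIntegrable.add hv
  set Φ : ℝ → H := fun s => hist T K 0 τ y s + v s + hist T K τ T w s with hΦdef
  have hΦ : IntervalIntegrable Φ volume τ T :=
    hψ.add (integrable_hist hK hτT hwi).intervalIntegrable
  have hwS : ∀ t ∈ Icc τ T, w t = S (clp T (t - τ)) ξ + ∫ s in τ..t, S (clp T (t - s)) (Φ s) := by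
    intro t ht
    rw [hw t ht, ← volterra_solution' hT hS hK hτ ξ hψ (w := w) ?_ ht,
      ← conv_hist hT hS hK hτ hwi ht, freeS, add_assoc, ← intervalIntegral.integral_add
      (hSc.intervalIntegrable_conv (intervalIntegrable_init hψ ht) t)
      (hSc.intervalIntegrable_conv (integrable_hist hK hτT hwi).intervalIntegrable t)]
    · simp only [hΦdef, map_add]
    · filter_upwards [ae_restrict_mem measurableSet_Ioc] with s hs
      exact hw s (Ioc_subset_Icc_self hs)
  have hψ₁ : IntervalIntegrable (fun s => hist T K 0 τ₁ y s + v s) volume τ₁ T :=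
    (integrable_hist hK (hτ.trans hτ₁.1) (hy.trans hyi₁)).intervalIntegrable.add
      (intervalIntegrable_tail hv hτ₁)
  have hwS₁ : ∀ t ∈ Icc τ₁ T, w t = freeS T S τ₁ (w τ₁) (fun s => hist T K 0 τ₁ y s + v s) t
      + ∫ s in τ₁..t, kerMu S K (clp T (t - s)) (w s) := by
    intro t ht
    have htτ : t ∈ Icc τ T := ⟨hτ₁.1.trans ht.1, ht.2⟩
    have hadd : ∀ s ∈ Icc τ τ₁, ∀ x, S (clp T (t - s)) x
        = S (clp T (t - τ₁)) (S (clp T (τ₁ - s)) x) := fun s hs x => by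
      rw [clp_of_mem ⟨by linarith [hs.2, ht.1], by linarith [hs.1, ht.2]⟩,
        clp_of_mem ⟨by linarith [ht.1], by linarith [hτ₁.1, ht.2]⟩,
        clp_of_mem ⟨by linarith [hs.2], by linarith [hs.1, hτ₁.2]⟩,
        show t - s = (t - τ₁) + (τ₁ - s) by ring,
        hS.map_add _ _ (by linarith [ht.1]) (by linarith [hs.2])]
      rfl
    rw [← conv_hist hT hS hK (hτ.trans hτ₁.1) hwi₁ ht, freeS, hwS t htτ, add_assoc,
      ← intervalIntegral.integral_add
      (hSc.intervalIntegrable_conv (intervalIntegrable_init hψ₁ ht) t)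
      (hSc.intervalIntegrable_conv (integrable_hist hK hτ₁.2 hwi₁).intervalIntegrable t)]
    rw [← intervalIntegral.integral_add_adjacent_intervals
      (hSc.intervalIntegrable_conv (intervalIntegrable_init hΦ hτ₁) t)
      (hSc.intervalIntegrable_conv (intervalIntegrable_tail (intervalIntegrable_init hΦ htτ)
        ⟨hτ₁.1, ht.1⟩) t), ← add_assoc]
    congr 1
    · rw [hadd τ ⟨le_rfl, hτ₁.1⟩, hwS τ₁ hτ₁, map_add,
        ← ContinuousLinearMap.intervalIntegral_comp_comm _
        (hSc.intervalIntegrable_conv (intervalIntegrable_init hΦ hτ₁) τ₁)]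
      congr 1
      exact intervalIntegral_congr_Ioc hτ₁.1 fun s hs => hadd s (Ioc_subset_Icc_self hs) _
    · refine intervalIntegral_congr_ae_Ioc ht.1 ?_
      filter_upwards [ae_restrict_of_ae (ae_integrable_kerK hK hτ hy),
        ae_restrict_of_ae (ae_integrable_kerK hK hτ₁.1 hyi₁),
        ae_restrict_of_ae (ae_integrable_kerK hK hτT hwi)] with s h1 h2 h3
      rw [← map_add]
      congr 1
      have e1 : hist T K 0 τ₁ y s = hist T K 0 τ y s + hist T K τ τ₁ y s :=
        (intervalIntegral.integral_add_adjacent_intervals h1 h2).symm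
      have e2 : hist T K τ T w s = hist T K τ τ₁ w s + hist T K τ₁ T w s :=
        (intervalIntegral.integral_add_adjacent_intervals (intervalIntegrable_init h3 hτ₁)
          (intervalIntegrable_tail h3 hτ₁)).symm
      have e3 : hist T K τ τ₁ w s = hist T K τ τ₁ y s :=
        hist_congr hτ₁.1 (fun σ hσ => (hyw σ ⟨hσ.1, hσ.2.trans hτ₁.2⟩).symm) s
      simp only [hΦdef, e1, e2, e3]
      abel
  intro t ht
  rw [hwS₁ t ht]
  refine volterra_solution hT hS hK (hτ.trans hτ₁.1) _ hψ₁ hwi₁ ?_ ht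
  filter_upwards [ae_restrict_mem measurableSet_Ioc] with s hs
  exact hwS₁ s (Ioc_subset_Icc_self hs)

end

section

/-! ### The abstract linear-quadratic problem -/

section Abstract

variable {X Z : Type*} [NormedAddCommGroup X] [InnerProductSpace ℂ X] [CompleteSpace X]
  [NormedAddCommGroup Z] [InnerProductSpace ℂ Z] [CompleteSpace Z]
  (L : X →L[ℂ] Z) (P : Z →L[ℂ] Z)

/-- The operator `Λ = I + L^* P L`. -/
def lqLam : X →L[ℂ] X :=
  ContinuousLinearMap.id ℂ X + ((ContinuousLinearMap.adjoint L).comp P).comp L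

/-- The optimal control `-Λ⁻¹ L^* P f` for the free response `f`, that is, the minimizer of
`v ↦ ⟨P (f + L v), f + L v⟩ + ‖v‖²`. -/
def lqCtrl : Z →L[ℂ] X :=
  -((Ring.inverse (lqLam L P)).comp ((ContinuousLinearMap.adjoint L).comp P))

/-- The optimal state for the free response `f`. -/
def lqState : Z →L[ℂ] Z := ContinuousLinearMap.id ℂ Z + L.comp (lqCtrl L P)

/-- The operator whose quadratic form is the optimal cost, as a function of the free response. -/
def lqCost : Z →L[ℂ] Z := P.comp (lqState L P)

variable {L P}

theorem lqState_apply (f : Z) : lqState L P f = f + L (lqCtrl L P f) := rfl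

/-- `Λ = I + L^* P L` is invertible, since `L^* P L` is non-negative. -/
theorem isUnit_lqLam (hP : P.IsPositive) : IsUnit (lqLam L P) := by
  refine ContinuousLinearMap.isUnit_of_forall_le_norm_inner_map _ (c := 1) one_pos fun x => ?_
  have h1 : inner ℂ (lqLam L P x) x = inner ℂ x x + inner ℂ (P (L x)) (L x) := by
    simp [lqLam, ContinuousLinearMap.adjoint_inner_left]
  have h2 := hP.re_inner_nonneg_left (L x)
  calc ‖x‖ ^ 2 * ((1 : NNReal) : ℝ) ≤ RCLike.re (inner ℂ (lqLam L P x) x) := by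
        rw [h1, map_add, ← norm_sq_eq_re_inner]; simpa using h2
    _ ≤ _ := RCLike.re_le_norm _

/-- The first order optimality condition `u = -L^* P w`. -/
theorem lqCtrl_eq (hP : P.IsPositive) (f : Z) :
    lqCtrl L P f = -(ContinuousLinearMap.adjoint L (P (lqState L P f))) := by
  have h : lqLam L P (lqCtrl L P f) = -(ContinuousLinearMap.adjoint L (P f)) := by
    have := congrArg (fun A : X →L[ℂ] X => A (ContinuousLinearMap.adjoint L (P f)))
      (Ring.mul_inverse_cancel _ (isUnit_lqLam (L := L) hP))
    simpa [lqCtrl] using this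
  have h2 : lqLam L P (lqCtrl L P f) = lqCtrl L P f
      + ContinuousLinearMap.adjoint L (P (L (lqCtrl L P f))) := rfl
  rw [h2] at h
  rw [lqState_apply, map_add, map_add, neg_add, ← h]
  abel

/-- The optimal cost form, polarized. -/
theorem inner_lqCost (hP : P.IsPositive) (f g : Z) :
    inner ℂ g (lqCost L P f) = inner ℂ (lqCtrl L P g) (lqCtrl L P f)
      + inner ℂ (lqState L P g) (P (lqState L P f)) := by
  have h : inner ℂ (lqCtrl L P g) (lqCtrl L P f)
      = -(inner ℂ (L (lqCtrl L P g)) (P (lqState L P f))) := by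
    conv_lhs => rw [lqCtrl_eq hP f]
    rw [inner_neg_right, ContinuousLinearMap.adjoint_inner_right]
  rw [h, lqState_apply g, inner_add_left]
  simp [lqCost]

theorem isPositive_lqCost (hP : P.IsPositive) : (lqCost L P).IsPositive := by
  refine ⟨fun f g => ?_, fun f => ?_⟩
  · change inner ℂ (lqCost L P f) g = inner ℂ f (lqCost L P g)
    rw [← inner_conj_symm, inner_lqCost hP, inner_lqCost hP, map_add, inner_conj_symm,
      inner_conj_symm, hP.inner_left_eq_inner_right]
  · change 0 ≤ RCLike.re (inner ℂ (lqCost L P f) f)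
    rw [inner_re_symm, inner_lqCost hP, map_add]
    have := hP.re_inner_nonneg_right (lqState L P f)
    have h2 : 0 ≤ RCLike.re (inner ℂ (lqCtrl L P f) (lqCtrl L P f)) := inner_self_nonneg
    linarith

/-- The cost of the control `v` exceeds the optimal cost at least by the squared distance of `v` to
the optimal control. -/
theorem lq_cost_ge (hP : P.IsPositive) (f : Z) (v : X) :
    (inner ℂ f (lqCost L P f)).re + ‖v - lqCtrl L P f‖ ^ 2
      ≤ (inner ℂ (f + L v) (P (f + L v))).re + ‖v‖ ^ 2 := by
  set c := lqCtrl L P f with hc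
  set s := lqState L P f with hs
  obtain ⟨d, rfl⟩ : ∃ d, v = c + d := ⟨v - c, by abel⟩
  have h1 : f + L (c + d) = s + L d := by rw [hs, lqState_apply, map_add]; abel
  have h2 : inner ℂ d c = -(inner ℂ (L d) (P s)) := by
    conv_lhs => rw [hc, lqCtrl_eq hP f]
    rw [inner_neg_right, ContinuousLinearMap.adjoint_inner_right]
  have h3 : (inner ℂ s (P (L d))).re = (inner ℂ (L d) (P s)).re := by
    rw [← hP.inner_left_eq_inner_right]; exact inner_re_symm (𝕜 := ℂ) _ _
  have h4 : (‖c + d‖ ^ 2 : ℝ) = ‖c‖ ^ 2 + 2 * (inner ℂ d c).re + ‖d‖ ^ 2 := by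
    have := norm_add_sq (𝕜 := ℂ) c d
    rw [this, inner_re_symm]; rfl
  have h5 : (inner ℂ c c).re = ‖c‖ ^ 2 := (norm_sq_eq_re_inner (𝕜 := ℂ) c).symm
  have h6 := hP.re_inner_nonneg_right (L d)
  have h6' : 0 ≤ (inner ℂ (L d) (P (L d))).re := h6
  rw [h1, h4, inner_lqCost hP, ← hc, ← hs, map_add, inner_add_left, inner_add_right,
    inner_add_right, add_sub_cancel_left, h2]
  simp only [Complex.add_re, Complex.neg_re, h3, h5]
  linarith

theorem lq_cost_eq (hP : P.IsPositive) (f : Z) :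
    (inner ℂ f (lqCost L P f)).re
      = (inner ℂ (lqState L P f) (P (lqState L P f))).re + ‖lqCtrl L P f‖ ^ 2 := by
  rw [inner_lqCost hP, Complex.add_re, add_comm,
    (norm_sq_eq_re_inner (𝕜 := ℂ) (lqCtrl L P f))]
  rfl

end Abstract

variable {V E E' : Type*} [NormedAddCommGroup V] [NormedSpace ℂ V]
  [NormedAddCommGroup E] [NormedSpace ℂ E] [NormedAddCommGroup E'] [NormedSpace ℂ E']

/-! ### Square integrable and bounded continuous functions on an interval -/

open scoped BoundedContinuousFunction

/-- The retraction of the line onto `[a,b]`. -/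
def clq (a b r : ℝ) : ℝ := max a (min b r)

theorem continuous_clq (a b : ℝ) : Continuous (clq a b) := by unfold clq; fun_prop

theorem clq_of_mem {a b r : ℝ} (h : r ∈ Icc a b) : clq a b r = r := by
  unfold clq; rw [min_eq_right h.2, max_eq_right h.1]

theorem clq_mem {a b : ℝ} (hab : a ≤ b) (r : ℝ) : clq a b r ∈ Icc a b :=
  ⟨le_max_left _ _, max_le hab (min_le_left _ _)⟩

theorem toL2_congr {a b : ℝ} {f g : ℝ → E} (h : f =ᵐ[volume.restrict (Ioc a b)] g) :
    toL2 a b f = toL2 a b g := by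
  unfold toL2
  by_cases hf : MemLp f 2 (volume.restrict (Ioc a b))
  · have hg := (memLp_congr_ae h).1 hf
    rw [dif_pos hf, dif_pos hg]
    exact (MemLp.toLp_eq_toLp_iff hf hg).2 h
  · have hg : ¬ MemLp g 2 (volume.restrict (Ioc a b)) := fun hg => hf ((memLp_congr_ae h).2 hg)
    rw [dif_neg hf, dif_neg hg]

theorem toL2_congr_Ioc {a b : ℝ} {f g : ℝ → E} (h : ∀ t ∈ Ioc a b, f t = g t) :
    toL2 a b f = toL2 a b g :=
  toL2_congr (by filter_upwards [ae_restrict_mem measurableSet_Ioc] with t ht using h t ht)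

theorem coeFn_toL2 {a b : ℝ} {f : ℝ → E} (hf : MemLp f 2 (volume.restrict (Ioc a b))) :
    toL2 a b f =ᵐ[volume.restrict (Ioc a b)] f := by
  rw [toL2, dif_pos hf]; exact hf.coeFn_toLp

theorem toL2_coeFn {a b : ℝ} (f : L2 E a b) : toL2 a b f = f := by
  rw [toL2, dif_pos (Lp.memLp f)]; exact Lp.toLp_coeFn f _

theorem memLp_of_continuousOn {a b : ℝ} {f : ℝ → E} (hf : ContinuousOn f (Icc a b)) :
    MemLp f 2 (volume.restrict (Ioc a b)) := by
  obtain ⟨C, hC⟩ := (isCompact_Icc (a := a) (b := b)).exists_bound_of_continuousOn hf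
  refine MemLp.of_bound ?_ C ?_
  · exact (hf.mono Ioc_subset_Icc_self).aestronglyMeasurable measurableSet_Ioc
  · filter_upwards [ae_restrict_mem measurableSet_Ioc] with t ht using hC t (Ioc_subset_Icc_self ht)

/-- The embedding of bounded continuous functions into `L²(a,b;E)`. -/
def bcfToL2 (a b : ℝ) : (ℝ →ᵇ E) →L[ℂ] L2 E a b :=
  BoundedContinuousFunction.toLp 2 (volume.restrict (Ioc a b)) ℂ

theorem coeFn_bcfToL2 (a b : ℝ) (f : ℝ →ᵇ E) :
    bcfToL2 a b f =ᵐ[volume.restrict (Ioc a b)] f := BoundedContinuousFunction.coeFn_toLp _ _ ℂ f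

theorem bcfToL2_eq_toL2 {a b : ℝ} {f : ℝ →ᵇ E} {g : ℝ → E} (h : ∀ t ∈ Ioc a b, f t = g t) :
    bcfToL2 a b f = toL2 a b g := by
  rw [← toL2_coeFn (bcfToL2 a b f)]
  refine toL2_congr ?_
  filter_upwards [coeFn_bcfToL2 a b f, ae_restrict_mem measurableSet_Ioc] with t h1 h2
  rw [h1, h t h2]

/-- A linear and bounded family of continuous functions on `[a,b]` defines a bounded operator into
the bounded continuous functions. -/
theorem exists_bcf {a b : ℝ} (hab : a ≤ b) (f : V → ℝ → E)
    (hadd : ∀ v w, ∀ t ∈ Icc a b, f (v + w) t = f v t + f w t)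
    (hsmul : ∀ (c : ℂ) v, ∀ t ∈ Icc a b, f (c • v) t = c • f v t)
    (hc : ∀ v, ContinuousOn (f v) (Icc a b)) {C : ℝ}
    (hC : ∀ v, ∀ t ∈ Icc a b, ‖f v t‖ ≤ C * ‖v‖) :
    ∃ L : V →L[ℂ] (ℝ →ᵇ E), ∀ v t, L v t = f v (clq a b t) := by
  let L : V →ₗ[ℂ] (ℝ →ᵇ E) :=
    { toFun := fun v => BoundedContinuousFunction.ofNormedAddCommGroup (fun t => f v (clq a b t))
        ((hc v).comp_continuous (continuous_clq a b) (clq_mem hab)) (C * ‖v‖)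
        (fun t => hC v _ (clq_mem hab t))
      map_add' := fun v w => by ext t; exact hadd v w _ (clq_mem hab t)
      map_smul' := fun c v => by ext t; exact hsmul c v _ (clq_mem hab t) }
  refine ⟨L.mkContinuous C fun v => ?_, fun v t => rfl⟩
  refine (BoundedContinuousFunction.norm_le ((norm_nonneg _).trans (hC v a ⟨le_rfl, hab⟩))).2
    fun t => hC v _ (clq_mem hab t)

/-- The embedding of `L²(a,b)` into `L¹(a,b)`. -/
theorem exists_integral_norm_le {a b : ℝ} (hab : a ≤ b) :
    ∃ c, 0 ≤ c ∧ ∀ u : L2 E a b, ∫ s in a..b, ‖u s‖ ≤ c * ‖u‖ := by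
  refine ⟨((volume.restrict (Ioc a b)) univ ^ (1 / (1 : ENNReal).toReal
    - 1 / (2 : ENNReal).toReal)).toReal, ENNReal.toReal_nonneg, fun u => ?_⟩
  have h := eLpNorm_le_eLpNorm_mul_rpow_measure_univ (p := 1) (q := 2) (by norm_num)
    (Lp.aestronglyMeasurable u)
  rw [intervalIntegral.integral_of_le hab,
    integral_norm_eq_lintegral_enorm (Lp.aestronglyMeasurable u),
    ← eLpNorm_one_eq_lintegral_enorm, mul_comm, Lp.norm_def, ← ENNReal.toReal_mul]
  refine ENNReal.toReal_mono ?_ h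
  refine ENNReal.mul_ne_top (Lp.eLpNorm_ne_top u) ?_
  exact ENNReal.rpow_ne_top_of_nonneg (by norm_num) (measure_ne_top _ _)

theorem L2_inner_eq {W : Type*} [NormedAddCommGroup W] [InnerProductSpace ℂ W] {a b : ℝ}
    (hab : a ≤ b) (f g : L2 W a b) : inner ℂ f g = ∫ s in a..b, inner ℂ (f s) (g s) := by
  rw [L2.inner_def, intervalIntegral.integral_of_le hab]

theorem L2_inner_congr {W : Type*} [NormedAddCommGroup W] [InnerProductSpace ℂ W] {a b : ℝ}
    (hab : a ≤ b) {f g : L2 W a b} {f' g' : ℝ → W}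
    (hf : f =ᵐ[volume.restrict (Ioc a b)] f') (hg : g =ᵐ[volume.restrict (Ioc a b)] g') :
    inner ℂ f g = ∫ s in a..b, inner ℂ (f' s) (g' s) := by
  rw [L2_inner_eq hab]
  refine intervalIntegral_congr_ae_Ioc hab ?_
  filter_upwards [hf, hg] with s h1 h2
  rw [h1, h2]

theorem isPositive_compLpL {W : Type*} [NormedAddCommGroup W] [InnerProductSpace ℂ W]
    [CompleteSpace W] {Q : W →L[ℂ] W} (hQ : Q.IsPositive) (ν : Measure ℝ) :
    (Q.compLpL 2 ν).IsPositive := by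
  refine ⟨fun f g => ?_, fun f => ?_⟩
  · change inner ℂ (Q.compLpL 2 ν f) g = inner ℂ f (Q.compLpL 2 ν g)
    rw [L2.inner_def, L2.inner_def]
    refine integral_congr_ae ?_
    filter_upwards [Q.coeFn_compLpL f, Q.coeFn_compLpL g] with s h1 h2
    rw [h1, h2, hQ.inner_left_eq_inner_right]
  · change 0 ≤ RCLike.re (inner ℂ (Q.compLpL 2 ν f) f)
    rw [L2.inner_def, ← integral_re (L2.integrable_inner _ _)]
    refine integral_nonneg_of_ae ?_
    filter_upwards [Q.coeFn_compLpL f] with s h1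
    rw [h1]
    exact hQ.re_inner_nonneg_left _

end

section

variable {H U : Type*} [NormedAddCommGroup H] [InnerProductSpace ℂ H] [CompleteSpace H]
  [NormedAddCommGroup U] [InnerProductSpace ℂ U] [CompleteSpace U]
  {T : ℝ} {F : ℝ → H →L[ℂ] H}

/-! ### The costate -/

theorem intervalIntegral_inner_right {W : Type*} [NormedAddCommGroup W] [InnerProductSpace ℂ W]
    [CompleteSpace W] {f : ℝ → W} {a b : ℝ} (hf : IntervalIntegrable f volume a b) (c : W) :
    inner ℂ c (∫ s in a..b, f s) = ∫ s in a..b, inner ℂ c (f s) := by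
  have h := ContinuousLinearMap.intervalIntegral_comp_comm (innerSL ℂ c) hf
  simpa only [innerSL_apply_apply] using h.symm

theorem intervalIntegral_inner_conj {W : Type*} [NormedAddCommGroup W] [InnerProductSpace ℂ W]
    (f g : ℝ → W) (a b : ℝ) :
    starRingEnd ℂ (∫ s in a..b, inner ℂ (f s) (g s)) = ∫ s in a..b, inner ℂ (g s) (f s) := by
  rw [intervalIntegral, intervalIntegral, map_sub, ← integral_conj, ← integral_conj]
  simp only [inner_conj_symm]

theorem intervalIntegral_inner_left {W : Type*} [NormedAddCommGroup W] [InnerProductSpace ℂ W]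
    [CompleteSpace W] {f : ℝ → W} {a b : ℝ} (hf : IntervalIntegrable f volume a b) (c : W) :
    inner ℂ (∫ s in a..b, f s) c = ∫ s in a..b, inner ℂ (f s) c := by
  rw [← inner_conj_symm, intervalIntegral_inner_right hf,
    intervalIntegral_inner_conj (fun _ => c)]

theorem norm_le_of_forall_inner {W : Type*} [NormedAddCommGroup W] [InnerProductSpace ℂ W]
    {z : W} {C : ℝ} (hC : 0 ≤ C) (h : ∀ y : W, ‖inner ℂ y z‖ ≤ C * ‖y‖) : ‖z‖ ≤ C := by
  have h1 := h z
  rcases eq_or_lt_of_le (norm_nonneg z) with h0 | h0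
  · rw [← h0]; exact hC
  · have : ‖z‖ * ‖z‖ ≤ C * ‖z‖ := by
      rw [inner_self_eq_norm_sq_to_K] at h1; simpa [sq] using h1
    exact le_of_mul_le_mul_right this h0

theorem intervalIntegrable_inner {W : Type*} [NormedAddCommGroup W] [InnerProductSpace ℂ W]
    {f g : ℝ → W} {a b : ℝ} {C : ℝ} (hf : IntervalIntegrable f volume a b)
    (hg : IntervalIntegrable g volume a b) (hC : ∀ s, ‖f s‖ ≤ C) :
    IntervalIntegrable (fun s => inner ℂ (f s) (g s)) volume a b := by
  refine (hg.norm.const_mul C).mono_fun ?_ (ae_of_all _ fun s => ?_)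
  · exact hf.aestronglyMeasurable_restrict_uIoc.inner hg.aestronglyMeasurable_restrict_uIoc
  · refine (norm_inner_le_norm _ _).trans ((mul_le_mul_of_nonneg_right (hC s)
      (norm_nonneg _)).trans (le_abs_self _))

/-- The costate `∫_σ^T F(p-σ)^* v(p) dp`, as a weak integral: the adjoint family need not be
strongly measurable. -/
def costate (F : ℝ → H →L[ℂ] H) (T : ℝ) (v : ℝ → H) (σ : ℝ) : H :=
  (InnerProductSpace.toDual ℂ H).symm
    (strongInt (fun p => (innerSL ℂ (v p)).comp (F (p - σ))) σ T)

theorem intervalIntegrable_inner_family (hF : StrongCont F) {v : ℝ → H} {a b : ℝ} (σ : ℝ)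
    (hv : IntervalIntegrable v volume a b) (y : H) :
    IntervalIntegrable (fun p => inner ℂ (F (p - σ) y) (v p)) volume a b := by
  obtain ⟨C, hC0, hC⟩ := hF.bdd
  exact intervalIntegrable_inner ((hF.comp_continuous (by fun_prop)
    continuous_const).intervalIntegrable _ _) hv (fun s => StrongCont.apply_le hC (s - σ) y)

/-- The defining property of the costate. -/
theorem inner_costate (hF : StrongCont F) {v : ℝ → H} {σ : ℝ} (hσ : σ ≤ T)
    (hv : IntervalIntegrable v volume σ T) (y : H) :
    inner ℂ y (costate F T v σ) = ∫ p in σ..T, inner ℂ (F (p - σ) y) (v p) := by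
  obtain ⟨C, hC0, hC⟩ := hF.bdd
  rw [← inner_conj_symm, costate, InnerProductSpace.toDual_symm_apply,
    strongInt_apply hσ (g := fun p => ‖v p‖ * C) (fun x => ?_) (hv.norm.mul_const C)
      (fun p _ => ?_)]
  · simp only [ContinuousLinearMap.comp_apply, innerSL_apply_apply]
    exact intervalIntegral_inner_conj v _ _ _
  · have h := intervalIntegrable_inner_family hF σ hv x
    refine h.norm.mono_fun ?_ (ae_of_all _ fun p => ?_)
    · exact hv.aestronglyMeasurable_restrict_uIoc.inner
        (hF.comp_continuous (by fun_prop) continuous_const).aestronglyMeasurable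
    · simp only [ContinuousLinearMap.comp_apply, innerSL_apply_apply]
      rw [norm_norm, norm_inner_symm]
  · refine (ContinuousLinearMap.opNorm_comp_le _ _).trans ?_
    rw [innerSL_apply_norm]
    gcongr
    exact hC _

theorem norm_costate_le (hF : StrongCont F) {C : ℝ} (hC : ∀ t, ‖F t‖ ≤ C) {v : ℝ → H} {σ : ℝ}
    (hσ : σ ≤ T) (hv : IntervalIntegrable v volume σ T) :
    ‖costate F T v σ‖ ≤ C * ∫ p in σ..T, ‖v p‖ := by
  have hC0 : 0 ≤ C := (norm_nonneg _).trans (hC 0)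
  refine norm_le_of_forall_inner (mul_nonneg hC0
    (intervalIntegral.integral_nonneg hσ fun _ _ => norm_nonneg _)) fun y => ?_
  rw [inner_costate hF hσ hv, mul_right_comm, ← intervalIntegral.integral_const_mul]
  refine intervalIntegral.norm_integral_le_of_norm_le hσ (ae_of_all _ fun p _ => ?_)
    (hv.norm.const_mul _)
  refine (norm_inner_le_norm _ _).trans ?_
  gcongr
  exact StrongCont.apply_le hC _ _

theorem costate_sub (hF : StrongCont F) {v w : ℝ → H} {σ : ℝ} (hσ : σ ≤ T)
    (hv : IntervalIntegrable v volume σ T) (hw : IntervalIntegrable w volume σ T) :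
    costate F T (fun p => v p - w p) σ = costate F T v σ - costate F T w σ := by
  refine ext_inner_left ℂ fun y => ?_
  rw [inner_sub_right, inner_costate hF hσ (hv.sub hw), inner_costate hF hσ hv,
    inner_costate hF hσ hw, ← intervalIntegral.integral_sub
    (intervalIntegrable_inner_family hF σ hv y) (intervalIntegrable_inner_family hF σ hw y)]
  simp only [inner_sub_right]

/-- The costate of a continuous function is continuous in norm. -/
theorem costate_continuousOn (hF : StrongCont F) {v : ℝ → H} {τ : ℝ} (hτ : τ ≤ T)
    (hv : ContinuousOn v (Icc τ T)) : ContinuousOn (costate F T v) (Icc τ T) := by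
  obtain ⟨C, hC0, hC⟩ := hF.bdd
  obtain ⟨M, hM⟩ := (isCompact_Icc (a := τ) (b := T)).exists_bound_of_continuousOn hv
  set z : ℝ → H := fun r => v (clq τ T r) with hz
  have hzc : Continuous z := hv.comp_continuous (continuous_clq τ T) (clq_mem hτ)
  have hzM : ∀ r, ‖z r‖ ≤ M := fun r => hM _ (clq_mem hτ r)
  -- After a shift of the variable, `σ` enters through the continuous function `z` alone. This gives
  -- norm continuity, although `σ ↦ F(p-σ)^*` may fail to be strongly continuous.
  have hrep : ∀ σ ∈ Icc τ T, ∀ y, inner ℂ y (costate F T v σ)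
      = ∫ r in (0 : ℝ)..(T - σ), inner ℂ (F r y) (z (σ + r)) := fun σ hσ y => by
    rw [inner_costate hF hσ.2 ((hv.mono (Icc_subset_Icc_left hσ.1)).intervalIntegrable_of_Icc hσ.2)]
    have h := intervalIntegral.integral_comp_sub_right (a := σ) (b := T)
      (fun r => inner ℂ (F r y) (z (σ + r))) σ
    rw [sub_self] at h
    rw [← h]
    refine intervalIntegral_congr_Ioc hσ.2 fun p hp => ?_
    rw [add_sub_cancel, hz]
    simp only
    rw [clq_of_mem ⟨hσ.1.trans hp.1.le, hp.2⟩]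
  have hcont : ∀ (σ : ℝ) (y : H), Continuous fun r => (inner ℂ (F r y) (z (σ + r)) : ℂ) :=
    fun σ y => (hF.cont y).inner (by fun_prop)
  intro σ₀ hσ₀
  rw [ContinuousWithinAt, tendsto_iff_norm_sub_tendsto_zero]
  set ω : ℝ → ℝ := fun σ => (C * ∫ r in (0 : ℝ)..(T - σ₀), ‖z (σ + r) - z (σ₀ + r)‖)
    + C * M * |σ - σ₀| with hω
  have hωc : Continuous ω := by
    refine (continuous_const.mul ?_).add (by fun_prop)
    exact intervalIntegral.continuous_parametric_intervalIntegral_of_continuous'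
      (by simp only [Function.uncurry_def]; fun_prop) _ _
  have hω0 : Tendsto ω (𝓝[Icc τ T] σ₀) (𝓝 0) := by
    have := hωc.tendsto σ₀
    simp only [hω, sub_self, norm_zero, intervalIntegral.integral_zero, abs_zero, mul_zero,
      add_zero] at this
    exact this.mono_left nhdsWithin_le_nhds
  refine squeeze_zero' (Eventually.of_forall fun _ => norm_nonneg _) ?_ hω0
  filter_upwards [self_mem_nhdsWithin] with σ hσ
  have hi0 : 0 ≤ ∫ r in (0 : ℝ)..(T - σ₀), ‖z (σ + r) - z (σ₀ + r)‖ :=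
    intervalIntegral.integral_nonneg (by linarith [hσ₀.2]) fun _ _ => norm_nonneg _
  have hM0 : 0 ≤ M := (norm_nonneg _).trans (hzM 0)
  refine norm_le_of_forall_inner (by positivity) fun y => ?_
  have hsplit : inner ℂ y (costate F T v σ - costate F T v σ₀)
      = (∫ r in (0 : ℝ)..(T - σ₀), inner ℂ (F r y) (z (σ + r) - z (σ₀ + r)))
        + ∫ r in (T - σ₀)..(T - σ), inner ℂ (F r y) (z (σ + r)) := by
    rw [inner_sub_right, hrep σ hσ, hrep σ₀ hσ₀,
      ← intervalIntegral.integral_add_adjacent_intervals (b := T - σ₀)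
      ((hcont σ y).intervalIntegrable _ _) ((hcont σ y).intervalIntegrable _ _)]
    simp only [inner_sub_right]
    rw [intervalIntegral.integral_sub ((hcont σ y).intervalIntegrable _ _)
      ((hcont σ₀ y).intervalIntegrable _ _)]
    abel
  rw [hsplit, hω, add_mul]
  refine (norm_add_le _ _).trans (add_le_add ?_ ?_)
  · rw [mul_right_comm, ← intervalIntegral.integral_const_mul]
    refine intervalIntegral.norm_integral_le_of_norm_le (by linarith [hσ₀.2])
      (ae_of_all _ fun r _ => ?_) (Continuous.intervalIntegrable (by fun_prop) _ _)
    refine (norm_inner_le_norm _ _).trans ?_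
    gcongr
    exact StrongCont.apply_le hC _ _
  · have := intervalIntegral.norm_integral_le_of_norm_le_const (a := T - σ₀) (b := T - σ)
      (f := fun r => (inner ℂ (F r y) (z (σ + r)) : ℂ)) (C := C * ‖y‖ * M) (fun r _ => by
        refine (norm_inner_le_norm _ _).trans ?_
        gcongr
        exacts [StrongCont.apply_le hC _ _, hzM _])
    refine this.trans (le_of_eq ?_)
    rw [show T - σ - (T - σ₀) = -(σ - σ₀) by ring, abs_neg]
    ring

/-- The convolution with `F` and the costate are adjoint to each other. -/
theorem conv_adjoint (hF : StrongCont F) {τ : ℝ} (hτ : τ ≤ T) {u v : ℝ → H}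
    (hu : IntervalIntegrable u volume τ T) (hv : ContinuousOn v (Icc τ T)) :
    ∫ t in τ..T, inner ℂ (∫ σ in τ..t, F (t - σ) (u σ)) (v t)
      = ∫ σ in τ..T, inner ℂ (u σ) (costate F T v σ) := by
  obtain ⟨C, hC0, hC⟩ := hF.bdd
  obtain ⟨M, hM⟩ := (isCompact_Icc (a := τ) (b := T)).exists_bound_of_continuousOn hv
  have hu' : IntegrableOn u (Ioc τ T) := by
    rwa [intervalIntegrable_iff_integrableOn_Ioc_of_le hτ] at hu
  have hvm : AEStronglyMeasurable v (volume.restrict (Ioc τ T)) :=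
    (hv.mono Ioc_subset_Icc_self).aestronglyMeasurable measurableSet_Ioc
  have h1 : ∫ t in τ..T, inner ℂ (∫ σ in τ..t, F (t - σ) (u σ)) (v t)
      = ∫ t in τ..T, ∫ σ in τ..t, inner ℂ (F (t - σ) (u σ)) (v t) :=
    intervalIntegral_congr_Ioc hτ fun t ht => intervalIntegral_inner_left
      (hF.intervalIntegrable_conv (intervalIntegrable_init hu (Ioc_subset_Icc_self ht)) t) _
  rw [h1, integral_triangle_swap hτ]
  · refine intervalIntegral_congr_Ioc hτ fun σ hσ => ?_
    rw [inner_costate hF hσ.2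
      ((hv.mono (Icc_subset_Icc_left hσ.1.le)).intervalIntegrable_of_Icc hσ.2)]
  · have hi : Integrable (fun p : ℝ × ℝ => F (p.1 - p.2) (u p.2))
        ((volume.restrict (Ioc τ T)).prod (volume.restrict (Ioc τ T))) :=
      hF.integrable_comp (by fun_prop) (hu'.comp_snd _)
    refine (hi.norm.mul_const M).mono' (hi.aestronglyMeasurable.inner hvm.comp_fst) ?_
    rw [Measure.prod_restrict]
    filter_upwards [ae_restrict_mem (measurableSet_Ioc.prod measurableSet_Ioc)] with p hp
    refine (norm_inner_le_norm _ _).trans ?_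
    gcongr
    exact hM _ (Ioc_subset_Icc_self hp.1)

/-! ### The optimality system -/

/-- The optimality system for the free response `f` on `[τ,T]`: the state equation for `w`, and the
control given by the costate of `Q w`. -/
structure OptSys (T : ℝ) (F : ℝ → H →L[ℂ] H) (B : U →L[ℂ] H) (Q : H →L[ℂ] H) (τ : ℝ)
    (f : ℝ → H) (u : ℝ → U) (w : ℝ → H) : Prop where
  contU : ContinuousOn u (Icc τ T)
  contW : ContinuousOn w (Icc τ T)
  state : ∀ t ∈ Icc τ T, w t = f t + ∫ σ in τ..t, F (t - σ) (B (u σ))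
  ctrl : ∀ t ∈ Icc τ T,
    u t = -(ContinuousLinearMap.adjoint B (costate F T (fun p => Q (w p)) t))

variable {B : U →L[ℂ] H} {Q : H →L[ℂ] H}

theorem OptSys.contBU {τ : ℝ} {f : ℝ → H} {u : ℝ → U} {w : ℝ → H} (h : OptSys T F B Q τ f u w) :
    ContinuousOn (fun s => B (u s)) (Icc τ T) := B.continuous.comp_continuousOn h.contU

theorem OptSys.contQW {τ : ℝ} {f : ℝ → H} {u : ℝ → U} {w : ℝ → H} (h : OptSys T F B Q τ f u w) :
    ContinuousOn (fun s => Q (w s)) (Icc τ T) := Q.continuous.comp_continuousOn h.contW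

theorem OptSys.contF (hF : StrongCont F) {τ : ℝ} (hτ : τ ≤ T) {f : ℝ → H} {u : ℝ → U} {w : ℝ → H}
    (h : OptSys T F B Q τ f u w) : ContinuousOn f (Icc τ T) := by
  refine (h.contW.sub (hF.continuousOn_conv (h.contBU.intervalIntegrable_of_Icc hτ))).congr
    fun t ht => ?_
  exact eq_sub_of_add_eq (h.state t ht).symm

/-- A solution of the optimality system restricts to later initial times, the control used before
becoming a part of the free response. -/
theorem OptSys.restrict (hF : StrongCont F) {τ τ' : ℝ} (hτ' : τ' ∈ Icc τ T) {f : ℝ → H}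
    {u : ℝ → U} {w : ℝ → H} (h : OptSys T F B Q τ f u w) :
    OptSys T F B Q τ' (fun t => f t + ∫ σ in τ..τ', F (t - σ) (B (u σ))) u w := by
  have hs := Icc_subset_Icc_left (b := T) hτ'.1
  have hi : IntervalIntegrable (fun s => B (u s)) volume τ T :=
    h.contBU.intervalIntegrable_of_Icc (hτ'.1.trans hτ'.2)
  refine ⟨h.contU.mono hs, h.contW.mono hs, fun t ht => ?_, fun t ht => h.ctrl t (hs ht)⟩
  rw [h.state t (hs ht), add_assoc, intervalIntegral.integral_add_adjacent_intervals
    (hF.intervalIntegrable_conv (intervalIntegrable_init hi hτ') t)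
    (hF.intervalIntegrable_conv (intervalIntegrable_tail (intervalIntegrable_init hi (hs ht))
      ⟨hτ'.1, ht.1⟩) t)]

theorem OptSys.sub (hF : StrongCont F) {τ : ℝ} {f f' : ℝ → H} {u u' : ℝ → U}
    {w w' : ℝ → H} (h : OptSys T F B Q τ f u w) (h' : OptSys T F B Q τ f' u' w') :
    OptSys T F B Q τ (fun t => f t - f' t) (fun t => u t - u' t) (fun t => w t - w' t) := by
  refine ⟨h.contU.sub h'.contU, h.contW.sub h'.contW, fun t ht => ?_, fun t ht => ?_⟩
  · have hs : Icc τ t ⊆ Icc τ T := Icc_subset_Icc_right ht.2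
    simp only [map_sub]
    rw [intervalIntegral.integral_sub
      (hF.intervalIntegrable_conv ((h.contBU.mono hs).intervalIntegrable_of_Icc ht.1) t)
      (hF.intervalIntegrable_conv ((h'.contBU.mono hs).intervalIntegrable_of_Icc ht.1) t),
      h.state t ht, h'.state t ht]
    abel
  · have hs := Icc_subset_Icc_left (b := T) ht.1
    simp only [map_sub]
    rw [costate_sub hF ht.2 ((h.contQW.mono hs).intervalIntegrable_of_Icc ht.2)
      ((h'.contQW.mono hs).intervalIntegrable_of_Icc ht.2), h.ctrl t ht, h'.ctrl t ht, map_sub]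
    abel

/-- Testing the optimality system with an arbitrary control `v` and the corresponding state. -/
theorem OptSys.pairing (hF : StrongCont F) {τ : ℝ} (hτ : τ ≤ T) {f : ℝ → H} {u : ℝ → U}
    {w : ℝ → H} (h : OptSys T F B Q τ f u w) {v : ℝ → U} (hv : ContinuousOn v (Icc τ T)) :
    ∫ t in τ..T, inner ℂ (∫ σ in τ..t, F (t - σ) (B (v σ))) (Q (w t))
      = -∫ t in τ..T, inner ℂ (v t) (u t) := by
  rw [conv_adjoint hF hτ (u := fun t => B (v t))
    ((B.continuous.comp_continuousOn hv).intervalIntegrable_of_Icc hτ)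
    h.contQW, ← intervalIntegral.integral_neg]
  refine intervalIntegral_congr_Ioc hτ fun t ht => ?_
  rw [h.ctrl t (Ioc_subset_Icc_self ht), inner_neg_right, neg_neg,
    ContinuousLinearMap.adjoint_inner_right]

theorem _root_.ContinuousOn.intervalIntegrable_inner {W : Type*} [NormedAddCommGroup W]
    [InnerProductSpace ℂ W] {f g : ℝ → W} {a b : ℝ} (hab : a ≤ b) (hf : ContinuousOn f (Icc a b))
    (hg : ContinuousOn g (Icc a b)) :
    IntervalIntegrable (fun s => (inner ℂ (f s) (g s) : ℂ)) volume a b :=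
  (hf.inner hg).intervalIntegrable_of_Icc hab

/-- Testing the optimality system with a control `v` and the state `z` that it produces from the
free response `g`. -/
theorem OptSys.test (hF : StrongCont F) {τ : ℝ} (hτ : τ ≤ T) {f : ℝ → H} {u : ℝ → U}
    {w : ℝ → H} (h : OptSys T F B Q τ f u w) {v : ℝ → U} {g z : ℝ → H}
    (hv : ContinuousOn v (Icc τ T)) (hg : ContinuousOn g (Icc τ T))
    (hz : ∀ t ∈ Icc τ T, z t = g t + ∫ σ in τ..t, F (t - σ) (B (v σ))) :
    (∫ t in τ..T, (inner ℂ (z t) (Q (w t)) : ℂ)) + ∫ t in τ..T, (inner ℂ (v t) (u t) : ℂ)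
      = ∫ t in τ..T, inner ℂ (g t) (Q (w t)) := by
  have h1 := h.pairing hF hτ hv
  have hc : ContinuousOn (fun t => ∫ σ in τ..t, F (t - σ) (B (v σ))) (Icc τ T) :=
    hF.continuousOn_conv (φ := fun s => B (v s))
      ((B.continuous.comp_continuousOn hv).intervalIntegrable_of_Icc hτ)
  have h2 : ∫ t in τ..T, (inner ℂ (z t) (Q (w t)) : ℂ)
      = (∫ t in τ..T, (inner ℂ (g t) (Q (w t)) : ℂ))
        + ∫ t in τ..T, inner ℂ (∫ σ in τ..t, F (t - σ) (B (v σ))) (Q (w t)) := by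
    rw [← intervalIntegral.integral_add (hg.intervalIntegrable_inner hτ h.contQW)
      (hc.intervalIntegrable_inner hτ h.contQW)]
    refine intervalIntegral_congr_Ioc hτ fun t ht => ?_
    rw [hz t (Ioc_subset_Icc_self ht), inner_add_left]
  rw [h2, h1]
  abel

theorem re_intervalIntegral {f : ℝ → ℂ} {a b : ℝ} (hf : IntervalIntegrable f volume a b) :
    (∫ t in a..b, f t).re = ∫ t in a..b, (f t).re :=
  (ContinuousLinearMap.intervalIntegral_comp_comm Complex.reCLM hf).symm

/-- Energy estimate for the optimal control. -/
theorem OptSys.integral_sq_le (hF : StrongCont F) (hQ : Q.IsPositive) {τ : ℝ} (hτ : τ ≤ T)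
    {f : ℝ → H} {u : ℝ → U} {w : ℝ → H} (h : OptSys T F B Q τ f u w) {δ : ℝ}
    (hδ : ∀ t ∈ Icc τ T, ‖f t‖ ≤ δ) :
    ∫ t in τ..T, ‖u t‖ ^ 2 ≤ (T - τ) * (‖Q‖ * δ ^ 2) := by
  have hf := h.contF hF hτ
  have h1 := congrArg Complex.re (h.test hF hτ h.contU hf h.state)
  rw [Complex.add_re, re_intervalIntegral (h.contW.intervalIntegrable_inner hτ h.contQW),
    re_intervalIntegral (h.contU.intervalIntegrable_inner hτ h.contU),
    re_intervalIntegral (hf.intervalIntegrable_inner hτ h.contQW)] at h1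
  have hu : ∫ t in τ..T, ‖u t‖ ^ 2 = ∫ t in τ..T, (inner ℂ (u t) (u t) : ℂ).re :=
    intervalIntegral.integral_congr fun t _ => norm_sq_eq_re_inner (𝕜 := ℂ) (u t)
  have hre : ∀ {a b : ℝ → H}, ContinuousOn a (Icc τ T) → ContinuousOn b (Icc τ T) →
      IntervalIntegrable (fun t => (inner ℂ (a t) (b t) : ℂ).re) volume τ T := fun ha hb =>
    (Complex.continuous_re.comp_continuousOn (ha.inner hb)).intervalIntegrable_of_Icc hτ
  have h2 : ∫ t in τ..T, (inner ℂ (f t) (Q (w t)) : ℂ).re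
      ≤ ∫ t in τ..T, ((inner ℂ (w t) (Q (w t)) : ℂ).re + ‖Q‖ * δ ^ 2) := by
    refine intervalIntegral.integral_mono_on hτ (hre hf h.contQW)
      ((hre h.contW h.contQW).add intervalIntegrable_const) fun t ht => ?_
    -- positivity of `Q` at `f - w`, and at `w`
    have p1 := hQ.re_inner_nonneg_right (f t - w t)
    have p2 := hQ.re_inner_nonneg_right (w t)
    have p3 : (inner ℂ (w t) (Q (f t))).re = (inner ℂ (f t) (Q (w t))).re := by
      rw [← hQ.inner_left_eq_inner_right]; exact inner_re_symm (𝕜 := ℂ) _ _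
    have p4 : (inner ℂ (f t) (Q (f t))).re ≤ ‖Q‖ * δ ^ 2 := by
      refine (Complex.re_le_norm _).trans ((norm_inner_le_norm _ _).trans ?_)
      calc ‖f t‖ * ‖Q (f t)‖ ≤ ‖f t‖ * (‖Q‖ * ‖f t‖) := by gcongr; exact Q.le_opNorm _
        _ = ‖Q‖ * ‖f t‖ ^ 2 := by ring
        _ ≤ _ := by gcongr; exact hδ t ht
    simp only [map_sub, inner_sub_left, inner_sub_right, RCLike.re_to_complex, p3] at p1 p2
    have : 0 ≤ ‖Q‖ * δ ^ 2 := by positivity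
    linarith
  rw [intervalIntegral.integral_add (hre h.contW h.contQW) intervalIntegrable_const,
    intervalIntegral.integral_const, smul_eq_mul] at h2
  rw [hu]
  linarith

/-- The optimality system is stable in the uniform norm, uniformly in the initial time. -/
theorem OptSys.exists_bound (hF : StrongCont F) (hQ : Q.IsPositive) (T : ℝ) (hT : 0 ≤ T)
    (B : U →L[ℂ] H) :
    ∃ C, 0 ≤ C ∧ ∀ τ ∈ Icc 0 T, ∀ (f : ℝ → H) (u : ℝ → U) (w : ℝ → H),
      OptSys T F B Q τ f u w → ∀ δ, 0 ≤ δ → (∀ t ∈ Icc τ T, ‖f t‖ ≤ δ) →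
      ∀ t ∈ Icc τ T, ‖u t‖ ≤ C * δ ∧ ‖w t‖ ≤ C * δ := by
  obtain ⟨C, hC0, hC⟩ := hF.bdd
  set c₁ : ℝ := T * (‖Q‖ + 1) with hc₁
  set c₂ : ℝ := 1 + C * (‖B‖ * c₁) with hc₂
  have hc₁0 : 0 ≤ c₁ := by positivity
  have hc₂0 : 0 ≤ c₂ := by positivity
  refine ⟨c₂ + ‖B‖ * (C * (T * (‖Q‖ * c₂))), by positivity, ?_⟩
  -- For `δ > 0` the `L¹` norm of `u` is controlled by the energy through `‖u‖ ≤ ‖u‖² / δ + δ`.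
  have key : ∀ τ ∈ Icc 0 T, ∀ (f : ℝ → H) (u : ℝ → U) (w : ℝ → H),
      OptSys T F B Q τ f u w → ∀ δ, 0 < δ → (∀ t ∈ Icc τ T, ‖f t‖ ≤ δ) →
      ∀ t ∈ Icc τ T, ‖u t‖ ≤ ‖B‖ * (C * (T * (‖Q‖ * c₂))) * δ ∧ ‖w t‖ ≤ c₂ * δ := by
    intro τ hτ f u w h δ hδ hf
    have hTτ : T - τ ≤ T := by linarith [hτ.1]
    have hTτ0 : 0 ≤ T - τ := by linarith [hτ.2]
    have h1 := h.integral_sq_le hF hQ hτ.2 hf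
    have hun : ContinuousOn (fun t => ‖u t‖) (Icc τ T) := h.contU.norm
    have hsq : IntervalIntegrable (fun t => δ⁻¹ * ‖u t‖ ^ 2) volume τ T :=
      (continuousOn_const.mul (hun.pow 2)).intervalIntegrable_of_Icc hτ.2
    have h2 : ∫ t in τ..T, ‖u t‖ ≤ c₁ * δ := by
      have : ∫ t in τ..T, ‖u t‖ ≤ ∫ t in τ..T, (δ⁻¹ * ‖u t‖ ^ 2 + δ) := by
        refine intervalIntegral.integral_mono_on hτ.2 (hun.intervalIntegrable_of_Icc hτ.2)
          (hsq.add intervalIntegrable_const) fun t _ => ?_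
        have : 0 ≤ δ⁻¹ * (‖u t‖ - δ) ^ 2 := by positivity
        have e : δ⁻¹ * (‖u t‖ - δ) ^ 2 = δ⁻¹ * ‖u t‖ ^ 2 - 2 * ‖u t‖ + δ := by
          field_simp; ring
        have := norm_nonneg (u t)
        linarith
      rw [intervalIntegral.integral_add hsq intervalIntegrable_const,
        intervalIntegral.integral_const_mul, intervalIntegral.integral_const, smul_eq_mul] at this
      refine this.trans ?_
      calc δ⁻¹ * (∫ t in τ..T, ‖u t‖ ^ 2) + (T - τ) * δ
          ≤ δ⁻¹ * ((T - τ) * (‖Q‖ * δ ^ 2)) + (T - τ) * δ := by gcongr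
        _ = (T - τ) * (‖Q‖ + 1) * δ := by field_simp
        _ ≤ c₁ * δ := by rw [hc₁]; gcongr
    have hBu : IntervalIntegrable (fun s => B (u s)) volume τ T :=
      h.contBU.intervalIntegrable_of_Icc hτ.2
    have hw : ∀ t ∈ Icc τ T, ‖w t‖ ≤ c₂ * δ := by
      intro t ht
      have h3 := norm_conv_le hC ht.1 (intervalIntegrable_init hBu ht) (fun s => t - s)
      have h4 : ∫ s in τ..t, ‖B (u s)‖ ≤ ‖B‖ * (c₁ * δ) := by
        have h5 : ∫ s in τ..t, ‖B (u s)‖ ≤ ∫ s in τ..T, ‖B (u s)‖ :=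
          intervalIntegral.integral_mono_interval le_rfl ht.1 ht.2
            (ae_of_all _ fun _ => norm_nonneg _) hBu.norm
        have h6 : ∫ s in τ..T, ‖B (u s)‖ ≤ ∫ s in τ..T, ‖B‖ * ‖u s‖ :=
          intervalIntegral.integral_mono_on hτ.2 hBu.norm
            ((continuousOn_const.mul hun).intervalIntegrable_of_Icc hτ.2)
            fun s _ => B.le_opNorm _
        rw [intervalIntegral.integral_const_mul] at h6
        exact h5.trans (h6.trans (by gcongr))
      rw [h.state t ht]
      refine (norm_add_le _ _).trans ?_
      calc ‖f t‖ + ‖∫ σ in τ..t, F (t - σ) (B (u σ))‖ ≤ δ + C * (‖B‖ * (c₁ * δ)) := by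
            refine add_le_add (hf t ht) (h3.trans ?_); gcongr
        _ = c₂ * δ := by rw [hc₂]; ring
    intro t ht
    refine ⟨?_, hw t ht⟩
    rw [h.ctrl t ht, norm_neg]
    refine (ContinuousLinearMap.le_opNorm _ _).trans ?_
    rw [LinearIsometryEquiv.norm_map]
    have hs := Icc_subset_Icc_left (b := T) ht.1
    have hQi : IntervalIntegrable (fun s => Q (w s)) volume t T :=
      (h.contQW.mono hs).intervalIntegrable_of_Icc ht.2
    have h3 := norm_costate_le hF hC ht.2 hQi
    have h4 : ∫ p in t..T, ‖Q (w p)‖ ≤ ∫ p in t..T, ‖Q‖ * (c₂ * δ) :=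
      intervalIntegral.integral_mono_on ht.2 hQi.norm intervalIntegrable_const fun s hsm =>
        (Q.le_opNorm _).trans (by gcongr; exact hw s (hs hsm))
    rw [intervalIntegral.integral_const, smul_eq_mul] at h4
    calc ‖B‖ * ‖costate F T (fun p => Q (w p)) t‖
        ≤ ‖B‖ * (C * ((T - t) * (‖Q‖ * (c₂ * δ)))) := by
          gcongr; exact h3.trans (by gcongr)
      _ ≤ ‖B‖ * (C * (T * (‖Q‖ * (c₂ * δ)))) := by gcongr; linarith [ht.1, hτ.1]
      _ = _ := by ring
  intro τ hτ f u w h δ hδ hf t ht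
  -- The case `δ = 0` is reached in the limit.
  have hlim : ∀ ε > 0, ‖u t‖ ≤ ‖B‖ * (C * (T * (‖Q‖ * c₂))) * (δ + ε) ∧ ‖w t‖ ≤ c₂ * (δ + ε) :=
    fun ε hε => key τ hτ f u w h (δ + ε) (by linarith)
      (fun t ht => (hf t ht).trans (by linarith)) t ht
  have hl : ∀ {a c : ℝ}, 0 ≤ c → (∀ ε > 0, a ≤ c * (δ + ε)) → a ≤ c * δ := fun {a c} hc hh => by
    have h1 : Tendsto (fun ε : ℝ => c * (δ + ε)) (𝓝[>] 0) (𝓝 (c * (δ + 0))) :=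
      ((by fun_prop : Continuous fun ε : ℝ => c * (δ + ε)).tendsto 0).mono_left nhdsWithin_le_nhds
    rw [add_zero] at h1
    refine ge_of_tendsto h1 ?_
    filter_upwards [self_mem_nhdsWithin] with ε hε using hh ε hε
  have hu := hl (by positivity) fun ε hε => (hlim ε hε).1
  have hw := hl hc₂0 fun ε hε => (hlim ε hε).2
  have e1 : 0 ≤ ‖B‖ * (C * (T * (‖Q‖ * c₂))) * δ := by positivity
  have e2 : 0 ≤ c₂ * δ := by positivity
  rw [add_mul]
  exact ⟨by linarith, by linarith⟩

/-- The optimality system has at most one solution. -/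
theorem OptSys.unique (hF : StrongCont F) (hQ : Q.IsPositive) {τ : ℝ} (hτ : τ ∈ Icc 0 T)
    {f f' : ℝ → H} {u u' : ℝ → U} {w w' : ℝ → H} (hff : ∀ t ∈ Icc τ T, f t = f' t)
    (h : OptSys T F B Q τ f u w) (h' : OptSys T F B Q τ f' u' w') :
    ∀ t ∈ Icc τ T, u t = u' t ∧ w t = w' t := by
  obtain ⟨C, -, hC⟩ := OptSys.exists_bound hF hQ T (hτ.1.trans hτ.2) B
  intro t ht
  have := hC τ hτ _ _ _ (h.sub hF h') 0 le_rfl (fun t ht => by simp [hff t ht]) t ht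
  simpa [sub_eq_zero] using this

/-- Comparison of two solutions of the optimality system with different initial times. -/
theorem OptSys.exists_compare (hF : StrongCont F) (hQ : Q.IsPositive) (T : ℝ) (hT : 0 ≤ T)
    (B : U →L[ℂ] H) :
    ∃ C, 0 ≤ C ∧ ∀ τ ∈ Icc 0 T, ∀ τ' ∈ Icc τ T, ∀ (f f' : ℝ → H) (u u' : ℝ → U) (w w' : ℝ → H),
      OptSys T F B Q τ f u w → OptSys T F B Q τ' f' u' w' → ∀ δ M, 0 ≤ δ → 0 ≤ M →
      (∀ t ∈ Icc τ' T, ‖f t - f' t‖ ≤ δ) → (∀ t ∈ Icc τ T, ‖u t‖ ≤ M) →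
      ∀ t ∈ Icc τ' T, ‖u t - u' t‖ ≤ C * (δ + M * (τ' - τ)) ∧
        ‖w t - w' t‖ ≤ C * (δ + M * (τ' - τ)) := by
  obtain ⟨D, hD0, hD⟩ := hF.bdd
  obtain ⟨C, hC0, hC⟩ := OptSys.exists_bound hF hQ T hT B
  refine ⟨C * (1 + D * ‖B‖), by positivity, ?_⟩
  intro τ hτ τ' hτ' f f' u u' w w' h h' δ M hδ hM hf hu t ht
  have hd : 0 ≤ τ' - τ := by linarith [hτ'.1]
  have := hC τ' ⟨hτ.1.trans hτ'.1, hτ'.2⟩ _ _ _ ((h.restrict hF hτ').sub hF h')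
    (δ + D * (‖B‖ * (M * (τ' - τ)))) (by positivity) (fun s hs => ?_) t ht
  · have hle : C * (δ + D * (‖B‖ * (M * (τ' - τ)))) ≤ C * (1 + D * ‖B‖) * (δ + M * (τ' - τ)) := by
      have : 0 ≤ C * (D * ‖B‖ * δ + M * (τ' - τ)) := by positivity
      nlinarith
    exact ⟨this.1.trans hle, this.2.trans hle⟩
  · have hi : IntervalIntegrable (fun s => B (u s)) volume τ τ' :=
      (h.contBU.mono (Icc_subset_Icc_right hτ'.2)).intervalIntegrable_of_Icc hτ'.1
    have h3 := norm_conv_le hD hτ'.1 hi (fun r => s - r)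
    have h4 : ∫ r in τ..τ', ‖B (u r)‖ ≤ ∫ r in τ..τ', ‖B‖ * M :=
      intervalIntegral.integral_mono_on hτ'.1 hi.norm intervalIntegrable_const fun r hr =>
        (B.le_opNorm _).trans (by gcongr; exact hu r ⟨hr.1, hr.2.trans hτ'.2⟩)
    rw [intervalIntegral.integral_const, smul_eq_mul] at h4
    calc ‖f s + (∫ σ in τ..τ', F (s - σ) (B (u σ))) - f' s‖
        = ‖(f s - f' s) + ∫ σ in τ..τ', F (s - σ) (B (u σ))‖ := by congr 1; abel
      _ ≤ δ + D * ((τ' - τ) * (‖B‖ * M)) := by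
          refine (norm_add_le _ _).trans (add_le_add (hf s hs) (h3.trans ?_)); gcongr
      _ = _ := by ring

end

section

open scoped BoundedContinuousFunction
variable {H U : Type*} [NormedAddCommGroup H] [InnerProductSpace ℂ H] [CompleteSpace H]
  [NormedAddCommGroup U] [InnerProductSpace ℂ U] [CompleteSpace U]
  {T : ℝ} {S : ℝ → H →L[ℂ] H} {K : ℝ → ℝ}

/-! ### The optimal control and the optimal state of a free response -/

theorem intervalIntegrable_clm_comp (B : U →L[ℂ] H) {u : ℝ → U} {a b : ℝ}
    (hu : IntervalIntegrable u volume a b) : IntervalIntegrable (fun s => B (u s)) volume a b := by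
  rw [intervalIntegrable_iff] at hu ⊢
  exact B.integrable_comp hu

/-- The operator `L_τ` takes values in continuous functions. They are represented by bounded
continuous functions on the line that are constant outside `[τ,T]`. -/
theorem exists_bcf_opL (hT : 0 ≤ T) (hS : IsC0Semigroup S) (hK : IntegrableOn K (Ioc 0 T))
    (B : U →L[ℂ] H) {τ : ℝ} (hτ : τ ∈ Icc 0 T) :
    ∃ L : L2 U τ T →L[ℂ] (ℝ →ᵇ H), ∀ u t,
      L u t = ∫ σ in τ..clq τ T t, famF T S K (clq τ T t - σ) (B (u σ)) := by
  have hF := strongCont_famF hT hS hK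
  obtain ⟨C, hC0, hC⟩ := hF.bdd
  obtain ⟨c, hc0, hc⟩ := exists_integral_norm_le (E := U) hτ.2
  have hi : ∀ u : L2 U τ T, IntervalIntegrable (fun s => B (u s)) volume τ T := fun u =>
    intervalIntegrable_clm_comp B (L2.intervalIntegrable hτ.2 u)
  refine exists_bcf (C := C * (‖B‖ * c)) hτ.2
    (fun (u : L2 U τ T) t => ∫ σ in τ..t, famF T S K (t - σ) (B (u σ))) ?_ ?_ ?_ ?_
  · intro u v t ht
    rw [← intervalIntegral.integral_add
      (hF.intervalIntegrable_conv (intervalIntegrable_init (hi u) ht) t)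
      (hF.intervalIntegrable_conv (intervalIntegrable_init (hi v) ht) t)]
    refine intervalIntegral_congr_ae_Ioc ht.1 ?_
    filter_upwards [ae_restrict_of_ae_restrict_of_subset (Ioc_subset_Ioc_right ht.2)
      (Lp.coeFn_add u v)] with s hs
    rw [hs, Pi.add_apply, map_add, map_add]
  · intro a u t ht
    rw [← intervalIntegral.integral_smul]
    refine intervalIntegral_congr_ae_Ioc ht.1 ?_
    filter_upwards [ae_restrict_of_ae_restrict_of_subset (Ioc_subset_Ioc_right ht.2)
      (Lp.coeFn_smul a u)] with s hs
    rw [hs, Pi.smul_apply, map_smul, map_smul]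
  · exact fun u => hF.continuousOn_conv (hi u)
  · intro u t ht
    refine (norm_conv_le hC ht.1 (intervalIntegrable_init (hi u) ht) (fun s => t - s)).trans ?_
    rw [mul_assoc]
    gcongr
    calc ∫ s in τ..t, ‖B (u s)‖ ≤ ∫ s in τ..T, ‖B (u s)‖ :=
          intervalIntegral.integral_mono_interval le_rfl ht.1 ht.2
            (ae_of_all _ fun _ => norm_nonneg _) (hi u).norm
      _ ≤ ∫ s in τ..T, ‖B‖ * ‖u s‖ := intervalIntegral.integral_mono_on hτ.2 (hi u).norm
            ((L2.intervalIntegrable hτ.2 u).norm.const_mul _) fun s _ => B.le_opNorm _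
      _ ≤ ‖B‖ * c * ‖u‖ := by
          rw [intervalIntegral.integral_const_mul, mul_assoc]; gcongr; exact hc u

theorem opL_eq (hT : 0 ≤ T) (hS : IsC0Semigroup S) (hK : IntegrableOn K (Ioc 0 T))
    (B : U →L[ℂ] H) {τ : ℝ} (hτ : τ ∈ Icc 0 T) (u : L2 U τ T) :
    opL T S K B τ u = toL2 τ T (fun t => ∫ σ in τ..t, famF T S K (t - σ) (B (u σ))) := by
  obtain ⟨L, hL⟩ := exists_bcf_opL hT hS hK B hτ
  have e : ∀ u : L2 U τ T, toL2 τ T (fun t => ∫ σ in τ..t, opF S K t σ (B (u σ)))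
      = toL2 τ T (fun t => ∫ σ in τ..t, famF T S K (t - σ) (B (u σ))) := fun u =>
    toL2_congr_Ioc fun t ht => intervalIntegral_congr_Ioc ht.1.le fun σ hσ => by
      rw [opF_eq_famF hT hS hK hσ.2 (by linarith [hσ.1, ht.2, hτ.1])]
  rw [← e, opL, opOf_apply (f := fun u : L2 U τ T => toL2 τ T (fun t => ∫ σ in τ..t,
    opF S K t σ (B (u σ)))) ((bcfToL2 τ T).comp L) fun u => ?_]
  rw [e, ContinuousLinearMap.comp_apply]
  exact bcfToL2_eq_toL2 fun t ht => by rw [hL, clq_of_mem (Ioc_subset_Icc_self ht)]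

theorem opL_ae (hT : 0 ≤ T) (hS : IsC0Semigroup S) (hK : IntegrableOn K (Ioc 0 T))
    (B : U →L[ℂ] H) {τ : ℝ} (hτ : τ ∈ Icc 0 T) (u : L2 U τ T) :
    opL T S K B τ u =ᵐ[volume.restrict (Ioc τ T)]
      fun t => ∫ σ in τ..t, famF T S K (t - σ) (B (u σ)) := by
  rw [opL_eq hT hS hK B hτ]
  exact coeFn_toL2 (memLp_of_continuousOn ((strongCont_famF hT hS hK).continuousOn_conv
    (intervalIntegrable_clm_comp B (L2.intervalIntegrable hτ.2 u))))

/-- The optimal control on `[τ,T]` for the free response `f`, in `L²(τ,T;U)`. -/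
def ctrlL2 (T : ℝ) (S : ℝ → H →L[ℂ] H) (K : ℝ → ℝ) (B : U →L[ℂ] H) (Q : H →L[ℂ] H) (τ : ℝ) :
    L2 H τ T →L[ℂ] L2 U τ T :=
  lqCtrl (opL T S K B τ) (Q.compLpL 2 (volume.restrict (Ioc τ T)))

/-- The optimal cost operator on free responses in `L²(τ,T;H)`. -/
def costL2 (T : ℝ) (S : ℝ → H →L[ℂ] H) (K : ℝ → ℝ) (B : U →L[ℂ] H) (Q : H →L[ℂ] H) (τ : ℝ) :
    L2 H τ T →L[ℂ] L2 H τ T :=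
  lqCost (opL T S K B τ) (Q.compLpL 2 (volume.restrict (Ioc τ T)))

/-- The optimal state on `[τ,T]` for the free response `f`. -/
def optState (T : ℝ) (S : ℝ → H →L[ℂ] H) (K : ℝ → ℝ) (B : U →L[ℂ] H) (Q : H →L[ℂ] H) (τ : ℝ)
    (f : ℝ → H) (t : ℝ) : H :=
  f t + ∫ σ in τ..t, famF T S K (t - σ) (B (ctrlL2 T S K B Q τ (toL2 τ T f) σ))

/-- The continuous representative of the optimal control on `[τ,T]` for the free response `f`. -/
def optCtrl (T : ℝ) (S : ℝ → H →L[ℂ] H) (K : ℝ → ℝ) (B : U →L[ℂ] H) (Q : H →L[ℂ] H) (τ : ℝ)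
    (f : ℝ → H) (t : ℝ) : U :=
  -(ContinuousLinearMap.adjoint B
    (costate (famF T S K) T (fun p => Q (optState T S K B Q τ f p)) t))

theorem optState_continuousOn (hT : 0 ≤ T) (hS : IsC0Semigroup S) (hK : IntegrableOn K (Ioc 0 T))
    (B : U →L[ℂ] H) (Q : H →L[ℂ] H) {τ : ℝ} (hτ : τ ∈ Icc 0 T) {f : ℝ → H}
    (hf : ContinuousOn f (Icc τ T)) : ContinuousOn (optState T S K B Q τ f) (Icc τ T) :=
  hf.add ((strongCont_famF hT hS hK).continuousOn_conv
    (intervalIntegrable_clm_comp B (L2.intervalIntegrable hτ.2 _)))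

theorem lqState_ae (hT : 0 ≤ T) (hS : IsC0Semigroup S) (hK : IntegrableOn K (Ioc 0 T))
    (B : U →L[ℂ] H) (Q : H →L[ℂ] H) {τ : ℝ} (hτ : τ ∈ Icc 0 T) {f : ℝ → H}
    (hf : ContinuousOn f (Icc τ T)) :
    lqState (opL T S K B τ) (Q.compLpL 2 (volume.restrict (Ioc τ T))) (toL2 τ T f)
      =ᵐ[volume.restrict (Ioc τ T)] optState T S K B Q τ f := by
  rw [lqState_apply]
  filter_upwards [Lp.coeFn_add (toL2 τ T f) (opL T S K B τ (lqCtrl (opL T S K B τ)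
    (Q.compLpL 2 (volume.restrict (Ioc τ T))) (toL2 τ T f))),
    coeFn_toL2 (memLp_of_continuousOn hf), opL_ae hT hS hK B hτ (lqCtrl (opL T S K B τ)
    (Q.compLpL 2 (volume.restrict (Ioc τ T))) (toL2 τ T f))] with t h1 h2 h3
  rw [h1, Pi.add_apply, h2, h3]
  rfl

theorem compLpL_lqState_ae (hT : 0 ≤ T) (hS : IsC0Semigroup S) (hK : IntegrableOn K (Ioc 0 T))
    (B : U →L[ℂ] H) (Q : H →L[ℂ] H) {τ : ℝ} (hτ : τ ∈ Icc 0 T) {f : ℝ → H}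
    (hf : ContinuousOn f (Icc τ T)) :
    costL2 T S K B Q τ (toL2 τ T f)
      =ᵐ[volume.restrict (Ioc τ T)] fun t => Q (optState T S K B Q τ f t) := by
  filter_upwards [Q.coeFn_compLpL (p := 2) (lqState (opL T S K B τ)
    (Q.compLpL 2 (volume.restrict (Ioc τ T))) (toL2 τ T f)), lqState_ae hT hS hK B Q hτ hf]
    with t h1 h2
  rw [costL2, lqCost, ContinuousLinearMap.comp_apply, h1, h2]

/-- The adjoint of `L_τ` is given by the costate. -/
theorem adjoint_opL_ae (hT : 0 ≤ T) (hS : IsC0Semigroup S) (hK : IntegrableOn K (Ioc 0 T))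
    (B : U →L[ℂ] H) {τ : ℝ} (hτ : τ ∈ Icc 0 T) {g : L2 H τ T} {v : ℝ → H}
    (hv : ContinuousOn v (Icc τ T)) (hg : g =ᵐ[volume.restrict (Ioc τ T)] v) :
    ContinuousLinearMap.adjoint (opL T S K B τ) g =ᵐ[volume.restrict (Ioc τ T)]
      fun t => ContinuousLinearMap.adjoint B (costate (famF T S K) T v t) := by
  have hF := strongCont_famF hT hS hK
  have hc : ContinuousOn (fun t => ContinuousLinearMap.adjoint B (costate (famF T S K) T v t))
      (Icc τ T) := (ContinuousLinearMap.adjoint B).continuous.comp_continuousOn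
        (costate_continuousOn hF hτ.2 hv)
  have hm := coeFn_toL2 (memLp_of_continuousOn hc)
  suffices h : ContinuousLinearMap.adjoint (opL T S K B τ) g
      = toL2 τ T (fun t => ContinuousLinearMap.adjoint B (costate (famF T S K) T v t)) by
    rw [h]; exact hm
  refine ext_inner_left ℂ fun u => ?_
  rw [ContinuousLinearMap.adjoint_inner_right, L2_inner_congr hτ.2 (opL_ae hT hS hK B hτ u) hg,
    conv_adjoint hF hτ.2 (u := fun s => B (u s))
      (intervalIntegrable_clm_comp B (L2.intervalIntegrable hτ.2 u)) hv,
    L2_inner_congr hτ.2 (EventuallyEq.refl _ _) hm]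
  simp only [ContinuousLinearMap.adjoint_inner_right]

/-- The optimal control in `L²` has a continuous representative, given by the costate. -/
theorem ctrlL2_ae (hT : 0 ≤ T) (hS : IsC0Semigroup S) (hK : IntegrableOn K (Ioc 0 T))
    (B : U →L[ℂ] H) {Q : H →L[ℂ] H} (hQ : Q.IsPositive) {τ : ℝ} (hτ : τ ∈ Icc 0 T) {f : ℝ → H}
    (hf : ContinuousOn f (Icc τ T)) :
    ctrlL2 T S K B Q τ (toL2 τ T f) =ᵐ[volume.restrict (Ioc τ T)] optCtrl T S K B Q τ f := by
  have hw := optState_continuousOn hT hS hK B Q hτ hf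
  rw [ctrlL2, lqCtrl_eq (isPositive_compLpL hQ _)]
  filter_upwards [adjoint_opL_ae hT hS hK B hτ (Q.continuous.comp_continuousOn hw)
    (compLpL_lqState_ae hT hS hK B Q hτ hf), Lp.coeFn_neg (ContinuousLinearMap.adjoint
      (opL T S K B τ) (costL2 T S K B Q τ (toL2 τ T f)))] with t h1 h2
  exact h2.trans (by rw [Pi.neg_apply, h1]; rfl)

/-- The optimal control and the optimal state solve the optimality system. -/
theorem optSys (hT : 0 ≤ T) (hS : IsC0Semigroup S) (hK : IntegrableOn K (Ioc 0 T))
    (B : U →L[ℂ] H) {Q : H →L[ℂ] H} (hQ : Q.IsPositive) {τ : ℝ} (hτ : τ ∈ Icc 0 T) {f : ℝ → H}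
    (hf : ContinuousOn f (Icc τ T)) :
    OptSys T (famF T S K) B Q τ f (optCtrl T S K B Q τ f) (optState T S K B Q τ f) := by
  have hF := strongCont_famF hT hS hK
  have hw := optState_continuousOn hT hS hK B Q hτ hf
  have hQw : ContinuousOn (fun p => Q (optState T S K B Q τ f p)) (Icc τ T) :=
    Q.continuous.comp_continuousOn hw
  refine ⟨?_, hw, fun t ht => ?_, fun t _ => rfl⟩
  · exact ((ContinuousLinearMap.adjoint B).continuous.comp_continuousOn
        (costate_continuousOn hF hτ.2 hQw)).neg
  · rw [optState]
    congr 1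
    refine intervalIntegral_congr_ae_Ioc ht.1 ?_
    filter_upwards [ae_restrict_of_ae_restrict_of_subset (Ioc_subset_Ioc_right ht.2)
      (ctrlL2_ae hT hS hK B hQ hτ hf)] with s hs
    rw [hs]

/-- The optimal cost form on continuous free responses. -/
theorem inner_costL2 (hT : 0 ≤ T) (hS : IsC0Semigroup S) (hK : IntegrableOn K (Ioc 0 T))
    (B : U →L[ℂ] H) (Q : H →L[ℂ] H) {τ : ℝ} (hτ : τ ∈ Icc 0 T) {f g : ℝ → H}
    (hf : ContinuousOn f (Icc τ T)) (hg : ContinuousOn g (Icc τ T)) :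
    inner ℂ (toL2 τ T g) (costL2 T S K B Q τ (toL2 τ T f))
      = ∫ p in τ..T, inner ℂ (g p) (Q (optState T S K B Q τ f p)) :=
  L2_inner_congr hτ.2 (coeFn_toL2 (memLp_of_continuousOn hg))
    (compLpL_lqState_ae hT hS hK B Q hτ hf)

/-- The optimal cost form in terms of the optimal controls and the optimal states. -/
theorem inner_costL2' (hT : 0 ≤ T) (hS : IsC0Semigroup S) (hK : IntegrableOn K (Ioc 0 T))
    (B : U →L[ℂ] H) {Q : H →L[ℂ] H} (hQ : Q.IsPositive) {τ : ℝ} (hτ : τ ∈ Icc 0 T) {f g : ℝ → H}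
    (hf : ContinuousOn f (Icc τ T)) (hg : ContinuousOn g (Icc τ T)) :
    inner ℂ (toL2 τ T g) (costL2 T S K B Q τ (toL2 τ T f))
      = ∫ p in τ..T, (inner ℂ (ctrlL2 T S K B Q τ (toL2 τ T g) p)
          (ctrlL2 T S K B Q τ (toL2 τ T f) p)
        + inner ℂ (optState T S K B Q τ g p) (Q (optState T S K B Q τ f p))) := by
  have hwf := optState_continuousOn hT hS hK B Q hτ hf
  have hwg := optState_continuousOn hT hS hK B Q hτ hg
  rw [intervalIntegral.integral_add, ← L2_inner_eq hτ.2]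
  · rw [costL2, inner_lqCost (isPositive_compLpL hQ _)]
    congr 1
    exact L2_inner_congr hτ.2 (lqState_ae hT hS hK B Q hτ hg)
      (compLpL_lqState_ae hT hS hK B Q hτ hf)
  · rw [intervalIntegrable_iff_integrableOn_Ioc_of_le hτ.2]
    exact L2.integrable_inner (𝕜 := ℂ) _ _
  · exact hwg.intervalIntegrable_inner hτ.2 (Q.continuous.comp_continuousOn hwf)

end

section

open scoped BoundedContinuousFunction

/-! ### Integral operators with a norm continuous kernel -/

section Kernel

variable {V W : Type*} [NormedAddCommGroup V] [NormedSpace ℂ V] [NormedAddCommGroup W]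
  [NormedSpace ℂ W] {N : ℝ → V →L[ℂ] W} {a b : ℝ}

theorem continuous_of_norm_sub_apply_le (g : ℝ → ℝ → ℝ)
    (hg : ∀ s₀, Tendsto (fun s => g s s₀) (𝓝 s₀) (𝓝 0)) (h0 : ∀ s s₀, 0 ≤ g s s₀)
    (h : ∀ s s₀ x, ‖N s x - N s₀ x‖ ≤ g s s₀ * ‖x‖) : Continuous N := by
  refine continuous_iff_continuousAt.2 fun s₀ => ?_
  rw [ContinuousAt, tendsto_iff_norm_sub_tendsto_zero]
  exact squeeze_zero (fun _ => norm_nonneg _) (fun s =>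
    ContinuousLinearMap.opNorm_le_bound _ (h0 s s₀) (h s s₀)) (hg s₀)

theorem intervalIntegrable_kernel_apply (hN : Continuous N) {y : ℝ → V}
    (hy : IntervalIntegrable y volume a b) :
    IntervalIntegrable (fun s => N s (y s)) volume a b := by
  obtain ⟨C, hC⟩ := isCompact_uIcc.exists_bound_of_continuousOn (hN.continuousOn (s := uIcc a b))
  refine (hy.norm.const_mul C).mono_fun ?_ ?_
  · have h1 : Continuous fun p : ℝ × V => N p.1 p.2 :=
      (hN.comp continuous_fst).clm_apply continuous_snd
    exact h1.comp_aestronglyMeasurable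
      (aestronglyMeasurable_id.prodMk hy.aestronglyMeasurable_restrict_uIoc)
  · filter_upwards [ae_restrict_mem measurableSet_uIoc] with s hs
    refine ((N s).le_opNorm _).trans ((mul_le_mul_of_nonneg_right
      (hC s (uIoc_subset_uIcc hs)) (norm_nonneg _)).trans (le_abs_self _))

/-- The integral `∫_a^b N(s) y(s) ds`. -/
def kernelInt (N : ℝ → V →L[ℂ] W) (a b : ℝ) (y : ℝ → V) : W := ∫ s in a..b, N s (y s)

theorem clm_kernelInt [CompleteSpace W] {Z : Type*} [NormedAddCommGroup Z] [NormedSpace ℂ Z]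
    [CompleteSpace Z] (hN : Continuous N) {y : ℝ → V} (hy : IntervalIntegrable y volume a b)
    (A : W →L[ℂ] Z) : A (kernelInt N a b y) = kernelInt (fun s => A.comp (N s)) a b y :=
  (ContinuousLinearMap.intervalIntegral_comp_comm A (intervalIntegrable_kernel_apply hN hy)).symm

theorem inner_kernelInt {W : Type*} [NormedAddCommGroup W] [InnerProductSpace ℂ W]
    [CompleteSpace W] {N : ℝ → V →L[ℂ] W} (hN : Continuous N) {y : ℝ → V}
    (hy : IntervalIntegrable y volume a b) (c : W) :
    inner ℂ (kernelInt N a b y) c = ∫ s in a..b, inner ℂ (N s (y s)) c :=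
  intervalIntegral_inner_left (intervalIntegrable_kernel_apply hN hy) c

/-- The operator `ξ ↦ ∫_a^b N(s) ξ(s) ds` on `L²(a,b;V)`. -/
theorem exists_kernel_clm [CompleteSpace W] (hab : a ≤ b) (hN : Continuous N) :
    ∃ m : L2 V a b →L[ℂ] W, ∀ ξ : L2 V a b, m ξ = kernelInt N a b ξ := by
  obtain ⟨C, hC⟩ := isCompact_Icc.exists_bound_of_continuousOn (hN.continuousOn (s := Icc a b))
  have hC0 : 0 ≤ C := (norm_nonneg _).trans (hC a ⟨le_rfl, hab⟩)
  obtain ⟨c, hc0, hc⟩ := exists_integral_norm_le (E := V) hab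
  have hi : ∀ ξ : L2 V a b, IntervalIntegrable (fun s => N s (ξ s)) volume a b := fun ξ =>
    intervalIntegrable_kernel_apply hN (L2.intervalIntegrable hab ξ)
  let m : L2 V a b →ₗ[ℂ] W :=
    { toFun := fun ξ => ∫ s in a..b, N s (ξ s)
      map_add' := fun ξ η => by
        rw [← intervalIntegral.integral_add (hi ξ) (hi η)]
        refine intervalIntegral_congr_ae_Ioc hab ?_
        filter_upwards [Lp.coeFn_add ξ η] with s hs
        rw [hs, Pi.add_apply, map_add]
      map_smul' := fun d ξ => by
        rw [RingHom.id_apply, ← intervalIntegral.integral_smul]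
        refine intervalIntegral_congr_ae_Ioc hab ?_
        filter_upwards [Lp.coeFn_smul d ξ] with s hs
        rw [hs, Pi.smul_apply, map_smul] }
  refine ⟨m.mkContinuous (C * c) fun ξ => ?_, fun ξ => rfl⟩
  refine (intervalIntegral.norm_integral_le_of_norm_le hab (g := fun s => C * ‖ξ s‖)
    (ae_of_all _ fun s hs => ?_) ((L2.intervalIntegrable hab ξ).norm.const_mul C)).trans ?_
  · exact ((N s).le_opNorm _).trans (by gcongr; exact hC s (Ioc_subset_Icc_self hs))
  · rw [intervalIntegral.integral_const_mul, mul_assoc]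
    gcongr
    exact hc ξ

/-- The adjoint of an integral operator has the adjoint kernel. -/
theorem adjoint_kernel_clm {V W : Type*} [NormedAddCommGroup V] [InnerProductSpace ℂ V]
    [CompleteSpace V] [NormedAddCommGroup W] [InnerProductSpace ℂ W] [CompleteSpace W]
    {N : ℝ → V →L[ℂ] W} (hab : a ≤ b) (hN : Continuous N) {m : L2 V a b →L[ℂ] W}
    (hm : ∀ ξ : L2 V a b, m ξ = kernelInt N a b ξ) (g : W) :
    ContinuousLinearMap.adjoint m g =ᵐ[volume.restrict (Ioc a b)]
      fun q => ContinuousLinearMap.adjoint (N q) g := by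
  have hc : Continuous fun q => ContinuousLinearMap.adjoint (N q) g :=
    (ContinuousLinearMap.adjoint.continuous.comp hN).clm_apply continuous_const
  have h2 := coeFn_toL2 (memLp_of_continuousOn (hc.continuousOn (s := Icc a b)))
  suffices h : ContinuousLinearMap.adjoint m g
      = toL2 a b (fun q => ContinuousLinearMap.adjoint (N q) g) by rw [h]; exact h2
  refine ext_inner_left ℂ fun ξ => ?_
  rw [ContinuousLinearMap.adjoint_inner_right, hm,
    inner_kernelInt hN (L2.intervalIntegrable hab ξ),
    L2_inner_congr hab (EventuallyEq.refl _ _) h2]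
  simp only [ContinuousLinearMap.adjoint_inner_right]

/-- Extension by zero from `L²(a,b)` to `L²(c,d)`. -/
theorem exists_extendByZero {c d : ℝ} (h : Ioc a b ⊆ Ioc c d) :
    ∃ J : L2 V a b →L[ℂ] L2 V c d, ∀ (f : L2 V a b) (g : ℝ → V),
      f =ᵐ[volume.restrict (Ioc a b)] g →
        J f =ᵐ[volume.restrict (Ioc c d)] (Ioc a b).indicator g := by
  have hr : (volume.restrict (Ioc c d)).restrict (Ioc a b) = volume.restrict (Ioc a b) := by
    rw [Measure.restrict_restrict measurableSet_Ioc, inter_eq_left.2 h]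
  have hm : ∀ f : L2 V a b, MemLp ((Ioc a b).indicator f) 2 (volume.restrict (Ioc c d)) :=
      fun f => by
    rw [memLp_indicator_iff_restrict measurableSet_Ioc, hr]; exact Lp.memLp f
  have hae : ∀ {p : ℝ → Prop}, (∀ᵐ t ∂(volume.restrict (Ioc a b)), p t) →
      ∀ᵐ t ∂(volume.restrict (Ioc c d)), t ∈ Ioc a b → p t := fun hp => by
    rw [← hr] at hp; exact (ae_restrict_iff' measurableSet_Ioc).1 hp
  let J : L2 V a b →ₗ[ℂ] L2 V c d :=
    { toFun := fun f => (hm f).toLp _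
      map_add' := fun f g => by
        rw [← MemLp.toLp_add, MemLp.toLp_eq_toLp_iff]
        filter_upwards [hae (Lp.coeFn_add f g)] with t ht
        by_cases h : t ∈ Ioc a b
        · simp only [Pi.add_apply, indicator_of_mem h]
          exact ht h
        · simp only [Pi.add_apply, indicator_of_notMem h, add_zero]
      map_smul' := fun e f => by
        rw [RingHom.id_apply, ← MemLp.toLp_const_smul, MemLp.toLp_eq_toLp_iff]
        filter_upwards [hae (Lp.coeFn_smul e f)] with t ht
        by_cases h : t ∈ Ioc a b
        · simp only [Pi.smul_apply, indicator_of_mem h]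
          exact ht h
        · simp only [Pi.smul_apply, indicator_of_notMem h, smul_zero] }
  refine ⟨J.mkContinuous 1 fun f => ?_, fun f g hfg => (hm f).coeFn_toLp.trans ?_⟩
  · change ‖(hm f).toLp _‖ ≤ 1 * ‖f‖
    rw [Lp.norm_toLp, one_mul, Lp.norm_def,
      eLpNorm_indicator_eq_eLpNorm_restrict measurableSet_Ioc, hr]
  · filter_upwards [hae hfg] with t ht
    by_cases h : t ∈ Ioc a b
    · rw [indicator_of_mem h, indicator_of_mem h, ht h]
    · rw [indicator_of_notMem h, indicator_of_notMem h]

end Kernel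

/-! ### Translates of the memory kernel -/

/-- Translation is continuous in `L¹`. -/
theorem tendsto_integral_norm_translate {k : ℝ → ℝ} (hk : Integrable k) (s₀ : ℝ) :
    Tendsto (fun s => ∫ r, ‖k (r - s) - k (r - s₀)‖) (𝓝 s₀) (𝓝 0) := by
  have hmp : ∀ s : ℝ, MeasurePreserving (fun r : ℝ => r - s) volume volume := fun s =>
    measurePreserving_sub_right volume s
  have hc : Continuous fun s : ℝ => Lp.compMeasurePreserving (fun r : ℝ => r - s) (hmp s)
      (hk.toL1 k) := by
    refine Continuous.compMeasurePreservingLp (p := 1) (f := fun _ : ℝ => hk.toL1 k)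
      (g := fun s : ℝ => (⟨fun r : ℝ => r - s, by fun_prop⟩ : C(ℝ, ℝ))) continuous_const ?_ hmp
      (by norm_num)
    exact ContinuousMap.continuous_of_continuous_uncurry _
      (by simp only [Function.uncurry_def, ContinuousMap.coe_mk]; fun_prop)
  have h0 := (continuous_iff_continuousAt.1 hc s₀)
  rw [ContinuousAt, tendsto_iff_norm_sub_tendsto_zero] at h0
  refine h0.congr fun s => ?_
  rw [L1.norm_eq_integral_norm]
  refine integral_congr_ae ?_
  have hcoe : ∀ s : ℝ, Lp.compMeasurePreserving (fun r : ℝ => r - s) (hmp s) (hk.toL1 k)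
      =ᵐ[volume] fun r => k (r - s) := fun s =>
    (Lp.coeFn_compMeasurePreserving _ (hmp s)).trans
      ((hmp s).quasiMeasurePreserving.ae_eq_comp hk.coeFn_toL1)
  filter_upwards [Lp.coeFn_sub (Lp.compMeasurePreserving (fun r : ℝ => r - s) (hmp s)
      (hk.toL1 k)) (Lp.compMeasurePreserving (fun r : ℝ => r - s₀) (hmp s₀) (hk.toL1 k)),
    hcoe s, hcoe s₀] with r h1 h2 h3
  rw [h1, Pi.sub_apply, h2, h3]

variable {H U : Type*} [NormedAddCommGroup H] [InnerProductSpace ℂ H] [CompleteSpace H]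
  [NormedAddCommGroup U] [InnerProductSpace ℂ U] [CompleteSpace U]
  {T : ℝ} {S : ℝ → H →L[ℂ] H} {K : ℝ → ℝ}

/-- The free response on `[τ,T]` to the value `x` of the history at the time `s`; for
`0 ≤ s ≤ τ` this is `M(·,s,τ) x`. -/
def memResp (T : ℝ) (S : ℝ → H →L[ℂ] H) (K : ℝ → ℝ) (τ s : ℝ) (x : H) (t : ℝ) : H :=
  ∫ r in τ..t, famF T S K (t - r) ((kerK T K (r - s) : ℂ) • x)

theorem memResp_continuousOn (hT : 0 ≤ T) (hS : IsC0Semigroup S) (hK : IntegrableOn K (Ioc 0 T))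
    (τ s : ℝ) (x : H) : ContinuousOn (memResp T S K τ s x) (Icc τ T) :=
  (strongCont_famF hT hS hK).continuousOn_conv (intervalIntegrable_kerK_smul hK s τ T x)

/-- The free responses to the values of the history form a norm continuous family of operators,
even though the kernel is only integrable. -/
theorem exists_bcf_memResp (hT : 0 ≤ T) (hS : IsC0Semigroup S) (hK : IntegrableOn K (Ioc 0 T))
    {τ : ℝ} (hτ : τ ∈ Icc 0 T) :
    ∃ N : ℝ → H →L[ℂ] (ℝ →ᵇ H), Continuous N ∧
      ∀ s x t, N s x t = memResp T S K τ s x (clq τ T t) := by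
  have hF := strongCont_famF hT hS hK
  obtain ⟨C, hC0, hC⟩ := hF.bdd
  have hk := integrable_kerK hK
  have hks : ∀ s : ℝ, Integrable fun r => kerK T K (r - s) := fun s => hk.comp_sub_right s
  have hi : ∀ (s : ℝ) (x : H) (t : ℝ), IntervalIntegrable (fun r => famF T S K (t - r)
      ((kerK T K (r - s) : ℂ) • x)) volume τ t := fun s x t =>
    hF.intervalIntegrable_conv (intervalIntegrable_kerK_smul hK s τ t x) t
  have hle : ∀ {g : ℝ → ℝ}, Integrable g → ∀ (x : H), ∀ t ∈ Icc τ T,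
      ‖∫ r in τ..t, famF T S K (t - r) ((g r : ℂ) • x)‖ ≤ C * (∫ r, ‖g r‖) * ‖x‖ := by
    intro g hg x t ht
    have hgx : IntervalIntegrable (fun r => (g r : ℂ) • x) volume τ t :=
      ((hg.ofReal (𝕜 := ℂ)).smul_const x).intervalIntegrable
    refine (norm_conv_le hC ht.1 hgx (fun r => t - r)).trans ?_
    rw [mul_assoc]
    gcongr
    simp only [norm_smul, Complex.norm_real]
    rw [intervalIntegral.integral_mul_const, intervalIntegral.integral_of_le ht.1]
    gcongr ?_ * _
    exact setIntegral_le_integral hg.norm (ae_of_all _ fun _ => norm_nonneg _)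
  have hex : ∀ s : ℝ, ∃ L : H →L[ℂ] (ℝ →ᵇ H), ∀ x t, L x t = memResp T S K τ s x (clq τ T t) := by
    intro s
    refine exists_bcf (C := C * ∫ r, ‖kerK T K (r - s)‖) hτ.2 (fun x t => memResp T S K τ s x t)
      ?_ ?_ (fun x => memResp_continuousOn hT hS hK τ s x) ?_
    · intro x y t ht
      simp only [memResp]
      rw [← intervalIntegral.integral_add (hi s x t) (hi s y t)]
      simp only [smul_add, map_add]
    · intro c x t ht
      simp only [memResp]
      rw [← intervalIntegral.integral_smul]
      simp only [smul_comm _ c, map_smul]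
    · exact fun x t ht => hle (hks s) x t ht
  choose N hN using hex
  refine ⟨N, ?_, hN⟩
  refine continuous_of_norm_sub_apply_le
    (fun s s₀ => C * ∫ r, ‖kerK T K (r - s) - kerK T K (r - s₀)‖) (fun s₀ => ?_)
    (fun s s₀ => mul_nonneg hC0 (integral_nonneg fun _ => norm_nonneg _)) (fun s s₀ x => ?_)
  · simpa only [mul_zero] using (tendsto_integral_norm_translate hk s₀).const_mul C
  have h0 : 0 ≤ C * ∫ r, ‖kerK T K (r - s) - kerK T K (r - s₀)‖ :=
    mul_nonneg hC0 (integral_nonneg fun _ => norm_nonneg _)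
  refine (BoundedContinuousFunction.norm_le (by positivity)).2 fun t => ?_
  have := hle ((hks s).sub (hks s₀)) x (clq τ T t) (clq_mem hτ.2 t)
  refine le_trans (le_of_eq ?_) this
  rw [BoundedContinuousFunction.sub_apply, hN, hN, memResp, memResp,
    ← intervalIntegral.integral_sub (hi _ _ _) (hi _ _ _)]
  simp only [Pi.sub_apply, Complex.ofReal_sub, sub_smul, map_sub]

theorem exists_bcf_famF (hT : 0 ≤ T) (hS : IsC0Semigroup S) (hK : IntegrableOn K (Ioc 0 T))
    {τ : ℝ} (hτ : τ ∈ Icc 0 T) :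
    ∃ L : H →L[ℂ] (ℝ →ᵇ H), ∀ x t, L x t = famF T S K (clq τ T t - τ) x := by
  have hF := strongCont_famF hT hS hK
  obtain ⟨C, hC0, hC⟩ := hF.bdd
  exact exists_bcf hτ.2 (fun x t => famF T S K (t - τ) x) (fun x y t _ => map_add _ _ _)
    (fun c x t _ => map_smul _ _ _)
    (fun x => (hF.comp_continuous (by fun_prop) continuous_const).continuousOn)
    (fun x t _ => StrongCont.apply_le hC _ _)

/-- The forcing by the whole history is the superposition of the forcing by its values. -/
theorem integral_memResp (hT : 0 ≤ T) (hS : IsC0Semigroup S) (hK : IntegrableOn K (Ioc 0 T))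
    {τ : ℝ} (hτ : τ ∈ Icc 0 T) {y : ℝ → H} (hy : IntervalIntegrable y volume 0 τ) {t : ℝ}
    (ht : t ∈ Icc τ T) :
    ∫ s in (0 : ℝ)..τ, memResp T S K τ s (y s) t
      = ∫ r in τ..t, famF T S K (t - r) (hist T K 0 τ y r) := by
  have hF := strongCont_famF hT hS hK
  have hp := integrable_kerK_prod hK hτ.1 hy
  have hp' : Integrable (fun p : ℝ × ℝ => famF T S K (t - p.1)
      ((kerK T K (p.1 - p.2) : ℂ) • y p.2))
      ((volume.restrict (Ioc τ t)).prod (volume.restrict (Ioc 0 τ))) := by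
    refine hF.integrable_comp (g := fun p : ℝ × ℝ => t - p.1) (by fun_prop) (hp.mono_measure ?_)
    exact Measure.prod_mono Measure.restrict_le_self le_rfl
  simp only [memResp, intervalIntegral.integral_of_le hτ.1, intervalIntegral.integral_of_le ht.1]
  rw [← integral_integral_swap hp']
  refine integral_congr_ae (ae_restrict_of_ae ?_)
  filter_upwards [hp.prod_right_ae] with r hr
  rw [hist, intervalIntegral.integral_of_le hτ.1]
  exact ContinuousLinearMap.integral_comp_comm _ hr

end

section

open scoped BoundedContinuousFunction
variable {H U : Type*} [NormedAddCommGroup H] [InnerProductSpace ℂ H] [CompleteSpace H]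
  [NormedAddCommGroup U] [InnerProductSpace ℂ U] [CompleteSpace U]
  {T : ℝ} {S : ℝ → H →L[ℂ] H} {K : ℝ → ℝ}

/-! ### The optimal cost operators -/

/-- The operator `x ↦ F(·,τ) x` into `L²(τ,T;H)`. -/
def freeOp (T : ℝ) (S : ℝ → H →L[ℂ] H) (K : ℝ → ℝ) (τ : ℝ) : H →L[ℂ] L2 H τ T :=
  opOf (fun x => toL2 τ T (fun t => famF T S K (t - τ) x))

/-- The operator `x ↦ M(·,s,τ) x` into `L²(τ,T;H)`. -/
def memOp (T : ℝ) (S : ℝ → H →L[ℂ] H) (K : ℝ → ℝ) (τ s : ℝ) : H →L[ℂ] L2 H τ T :=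
  opOf (fun x => toL2 τ T (memResp T S K τ s x))

theorem freeResp_continuousOn (hT : 0 ≤ T) (hS : IsC0Semigroup S)
    (hK : IntegrableOn K (Ioc 0 T)) (τ : ℝ) (x : H) (s : Set ℝ) :
    ContinuousOn (fun t => famF T S K (t - τ) x) s :=
  ((strongCont_famF hT hS hK).comp_continuous (by fun_prop) continuous_const).continuousOn

theorem freeOp_apply (hT : 0 ≤ T) (hS : IsC0Semigroup S) (hK : IntegrableOn K (Ioc 0 T))
    {τ : ℝ} (hτ : τ ∈ Icc 0 T) (x : H) :
    freeOp T S K τ x = toL2 τ T (fun t => famF T S K (t - τ) x) := by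
  obtain ⟨L, hL⟩ := exists_bcf_famF hT hS hK hτ
  refine opOf_apply ((bcfToL2 τ T).comp L) (fun x => ?_) x
  rw [ContinuousLinearMap.comp_apply]
  exact bcfToL2_eq_toL2 fun t ht => by rw [hL, clq_of_mem (Ioc_subset_Icc_self ht)]

theorem memOp_apply (hT : 0 ≤ T) (hS : IsC0Semigroup S) (hK : IntegrableOn K (Ioc 0 T))
    {τ : ℝ} (hτ : τ ∈ Icc 0 T) (s : ℝ) (x : H) :
    memOp T S K τ s x = toL2 τ T (memResp T S K τ s x) := by
  obtain ⟨N, -, hN⟩ := exists_bcf_memResp hT hS hK hτ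
  refine opOf_apply ((bcfToL2 τ T).comp (N s)) (fun x => ?_) x
  rw [ContinuousLinearMap.comp_apply]
  exact bcfToL2_eq_toL2 fun t ht => by rw [hN, clq_of_mem (Ioc_subset_Icc_self ht)]

theorem continuous_memOp (hT : 0 ≤ T) (hS : IsC0Semigroup S) (hK : IntegrableOn K (Ioc 0 T))
    {τ : ℝ} (hτ : τ ∈ Icc 0 T) : Continuous (memOp T S K τ) := by
  obtain ⟨N, hNc, hN⟩ := exists_bcf_memResp hT hS hK hτ
  have e : memOp T S K τ = fun s => (bcfToL2 τ T).comp (N s) := by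
    funext s
    ext1 x
    rw [memOp_apply hT hS hK hτ, ContinuousLinearMap.comp_apply]
    exact (bcfToL2_eq_toL2 fun t ht => by rw [hN, clq_of_mem (Ioc_subset_Icc_self ht)]).symm
  rw [e]
  exact continuous_const.clm_comp hNc

section Defs

variable (T : ℝ) (S : ℝ → H →L[ℂ] H) (K : ℝ → ℝ) (B : U →L[ℂ] H) (Q : H →L[ℂ] H)

/-- The operator `P₀(t)`. -/
def costOp0 (t : ℝ) : H →L[ℂ] H :=
  (ContinuousLinearMap.adjoint (freeOp T S K t)).comp
    ((costL2 T S K B Q t).comp (freeOp T S K t))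

/-- The operator `P₁(t,s)`. -/
def costOp1 (t s : ℝ) : H →L[ℂ] H :=
  (ContinuousLinearMap.adjoint (freeOp T S K t)).comp
    ((costL2 T S K B Q t).comp (memOp T S K t s))

/-- The operator `P₂(t,s,q)`. -/
def costOp2 (t s q : ℝ) : H →L[ℂ] H :=
  (ContinuousLinearMap.adjoint (memOp T S K t q)).comp
    ((costL2 T S K B Q t).comp (memOp T S K t s))

end Defs

theorem toL2_opF (hT : 0 ≤ T) (hS : IsC0Semigroup S) (hK : IntegrableOn K (Ioc 0 T))
    {τ : ℝ} (hτ : τ ∈ Icc 0 T) (x : H) :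
    toL2 τ T (fun t => opF S K t τ x) = toL2 τ T (fun t => famF T S K (t - τ) x) :=
  toL2_congr_Ioc fun t ht => by rw [opF_eq_famF hT hS hK ht.1.le (by linarith [ht.2, hτ.1])]

/-- `M(·,s,τ)` is the free response to a value of the history at the time `s`. -/
theorem opM_eq_memResp (hT : 0 ≤ T) (hS : IsC0Semigroup S) (hK : IntegrableOn K (Ioc 0 T))
    {τ s t : ℝ} (hs : s ∈ Icc 0 τ) (ht : t ∈ Icc τ T) (x : H) :
    opM S K t s τ x = memResp T S K τ s x t :=
  opM_apply hT hS hK hs.1 hs.2 ht.1 ht.2 x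

theorem toL2_opM (hT : 0 ≤ T) (hS : IsC0Semigroup S) (hK : IntegrableOn K (Ioc 0 T))
    {τ s : ℝ} (hs : s ∈ Icc 0 τ) (x : H) :
    toL2 τ T (fun t => opM S K t s τ x) = toL2 τ T (memResp T S K τ s x) :=
  toL2_congr_Ioc fun _ ht => opM_eq_memResp hT hS hK hs (Ioc_subset_Icc_self ht) x

variable {B : U →L[ℂ] H} {Q : H →L[ℂ] H}

theorem psi1_eq (hT : 0 ≤ T) (hS : IsC0Semigroup S) (hK : IntegrableOn K (Ioc 0 T))
    {τ : ℝ} (hτ : τ ∈ Icc 0 T) (x : H) :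
    psi1 T S K B Q τ x = ctrlL2 T S K B Q τ (toL2 τ T (fun t => famF T S K (t - τ) x)) := by
  rw [← toL2_opF hT hS hK hτ]; rfl

theorem psi2_eq (hT : 0 ≤ T) (hS : IsC0Semigroup S) (hK : IntegrableOn K (Ioc 0 T))
    {τ s : ℝ} (hs : s ∈ Icc 0 τ) (x : H) :
    psi2 T S K B Q s τ x = ctrlL2 T S K B Q τ (toL2 τ T (memResp T S K τ s x)) := by
  rw [← toL2_opM hT hS hK hs]; rfl

theorem z1_eq (hT : 0 ≤ T) (hS : IsC0Semigroup S) (hK : IntegrableOn K (Ioc 0 T))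
    {τ p : ℝ} (hτ : τ ∈ Icc 0 T) (hp : p ∈ Icc τ T) (x : H) :
    z1 T S K B Q p τ x = optState T S K B Q τ (fun t => famF T S K (t - τ) x) p := by
  rw [z1, psi1_eq hT hS hK hτ, optState, opF_eq_famF hT hS hK hp.1 (by linarith [hp.2, hτ.1])]
  congr 1
  refine intervalIntegral_congr_Ioc hp.1 fun σ hσ => ?_
  rw [opF_eq_famF hT hS hK hσ.2 (by linarith [hσ.1, hp.2, hτ.1])]

theorem z2_eq (hT : 0 ≤ T) (hS : IsC0Semigroup S) (hK : IntegrableOn K (Ioc 0 T))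
    {τ s p : ℝ} (hτ : τ ∈ Icc 0 T) (hs : s ∈ Icc 0 τ) (hp : p ∈ Icc τ T) (x : H) :
    z2 T S K B Q p s τ x = optState T S K B Q τ (memResp T S K τ s x) p := by
  rw [z2, psi2_eq hT hS hK hs, optState, opM_eq_memResp hT hS hK hs hp]
  congr 1
  refine intervalIntegral_congr_Ioc hp.1 fun σ hσ => ?_
  rw [opF_eq_famF hT hS hK hσ.2 (by linarith [hσ.1, hp.2, hτ.1])]

theorem inner_costOp0 (hT : 0 ≤ T) (hS : IsC0Semigroup S) (hK : IntegrableOn K (Ioc 0 T))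
    {τ : ℝ} (hτ : τ ∈ Icc 0 T) (x y : H) :
    inner ℂ y (costOp0 T S K B Q τ x) = inner ℂ (toL2 τ T (fun t => famF T S K (t - τ) y))
      (costL2 T S K B Q τ (toL2 τ T (fun t => famF T S K (t - τ) x))) := by
  rw [← freeOp_apply hT hS hK hτ, ← freeOp_apply hT hS hK hτ, costOp0]
  simp only [ContinuousLinearMap.comp_apply, ContinuousLinearMap.adjoint_inner_right]

theorem inner_costOp1 (hT : 0 ≤ T) (hS : IsC0Semigroup S) (hK : IntegrableOn K (Ioc 0 T))
    {τ : ℝ} (hτ : τ ∈ Icc 0 T) (s : ℝ) (x y : H) :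
    inner ℂ y (costOp1 T S K B Q τ s x) = inner ℂ (toL2 τ T (fun t => famF T S K (t - τ) y))
      (costL2 T S K B Q τ (toL2 τ T (memResp T S K τ s x))) := by
  rw [← freeOp_apply hT hS hK hτ, ← memOp_apply hT hS hK hτ, costOp1]
  simp only [ContinuousLinearMap.comp_apply, ContinuousLinearMap.adjoint_inner_right]

theorem inner_costOp2 (hT : 0 ≤ T) (hS : IsC0Semigroup S) (hK : IntegrableOn K (Ioc 0 T))
    {τ : ℝ} (hτ : τ ∈ Icc 0 T) (s q : ℝ) (x y : H) :
    inner ℂ y (costOp2 T S K B Q τ s q x) = inner ℂ (toL2 τ T (memResp T S K τ q y))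
      (costL2 T S K B Q τ (toL2 τ T (memResp T S K τ s x))) := by
  rw [← memOp_apply hT hS hK hτ, ← memOp_apply hT hS hK hτ, costOp2]
  simp only [ContinuousLinearMap.comp_apply, ContinuousLinearMap.adjoint_inner_right]

theorem isP0_costOp0 (hT : 0 ≤ T) (hS : IsC0Semigroup S) (hK : IntegrableOn K (Ioc 0 T))
    (hQ : Q.IsPositive) {t : ℝ} (ht : t ∈ Icc 0 T) :
    IsP0 T S K B Q t (costOp0 T S K B Q t) := by
  intro x y
  have hx := freeResp_continuousOn hT hS hK t x (Icc t T)
  have hy := freeResp_continuousOn hT hS hK t y (Icc t T)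
  rw [inner_costOp0 hT hS hK ht]
  constructor
  · rw [inner_costL2' hT hS hK B hQ ht hx hy]
    refine intervalIntegral_congr_Ioc ht.2 fun p hp => ?_
    have hp := Ioc_subset_Icc_self hp
    rw [psi1_eq hT hS hK ht, psi1_eq hT hS hK ht, z1_eq hT hS hK ht hp, z1_eq hT hS hK ht hp]
  · rw [inner_costL2 hT hS hK B Q ht hx hy]
    refine intervalIntegral_congr_Ioc ht.2 fun p hp => ?_
    rw [z1_eq hT hS hK ht (Ioc_subset_Icc_self hp),
      opF_eq_famF hT hS hK hp.1.le (by linarith [hp.2, ht.1])]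

theorem isP1_costOp1 (hT : 0 ≤ T) (hS : IsC0Semigroup S) (hK : IntegrableOn K (Ioc 0 T))
    (hQ : Q.IsPositive) {t s : ℝ} (ht : t ∈ Icc 0 T) (hs : s ∈ Icc 0 t) :
    IsP1 T S K B Q t s (costOp1 T S K B Q t s) := by
  intro x y
  have hx := memResp_continuousOn hT hS hK t s x
  have hy := freeResp_continuousOn hT hS hK t y (Icc t T)
  rw [inner_costOp1 hT hS hK ht]
  constructor
  · rw [inner_costL2' hT hS hK B hQ ht hx hy]
    refine intervalIntegral_congr_Ioc ht.2 fun p hp => ?_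
    have hp := Ioc_subset_Icc_self hp
    rw [psi1_eq hT hS hK ht, psi2_eq hT hS hK hs, z1_eq hT hS hK ht hp, z2_eq hT hS hK ht hs hp]
  · rw [inner_costL2 hT hS hK B Q ht hx hy]
    refine intervalIntegral_congr_Ioc ht.2 fun p hp => ?_
    rw [z2_eq hT hS hK ht hs (Ioc_subset_Icc_self hp),
      opF_eq_famF hT hS hK hp.1.le (by linarith [hp.2, ht.1])]

theorem isP2_costOp2 (hT : 0 ≤ T) (hS : IsC0Semigroup S) (hK : IntegrableOn K (Ioc 0 T))
    (hQ : Q.IsPositive) {t s q : ℝ} (ht : t ∈ Icc 0 T) (hs : s ∈ Icc 0 t) (hq : q ∈ Icc 0 t) :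
    IsP2 T S K B Q t s q (costOp2 T S K B Q t s q) := by
  intro x y
  have hx := memResp_continuousOn hT hS hK t s x
  have hy := memResp_continuousOn hT hS hK t q y
  rw [inner_costOp2 hT hS hK ht]
  constructor
  · rw [inner_costL2' hT hS hK B hQ ht hx hy]
    refine intervalIntegral_congr_Ioc ht.2 fun p hp => ?_
    have hp := Ioc_subset_Icc_self hp
    rw [psi2_eq hT hS hK hq, psi2_eq hT hS hK hs, z2_eq hT hS hK ht hq hp,
      z2_eq hT hS hK ht hs hp]
  · rw [inner_costL2 hT hS hK B Q ht hx hy]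
    refine intervalIntegral_congr_Ioc ht.2 fun p hp => ?_
    have hp := Ioc_subset_Icc_self hp
    rw [z2_eq hT hS hK ht hs hp, opM_eq_memResp hT hS hK hq hp]

theorem isPositive_costL2 (hQ : Q.IsPositive) (τ : ℝ) : (costL2 T S K B Q τ).IsPositive :=
  isPositive_lqCost (isPositive_compLpL hQ _)

theorem isPositive_costOp0 (hQ : Q.IsPositive) (τ : ℝ) : (costOp0 T S K B Q τ).IsPositive :=
  (isPositive_costL2 hQ τ).adjoint_conj (freeOp T S K τ)

/-! ### The free response of an initial datum -/

/-- The free response to the initial datum `X`. -/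
def freeY (T : ℝ) (S : ℝ → H →L[ℂ] H) (K : ℝ → ℝ) (τ : ℝ) (X : Y H τ) : ℝ → H :=
  freeF T S K τ X.fst (hist T K 0 τ X.snd)

theorem freeY_continuousOn (hT : 0 ≤ T) (hS : IsC0Semigroup S) (hK : IntegrableOn K (Ioc 0 T))
    {τ : ℝ} (hτ : τ ∈ Icc 0 T) (X : Y H τ) : ContinuousOn (freeY T S K τ X) (Icc τ T) :=
  freeF_continuousOn hT hS hK X.fst
    (integrable_hist hK hτ.1 (L2.intervalIntegrable hτ.1 X.snd)).intervalIntegrable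

/-- The free response depends boundedly, in the uniform norm, on the initial datum. -/
theorem exists_bcf_freeY (hT : 0 ≤ T) (hS : IsC0Semigroup S) (hK : IntegrableOn K (Ioc 0 T))
    {τ : ℝ} (hτ : τ ∈ Icc 0 T) :
    ∃ L : Y H τ →L[ℂ] (ℝ →ᵇ H), ∀ X t, L X t = freeY T S K τ X (clq τ T t) := by
  obtain ⟨E, hE⟩ := exists_bcf_famF hT hS hK hτ
  obtain ⟨N, hNc, hN⟩ := exists_bcf_memResp hT hS hK hτ
  obtain ⟨m, hm⟩ := exists_kernel_clm (V := H) hτ.1 hNc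
  refine ⟨E.comp (WithLp.fstL 2 ℂ H (L2 H 0 τ)) + m.comp (WithLp.sndL 2 ℂ H (L2 H 0 τ)),
    fun X t => ?_⟩
  have hy := L2.intervalIntegrable hτ.1 X.snd
  have h2 : m X.snd t = ∫ r in τ..clq τ T t, famF T S K (clq τ T t - r)
      (hist T K 0 τ X.snd r) := by
    rw [← integral_memResp hT hS hK hτ hy (clq_mem hτ.2 t), hm]
    simp only [← hN]
    exact clm_kernelInt hNc hy (BoundedContinuousFunction.evalCLM ℂ (β := H) t)
  change E X.fst t + m X.snd t = _
  rw [hE, h2]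
  rfl

theorem toL2_freeY (hT : 0 ≤ T) (hS : IsC0Semigroup S) (hK : IntegrableOn K (Ioc 0 T))
    {τ : ℝ} (hτ : τ ∈ Icc 0 T) (X : Y H τ) :
    toL2 τ T (freeY T S K τ X) = freeOp T S K τ X.fst
      + kernelInt (memOp T S K τ) 0 τ X.snd := by
  obtain ⟨E, hE⟩ := exists_bcf_famF hT hS hK hτ
  obtain ⟨N, hNc, hN⟩ := exists_bcf_memResp hT hS hK hτ
  have hy := L2.intervalIntegrable hτ.1 X.snd
  have h1 : kernelInt (memOp T S K τ) 0 τ X.snd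
      = bcfToL2 τ T (kernelInt N 0 τ X.snd) := by
    rw [clm_kernelInt hNc hy]
    refine intervalIntegral_congr_Ioc hτ.1 fun s _ => ?_
    rw [memOp_apply hT hS hK hτ]
    exact (bcfToL2_eq_toL2 fun t ht => (hN _ _ _).trans
      (by rw [clq_of_mem (Ioc_subset_Icc_self ht)])).symm
  have h2 : freeOp T S K τ X.fst = bcfToL2 τ T (E X.fst) := by
    rw [freeOp_apply hT hS hK hτ]
    exact (bcfToL2_eq_toL2 fun t ht => by rw [hE, clq_of_mem (Ioc_subset_Icc_self ht)]).symm
  rw [h1, h2, ← map_add]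
  refine (bcfToL2_eq_toL2 fun t ht => ?_).symm
  have ht' := Ioc_subset_Icc_self ht
  have h3 : kernelInt N 0 τ X.snd t = ∫ s in (0 : ℝ)..τ, N s (X.snd s) t :=
    clm_kernelInt hNc hy (BoundedContinuousFunction.evalCLM ℂ (β := H) t)
  simp only [hN, clq_of_mem ht'] at h3
  rw [BoundedContinuousFunction.add_apply, h3, integral_memResp hT hS hK hτ hy ht', hE,
    clq_of_mem ht']
  rfl

end

section

open scoped BoundedContinuousFunction
variable {H U : Type*} [NormedAddCommGroup H] [InnerProductSpace ℂ H] [CompleteSpace H]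
  [NormedAddCommGroup U] [InnerProductSpace ℂ U] [CompleteSpace U]
  {T : ℝ} {S : ℝ → H →L[ℂ] H} {K : ℝ → ℝ}

/-! ### Existence and uniqueness of the optimal pair -/

/-- The optimal state for the initial datum `X` at the time `τ`. -/
def stateY (T : ℝ) (S : ℝ → H →L[ℂ] H) (K : ℝ → ℝ) (B : U →L[ℂ] H) (Q : H →L[ℂ] H) (τ : ℝ)
    (X : Y H τ) : ℝ → H := optState T S K B Q τ (freeY T S K τ X)

/-- The optimal control for the initial datum `X` at the time `τ`. -/
def ctrlY (T : ℝ) (S : ℝ → H →L[ℂ] H) (K : ℝ → ℝ) (B : U →L[ℂ] H) (Q : H →L[ℂ] H) (τ : ℝ)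
    (X : Y H τ) : ℝ → U := optCtrl T S K B Q τ (freeY T S K τ X)

variable {B : U →L[ℂ] H} {Q : H →L[ℂ] H}

theorem optSysY (hT : 0 ≤ T) (hS : IsC0Semigroup S) (hK : IntegrableOn K (Ioc 0 T))
    (hQ : Q.IsPositive) {τ : ℝ} (hτ : τ ∈ Icc 0 T) (X : Y H τ) :
    OptSys T (famF T S K) B Q τ (freeY T S K τ X) (ctrlY T S K B Q τ X)
      (stateY T S K B Q τ X) :=
  optSys hT hS hK B hQ hτ (freeY_continuousOn hT hS hK hτ X)

/-- The response is the free response plus the response to the forcing term. -/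
theorem resp_eq (hT : 0 ≤ T) (hS : IsC0Semigroup S) (hK : IntegrableOn K (Ioc 0 T))
    {τ : ℝ} (hτ : τ ∈ Icc 0 T) (X : Y H τ) {v : ℝ → H} (hv : IntervalIntegrable v volume τ T)
    {t : ℝ} (ht : t ∈ Icc τ T) :
    resp T S K τ X v t = freeY T S K τ X t + ∫ s in τ..t, famF T S K (t - s) (v s) := by
  have hF := strongCont_famF hT hS hK
  rw [resp, freeF, freeY, freeF, add_assoc, ← intervalIntegral.integral_add
    (hF.intervalIntegrable_conv (integrable_hist hK hτ.1
      (L2.intervalIntegrable hτ.1 X.snd)).intervalIntegrable t)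
    (hF.intervalIntegrable_conv (intervalIntegrable_init hv ht) t)]
  simp only [map_add]

theorem resp_continuousOn (hT : 0 ≤ T) (hS : IsC0Semigroup S) (hK : IntegrableOn K (Ioc 0 T))
    {τ : ℝ} (hτ : τ ∈ Icc 0 T) (X : Y H τ) {v : ℝ → H} (hv : IntervalIntegrable v volume τ T) :
    ContinuousOn (resp T S K τ X v) (Icc τ T) :=
  freeF_continuousOn hT hS hK X.fst ((integrable_hist hK hτ.1
    (L2.intervalIntegrable hτ.1 X.snd)).intervalIntegrable.add hv)

theorem resp_congr {τ : ℝ} (X : Y H τ) {v v' : ℝ → H}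
    (h : v =ᵐ[volume.restrict (Ioc τ T)] v') {t : ℝ} (ht : t ∈ Icc τ T) :
    resp T S K τ X v t = resp T S K τ X v' t := by
  rw [resp, freeF, resp, freeF]
  congr 1
  refine intervalIntegral_congr_ae_Ioc ht.1 ?_
  filter_upwards [ae_restrict_of_ae_restrict_of_subset (Ioc_subset_Ioc_right ht.2) h] with s hs
  rw [hs]

theorem exists_unique_mild (hT : 0 ≤ T) (hS : IsC0Semigroup S) (hK : IntegrableOn K (Ioc 0 T))
    {τ : ℝ} (hτ : τ ∈ Icc 0 T) (X : Y H τ) {u : ℝ → U}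
    (hu : MemLp u 2 (volume.restrict (Ioc τ T))) :
    ∃ w, IsMildSolution T S K B τ X u w ∧
      ∀ w', IsMildSolution T S K B τ X u w' → w' =ᵐ[volume.restrict (Ioc τ T)] w := by
  refine ⟨resp T S K τ X (fun s => B (u s)), ?_, fun w' hw' => ?_⟩
  · exact (isMildSolution_iff hT hS hK B hτ X hu).2 ⟨memLp_of_continuousOn
      (resp_continuousOn hT hS hK hτ X (intervalIntegrable_clm_comp B
        (intervalIntegrable_of_memLp hτ.2 hu))), EventuallyEq.refl _ _⟩
  · exact ((isMildSolution_iff hT hS hK B hτ X hu).1 hw').2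

/-- The state of a control, in `L²(τ,T;H)`. -/
theorem toL2_mild (hT : 0 ≤ T) (hS : IsC0Semigroup S) (hK : IntegrableOn K (Ioc 0 T))
    {τ : ℝ} (hτ : τ ∈ Icc 0 T) (X : Y H τ) {u : ℝ → U} {w : ℝ → H}
    (hu : MemLp u 2 (volume.restrict (Ioc τ T))) (hw : IsMildSolution T S K B τ X u w) :
    toL2 τ T w = toL2 τ T (freeY T S K τ X) + opL T S K B τ (toL2 τ T u) := by
  have hw' := (isMildSolution_iff hT hS hK B hτ X hu).1 hw
  refine Lp.ext ?_
  filter_upwards [coeFn_toL2 hw'.1, hw'.2, Lp.coeFn_add (toL2 τ T (freeY T S K τ X))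
    (opL T S K B τ (toL2 τ T u)), opL_ae hT hS hK B hτ (toL2 τ T u),
    coeFn_toL2 (memLp_of_continuousOn (freeY_continuousOn hT hS hK hτ X)),
    ae_restrict_mem measurableSet_Ioc] with t h1 h2 h3 h4 h5 ht
  have ht' := Ioc_subset_Icc_self ht
  rw [h1, h2, h3, Pi.add_apply, h4, h5, resp_eq hT hS hK hτ X (intervalIntegrable_clm_comp B
    (intervalIntegrable_of_memLp hτ.2 hu)) ht']
  congr 1
  refine intervalIntegral_congr_ae_Ioc ht'.1 ?_
  filter_upwards [ae_restrict_of_ae_restrict_of_subset (Ioc_subset_Ioc_right ht'.2)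
    (coeFn_toL2 hu)] with s hs
  rw [hs]

theorem cost_eq {τ : ℝ} (hτ : τ ≤ T) {u : ℝ → U} {w : ℝ → H}
    (hu : MemLp u 2 (volume.restrict (Ioc τ T))) (hw : MemLp w 2 (volume.restrict (Ioc τ T))) :
    cost T Q τ u w = (inner ℂ (toL2 τ T w) (Q.compLpL 2 (volume.restrict (Ioc τ T))
      (toL2 τ T w))).re + ‖toL2 τ T u‖ ^ 2 := by
  have hu2 : (‖toL2 τ T u‖ ^ 2 : ℝ) = (inner ℂ (toL2 τ T u) (toL2 τ T u) : ℂ).re :=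
    norm_sq_eq_re_inner (𝕜 := ℂ) _
  have hQw : Q.compLpL 2 (volume.restrict (Ioc τ T)) (toL2 τ T w)
      =ᵐ[volume.restrict (Ioc τ T)] fun t => Q (w t) := by
    filter_upwards [Q.coeFn_compLpL (p := 2) (toL2 τ T w), coeFn_toL2 hw] with t h1 h2
    rw [h1, h2]
  have i1 : IntervalIntegrable (fun t => (inner ℂ (w t) (Q (w t)) : ℂ)) volume τ T := by
    rw [intervalIntegrable_iff_integrableOn_Ioc_of_le hτ]
    refine (L2.integrable_inner (𝕜 := ℂ) (toL2 τ T w)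
      (Q.compLpL 2 (volume.restrict (Ioc τ T)) (toL2 τ T w))).congr ?_
    filter_upwards [hQw, coeFn_toL2 hw] with t h1 h2
    rw [h1, h2]
  have i2 : IntervalIntegrable (fun t => (inner ℂ (u t) (u t) : ℂ)) volume τ T := by
    rw [intervalIntegrable_iff_integrableOn_Ioc_of_le hτ]
    refine (L2.integrable_inner (𝕜 := ℂ) (toL2 τ T u) (toL2 τ T u)).congr ?_
    filter_upwards [coeFn_toL2 hu] with t h1
    rw [h1]
  rw [hu2, L2_inner_congr hτ (coeFn_toL2 hw) hQw, L2_inner_congr hτ (coeFn_toL2 hu)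
    (coeFn_toL2 hu), ← Complex.add_re, ← intervalIntegral.integral_add i1 i2,
    re_intervalIntegral (i1.add i2), cost]
  refine intervalIntegral.integral_congr fun t _ => ?_
  have : (‖u t‖ ^ 2 : ℝ) = (inner ℂ (u t) (u t) : ℂ).re := norm_sq_eq_re_inner (𝕜 := ℂ) _
  simp only [Complex.add_re, this]

theorem isMildSolution_stateY (hT : 0 ≤ T) (hS : IsC0Semigroup S) (hK : IntegrableOn K (Ioc 0 T))
    (hQ : Q.IsPositive) {τ : ℝ} (hτ : τ ∈ Icc 0 T) (X : Y H τ) :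
    IsMildSolution T S K B τ X (ctrlY T S K B Q τ X) (stateY T S K B Q τ X) := by
  have h := optSysY (B := B) hT hS hK hQ hτ X
  refine (isMildSolution_iff hT hS hK B hτ X (memLp_of_continuousOn h.contU)).2
    ⟨memLp_of_continuousOn h.contW, ?_⟩
  filter_upwards [ae_restrict_mem measurableSet_Ioc] with t ht
  have ht' := Ioc_subset_Icc_self ht
  rw [resp_eq hT hS hK hτ X (h.contBU.intervalIntegrable_of_Icc hτ.2) ht', h.state t ht']

theorem toL2_ctrlY (hT : 0 ≤ T) (hS : IsC0Semigroup S) (hK : IntegrableOn K (Ioc 0 T))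
    (hQ : Q.IsPositive) {τ : ℝ} (hτ : τ ∈ Icc 0 T) (X : Y H τ) :
    toL2 τ T (ctrlY T S K B Q τ X) = ctrlL2 T S K B Q τ (toL2 τ T (freeY T S K τ X)) := by
  rw [← toL2_coeFn (ctrlL2 T S K B Q τ (toL2 τ T (freeY T S K τ X)))]
  exact (toL2_congr (ctrlL2_ae hT hS hK B hQ hτ (freeY_continuousOn hT hS hK hτ X))).symm

theorem toL2_stateY (hT : 0 ≤ T) (hS : IsC0Semigroup S) (hK : IntegrableOn K (Ioc 0 T))
    {τ : ℝ} (hτ : τ ∈ Icc 0 T) (X : Y H τ) :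
    toL2 τ T (stateY T S K B Q τ X) = lqState (opL T S K B τ)
      (Q.compLpL 2 (volume.restrict (Ioc τ T))) (toL2 τ T (freeY T S K τ X)) := by
  rw [← toL2_coeFn (lqState (opL T S K B τ) _ (toL2 τ T (freeY T S K τ X)))]
  exact (toL2_congr (lqState_ae hT hS hK B Q hτ (freeY_continuousOn hT hS hK hτ X))).symm

/-- The optimal cost is the value of the quadratic form of `costL2` at the free response. -/
theorem cost_optimal (hT : 0 ≤ T) (hS : IsC0Semigroup S) (hK : IntegrableOn K (Ioc 0 T))
    (hQ : Q.IsPositive) {τ : ℝ} (hτ : τ ∈ Icc 0 T) (X : Y H τ) :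
    cost T Q τ (ctrlY T S K B Q τ X) (stateY T S K B Q τ X)
      = (inner ℂ (toL2 τ T (freeY T S K τ X))
          (costL2 T S K B Q τ (toL2 τ T (freeY T S K τ X)))).re := by
  have h := optSysY (B := B) hT hS hK hQ hτ X
  rw [cost_eq hτ.2 (memLp_of_continuousOn h.contU) (memLp_of_continuousOn h.contW),
    toL2_ctrlY hT hS hK hQ hτ, toL2_stateY hT hS hK hτ, costL2,
    lq_cost_eq (isPositive_compLpL hQ _)]
  rfl

theorem isOptimalPair (hT : 0 ≤ T) (hS : IsC0Semigroup S) (hK : IntegrableOn K (Ioc 0 T))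
    (hQ : Q.IsPositive) {τ : ℝ} (hτ : τ ∈ Icc 0 T) (X : Y H τ) :
    IsOptimalPair T S K B Q τ X (ctrlY T S K B Q τ X) (stateY T S K B Q τ X) := by
  have h := optSysY (B := B) hT hS hK hQ hτ X
  refine ⟨memLp_of_continuousOn h.contU, isMildSolution_stateY hT hS hK hQ hτ X,
    fun v z hv hz => ?_⟩
  rw [cost_optimal hT hS hK hQ hτ, cost_eq hτ.2 hv hz.1, toL2_mild hT hS hK hτ X hv hz]
  have := lq_cost_ge (L := opL T S K B τ) (isPositive_compLpL hQ (volume.restrict (Ioc τ T)))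
    (toL2 τ T (freeY T S K τ X)) (toL2 τ T v)
  refine le_trans ?_ this
  exact le_add_of_nonneg_right (sq_nonneg _)

theorem IsOptimalPair.ae_eq (hT : 0 ≤ T) (hS : IsC0Semigroup S) (hK : IntegrableOn K (Ioc 0 T))
    (hQ : Q.IsPositive) {τ : ℝ} (hτ : τ ∈ Icc 0 T) {X : Y H τ} {u : ℝ → U} {w : ℝ → H}
    (h : IsOptimalPair T S K B Q τ X u w) :
    u =ᵐ[volume.restrict (Ioc τ T)] ctrlY T S K B Q τ X ∧
      w =ᵐ[volume.restrict (Ioc τ T)] stateY T S K B Q τ X := by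
  obtain ⟨hu, hw, hmin⟩ := h
  have h0 := optSysY (B := B) hT hS hK hQ hτ X
  have hu0 := memLp_of_continuousOn h0.contU
  have hw0 := isMildSolution_stateY (B := B) hT hS hK hQ hτ X
  have h1 := hmin _ _ hu0 hw0
  have h2 := lq_cost_ge (L := opL T S K B τ) (isPositive_compLpL hQ (volume.restrict (Ioc τ T)))
    (toL2 τ T (freeY T S K τ X)) (toL2 τ T u)
  rw [cost_optimal hT hS hK hQ hτ, cost_eq hτ.2 hu hw.1, toL2_mild hT hS hK hτ X hu hw] at h1
  -- Equality in the lower bound for the cost forces the control to be the optimal one.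
  have h3 : ‖toL2 τ T u - lqCtrl (opL T S K B τ) (Q.compLpL 2 (volume.restrict (Ioc τ T)))
      (toL2 τ T (freeY T S K τ X))‖ ^ 2 ≤ 0 := by
    have := h2.trans h1
    rw [costL2] at this
    linarith
  have h4 : toL2 τ T u = ctrlL2 T S K B Q τ (toL2 τ T (freeY T S K τ X)) := by
    rw [← sub_eq_zero, ← norm_eq_zero]
    exact pow_eq_zero_iff two_ne_zero |>.1 (le_antisymm h3 (sq_nonneg _))
  have h5 : u =ᵐ[volume.restrict (Ioc τ T)] ctrlY T S K B Q τ X := by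
    rw [← toL2_ctrlY hT hS hK hQ hτ] at h4
    have h6 := coeFn_toL2 hu0
    rw [← h4] at h6
    exact (coeFn_toL2 hu).symm.trans h6
  refine ⟨h5, ?_⟩
  refine ((isMildSolution_iff hT hS hK B hτ X hu).1 hw).2.trans (EventuallyEq.trans ?_
    ((isMildSolution_iff hT hS hK B hτ X hu0).1 hw0).2.symm)
  filter_upwards [ae_restrict_mem measurableSet_Ioc] with t ht
  refine resp_congr X ?_ (Ioc_subset_Icc_self ht)
  filter_upwards [h5] with s hs
  rw [hs]

/-! ### The optimal evolution -/

theorem stateY_self (hT : 0 ≤ T) (hS : IsC0Semigroup S) (hK : IntegrableOn K (Ioc 0 T))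
    {τ : ℝ} (X : Y H τ) : stateY T S K B Q τ X τ = X.fst := by
  rw [stateY, optState, intervalIntegral.integral_same, add_zero, freeY, freeF,
    intervalIntegral.integral_same, add_zero, sub_self, famF_zero hT hS hK]
  rfl

/-- The optimal pair may be restarted: its restriction to `[t,T]` is the optimal pair for the
datum at the time `t`. -/
theorem stateY_flow (hT : 0 ≤ T) (hS : IsC0Semigroup S) (hK : IntegrableOn K (Ioc 0 T))
    (hQ : Q.IsPositive) {τ t : ℝ} (hτ : τ ∈ Icc 0 T) (ht : t ∈ Icc τ T) {X : Y H τ} {X' : Y H t}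
    (h1 : X'.fst = stateY T S K B Q τ X t)
    (h2 : X'.snd =ᵐ[volume.restrict (Ioc 0 t)] extHist X (stateY T S K B Q τ X)) {p : ℝ}
    (hp : p ∈ Icc t T) : stateY T S K B Q t X' p = stateY T S K B Q τ X p := by
  have hF := strongCont_famF hT hS hK
  have ht0 : t ∈ Icc 0 T := ⟨hτ.1.trans ht.1, ht.2⟩
  have hs := Icc_subset_Icc_left (b := T) ht.1
  have h := optSysY (B := B) hT hS hK hQ hτ X
  have hBu := h.contBU.intervalIntegrable_of_Icc (μ := volume) hτ.2
  have hext : ∀ s ∈ Ioc 0 τ, extHist X (stateY T S K B Q τ X) s = X.snd s := fun s hs => by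
    rw [extHist, if_pos hs.2]
  have hflow := freeF_flow hT hS hK hτ.1 ht (ξ := X.fst)
    (y := extHist X (stateY T S K B Q τ X)) (w := stateY T S K B Q τ X)
    (v := fun s => B (ctrlY T S K B Q τ X s)) ?_ (fun s hs => by
      rw [extHist, if_neg (not_le.2 hs.1)]) hBu h.contW (fun r hr => ?_)
  -- The restriction to `[t,T]` solves the optimality system of `X'`; use uniqueness.
  · have key : OptSys T (famF T S K) B Q t (freeY T S K t X') (ctrlY T S K B Q τ X)
        (stateY T S K B Q τ X) := by
      refine ⟨h.contU.mono hs, h.contW.mono hs, fun r hr => ?_, fun r hr => h.ctrl r (hs hr)⟩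
      rw [← resp_eq hT hS hK ht0 X' (intervalIntegrable_tail hBu ht) hr, hflow r hr, resp, h1]
      have : ∀ s, hist T K 0 t (extHist X (stateY T S K B Q τ X)) s = hist T K 0 t X'.snd s :=
        fun s => intervalIntegral_congr_ae_Ioc ht0.1 (by
          filter_upwards [h2] with σ hσ
          rw [hσ])
      simp only [this]
    exact ((optSysY (B := B) hT hS hK hQ ht0 X').unique hF hQ ht0 (fun _ _ => rfl) key p hp).2
  · refine (L2.intervalIntegrable hτ.1 X.snd).congr_ae ?_
    rw [uIoc_of_le hτ.1]
    filter_upwards [ae_restrict_mem measurableSet_Ioc] with s hs using (hext s hs).symm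
  · rw [h.state r hr, ← resp_eq hT hS hK hτ X hBu hr, resp]
    have : ∀ s, hist T K 0 τ (extHist X (stateY T S K B Q τ X)) s = hist T K 0 τ X.snd s :=
      hist_congr hτ.1 hext
    simp only [this]

/-- The optimal state depends boundedly, in the uniform norm, on the initial datum. -/
theorem exists_bcf_stateY (hT : 0 ≤ T) (hS : IsC0Semigroup S) (hK : IntegrableOn K (Ioc 0 T))
    (B : U →L[ℂ] H) (Q : H →L[ℂ] H) {τ : ℝ} (hτ : τ ∈ Icc 0 T) :
    ∃ L : Y H τ →L[ℂ] (ℝ →ᵇ H), ∀ X t, L X t = stateY T S K B Q τ X (clq τ T t) := by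
  obtain ⟨E, hE⟩ := exists_bcf_freeY hT hS hK hτ
  obtain ⟨L, hL⟩ := exists_bcf_opL hT hS hK B hτ
  refine ⟨E + L.comp ((ctrlL2 T S K B Q τ).comp ((bcfToL2 τ T).comp E)), fun X t => ?_⟩
  change E X t + L (ctrlL2 T S K B Q τ (bcfToL2 τ T (E X))) t = _
  have : bcfToL2 τ T (E X) = toL2 τ T (freeY T S K τ X) :=
    bcfToL2_eq_toL2 fun t ht => by rw [hE, clq_of_mem (Ioc_subset_Icc_self ht)]
  rw [hE, hL, this]
  rfl

/-- The optimal evolution map from the time `τ` to the time `t`. -/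
theorem exists_evolution (hT : 0 ≤ T) (hS : IsC0Semigroup S) (hK : IntegrableOn K (Ioc 0 T))
    (B : U →L[ℂ] H) (Q : H →L[ℂ] H) {τ t : ℝ} (hτ : τ ∈ Icc 0 T) (ht : t ∈ Icc τ T) :
    ∃ Φ : Y H τ →L[ℂ] Y H t, ∀ X, (Φ X).fst = stateY T S K B Q τ X t ∧
      (Φ X).snd =ᵐ[volume.restrict (Ioc 0 t)] extHist X (stateY T S K B Q τ X) := by
  obtain ⟨L, hL⟩ := exists_bcf_stateY hT hS hK B Q hτ
  -- `J₁` carries over the old history on `(0,τ]`, and `J₂` the optimal state on `(τ,t]`.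
  obtain ⟨J₁, hJ₁⟩ := exists_extendByZero (V := H) (a := 0) (b := τ) (c := 0) (d := t)
    (Ioc_subset_Ioc_right ht.1)
  obtain ⟨J₂, hJ₂⟩ := exists_extendByZero (V := H) (a := τ) (b := t) (c := 0) (d := t)
    (Ioc_subset_Ioc_left hτ.1)
  refine ⟨((WithLp.prodContinuousLinearEquiv 2 ℂ H (L2 H 0 t)).symm :
      (H × L2 H 0 t) →L[ℂ] Y H t).comp
    (((BoundedContinuousFunction.evalCLM ℂ (β := H) t).comp L).prod
      (J₁.comp (WithLp.sndL 2 ℂ H (L2 H 0 τ)) + J₂.comp ((bcfToL2 τ t).comp L))), fun X => ?_⟩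
  constructor
  · change L X t = _
    rw [hL, clq_of_mem ht]
  · change ((J₁ X.snd + J₂ (bcfToL2 τ t (L X)) : L2 H 0 t) : ℝ → H) =ᵐ[_] _
    filter_upwards [Lp.coeFn_add (J₁ X.snd) (J₂ (bcfToL2 τ t (L X))),
      hJ₁ X.snd _ (EventuallyEq.refl _ _), hJ₂ _ _ (coeFn_bcfToL2 τ t (L X)),
      ae_restrict_mem measurableSet_Ioc] with s h1 h2 h3 hs
    rw [h1, Pi.add_apply, h2, h3, extHist]
    by_cases hsτ : s ≤ τ
    · rw [if_pos hsτ, indicator_of_mem (show s ∈ Ioc 0 τ from ⟨hs.1, hsτ⟩),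
        indicator_of_notMem (fun h => absurd h.1 (not_lt.2 hsτ)), add_zero]
    · rw [if_neg hsτ, indicator_of_notMem (fun h => hsτ h.2),
        indicator_of_mem (show s ∈ Ioc τ t from ⟨not_le.1 hsτ, hs.2⟩), zero_add, hL,
        clq_of_mem ⟨(not_le.1 hsτ).le, hs.2.trans ht.2⟩]

/-- The optimal evolution maps form a bounded evolution operator. -/
theorem exists_evolution_family (hT : 0 ≤ T) (hS : IsC0Semigroup S)
    (hK : IntegrableOn K (Ioc 0 T)) (B : U →L[ℂ] H) (hQ : Q.IsPositive) :
    ∃ Φ : (t τ : ℝ) → (Y H τ →L[ℂ] Y H t),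
      (∀ τ ∈ Icc 0 T, ∀ t ∈ Icc τ T, ∀ X : Y H τ,
        (Φ t τ X).fst = stateY T S K B Q τ X t ∧
        (Φ t τ X).snd =ᵐ[volume.restrict (Ioc 0 t)] extHist X (stateY T S K B Q τ X)) ∧
      (∀ t ∈ Icc 0 T, Φ t t = ContinuousLinearMap.id ℂ (Y H t)) ∧
      (∀ τ τ₁ t : ℝ, 0 ≤ τ → τ ≤ τ₁ → τ₁ ≤ t → t ≤ T →
        Φ t τ = (Φ t τ₁).comp (Φ τ₁ τ)) := by
  have hex : ∀ t τ : ℝ, ∃ Φ : Y H τ →L[ℂ] Y H t, τ ∈ Icc 0 T → t ∈ Icc τ T →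
      ∀ X, (Φ X).fst = stateY T S K B Q τ X t ∧
        (Φ X).snd =ᵐ[volume.restrict (Ioc 0 t)] extHist X (stateY T S K B Q τ X) := fun t τ => by
    by_cases h : τ ∈ Icc 0 T ∧ t ∈ Icc τ T
    · obtain ⟨Φ, hΦ⟩ := exists_evolution hT hS hK B Q h.1 h.2
      exact ⟨Φ, fun _ _ => hΦ⟩
    · exact ⟨0, fun h1 h2 => absurd ⟨h1, h2⟩ h⟩
  choose Φ hΦ using hex
  have hext : ∀ {t : ℝ} {X X' : Y H t}, X.fst = X'.fst →
      X.snd =ᵐ[volume.restrict (Ioc 0 t)] X'.snd → X = X' := fun h1 h2 =>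
    (WithLp.ofLp_injective 2) (Prod.ext h1 (Lp.ext h2))
  refine ⟨Φ, fun τ hτ t ht => hΦ t τ hτ ht, fun t ht => ?_, fun τ τ₁ t h0 h1 h2 h3 => ?_⟩
  · ext1 X
    obtain ⟨e1, e2⟩ := hΦ t t ht ⟨le_rfl, ht.2⟩ X
    refine hext (e1.trans (stateY_self hT hS hK X)) ?_
    filter_upwards [e2, ae_restrict_mem measurableSet_Ioc] with s hs hm
    rw [hs, extHist, if_pos hm.2]
    rfl
  · have hτ : τ ∈ Icc 0 T := ⟨h0, (h1.trans h2).trans h3⟩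
    have hτ₁ : τ₁ ∈ Icc 0 T := ⟨h0.trans h1, h2.trans h3⟩
    ext1 X
    obtain ⟨e1, e2⟩ := hΦ τ₁ τ hτ ⟨h1, h2.trans h3⟩ X
    obtain ⟨e3, e4⟩ := hΦ t τ₁ hτ₁ ⟨h2, h3⟩ (Φ τ₁ τ X)
    obtain ⟨e5, e6⟩ := hΦ t τ hτ ⟨h1.trans h2, h3⟩ X
    have hf : ∀ p ∈ Icc τ₁ T, stateY T S K B Q τ₁ (Φ τ₁ τ X) p = stateY T S K B Q τ X p :=
      fun p hp => stateY_flow hT hS hK hQ hτ ⟨h1, h2.trans h3⟩ e1 e2 hp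
    rw [ContinuousLinearMap.comp_apply]
    refine hext ?_ ?_
    · rw [e5, e3, hf t ⟨h2, h3⟩]
    · have e2' : ∀ᵐ s ∂(volume.restrict (Ioc 0 t)), s ∈ Ioc 0 τ₁ →
          (Φ τ₁ τ X).snd s = extHist X (stateY T S K B Q τ X) s :=
        ae_restrict_of_ae ((ae_restrict_iff' measurableSet_Ioc).1 e2)
      filter_upwards [e6, e4, e2', ae_restrict_mem measurableSet_Ioc] with s k1 k2 k3 hs
      rw [k1, k2]
      by_cases hsτ : s ≤ τ₁
      · conv_rhs => rw [extHist, if_pos hsτ]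
        exact (k3 ⟨hs.1, hsτ⟩).symm
      · have hlt := not_le.1 hsτ
        conv_rhs => rw [extHist, if_neg hsτ]
        rw [hf s ⟨hlt.le, hs.2.trans h3⟩, extHist, if_neg (not_le.2 (h1.trans_lt hlt))]

end

section

variable {H U : Type*} [NormedAddCommGroup H] [InnerProductSpace ℂ H] [CompleteSpace H]
  [NormedAddCommGroup U] [InnerProductSpace ℂ U] [CompleteSpace U]
  {T : ℝ} {S : ℝ → H →L[ℂ] H} {K : ℝ → ℝ} {B : U →L[ℂ] H} {Q : H →L[ℂ] H}

/-! ### The optimal cost as a quadratic form -/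

theorem integral_costOp1 (hT : 0 ≤ T) (hS : IsC0Semigroup S) (hK : IntegrableOn K (Ioc 0 T))
    {τ : ℝ} (hτ : τ ∈ Icc 0 T) {y : ℝ → H} (hy : IntervalIntegrable y volume 0 τ) :
    ∫ s in (0 : ℝ)..τ, costOp1 T S K B Q τ s (y s)
      = ContinuousLinearMap.adjoint (freeOp T S K τ) (costL2 T S K B Q τ
        (kernelInt (memOp T S K τ) 0 τ y)) :=
  (clm_kernelInt (continuous_memOp hT hS hK hτ) hy
    ((ContinuousLinearMap.adjoint (freeOp T S K τ)).comp (costL2 T S K B Q τ))).symm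

theorem integral_costOp2 (hT : 0 ≤ T) (hS : IsC0Semigroup S) (hK : IntegrableOn K (Ioc 0 T))
    {τ : ℝ} (hτ : τ ∈ Icc 0 T) (q : ℝ) {y : ℝ → H} (hy : IntervalIntegrable y volume 0 τ) :
    ∫ s in (0 : ℝ)..τ, costOp2 T S K B Q τ s q (y s)
      = ContinuousLinearMap.adjoint (memOp T S K τ q) (costL2 T S K B Q τ
        (kernelInt (memOp T S K τ) 0 τ y)) :=
  (clm_kernelInt (continuous_memOp hT hS hK hτ) hy
    ((ContinuousLinearMap.adjoint (memOp T S K τ q)).comp (costL2 T S K B Q τ))).symm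

theorem intervalIntegrable_costOp1 (hT : 0 ≤ T) (hS : IsC0Semigroup S)
    (hK : IntegrableOn K (Ioc 0 T)) {τ : ℝ} (hτ : τ ∈ Icc 0 T) {y : ℝ → H}
    (hy : IntervalIntegrable y volume 0 τ) :
    IntervalIntegrable (fun s => costOp1 T S K B Q τ s (y s)) volume 0 τ :=
  intervalIntegrable_kernel_apply (continuous_const.clm_comp
    (continuous_const.clm_comp (continuous_memOp hT hS hK hτ))) hy

theorem inner_costL2_symm (hQ : Q.IsPositive) {τ : ℝ} (f g : L2 H τ T) :
    inner ℂ (costL2 T S K B Q τ f) g = inner ℂ f (costL2 T S K B Q τ g) :=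
  (isPositive_costL2 hQ τ).inner_left_eq_inner_right f g

theorem ofReal_cost_optimal (hT : 0 ≤ T) (hS : IsC0Semigroup S) (hK : IntegrableOn K (Ioc 0 T))
    (hQ : Q.IsPositive) {τ : ℝ} (hτ : τ ∈ Icc 0 T) (X : Y H τ) :
    (cost T Q τ (ctrlY T S K B Q τ X) (stateY T S K B Q τ X) : ℂ)
      = inner ℂ (toL2 τ T (freeY T S K τ X))
          (costL2 T S K B Q τ (toL2 τ T (freeY T S K τ X))) := by
  rw [cost_optimal hT hS hK hQ hτ]
  refine Complex.conj_eq_iff_re.1 ?_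
  rw [inner_conj_symm, inner_costL2_symm hQ]

/-- The optimal cost, with the free response split into the part due to the present state and the
part due to the history. -/
theorem cost_eq_form (hT : 0 ≤ T) (hS : IsC0Semigroup S) (hK : IntegrableOn K (Ioc 0 T))
    (hQ : Q.IsPositive) {τ : ℝ} (hτ : τ ∈ Icc 0 T) (X : Y H τ) :
    (cost T Q τ (ctrlY T S K B Q τ X) (stateY T S K B Q τ X) : ℂ) =
      inner ℂ X.fst (costOp0 T S K B Q τ X.fst)
      + ((2 * (∫ s in (0 : ℝ)..τ,
          inner ℂ X.fst (costOp1 T S K B Q τ s (X.snd s))).re : ℝ) : ℂ)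
      + ∫ q in (0 : ℝ)..τ, ∫ s in (0 : ℝ)..τ,
          inner ℂ (X.snd q) (costOp2 T S K B Q τ s q (X.snd s)) := by
  have hy := L2.intervalIntegrable hτ.1 X.snd
  set m : L2 H τ T := kernelInt (memOp T S K τ) 0 τ X.snd with hm
  have h1 : ∫ s in (0 : ℝ)..τ, (inner ℂ X.fst (costOp1 T S K B Q τ s (X.snd s)) : ℂ)
      = inner ℂ (freeOp T S K τ X.fst) (costL2 T S K B Q τ m) := by
    rw [← intervalIntegral_inner_right (intervalIntegrable_costOp1 hT hS hK hτ hy),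
      integral_costOp1 hT hS hK hτ hy, ContinuousLinearMap.adjoint_inner_right]
  have h2 : ∫ q in (0 : ℝ)..τ, ∫ s in (0 : ℝ)..τ,
      (inner ℂ (X.snd q) (costOp2 T S K B Q τ s q (X.snd s)) : ℂ)
      = inner ℂ m (costL2 T S K B Q τ m) := by
    rw [hm, inner_kernelInt (continuous_memOp hT hS hK hτ) hy, ← hm]
    refine intervalIntegral_congr_Ioc hτ.1 fun q _ => ?_
    rw [← intervalIntegral_inner_right, integral_costOp2 hT hS hK hτ q hy,
      ContinuousLinearMap.adjoint_inner_right]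
    exact intervalIntegrable_kernel_apply (continuous_const.clm_comp
      (continuous_const.clm_comp (continuous_memOp hT hS hK hτ))) hy
  have h3 : (inner ℂ m (costL2 T S K B Q τ (freeOp T S K τ X.fst)) : ℂ)
      = starRingEnd ℂ (inner ℂ (freeOp T S K τ X.fst) (costL2 T S K B Q τ m)) := by
    rw [inner_conj_symm, inner_costL2_symm hQ]
  have h4 : (inner ℂ X.fst (costOp0 T S K B Q τ X.fst) : ℂ)
      = inner ℂ (freeOp T S K τ X.fst) (costL2 T S K B Q τ (freeOp T S K τ X.fst)) := by
    rw [costOp0]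
    simp only [ContinuousLinearMap.comp_apply, ContinuousLinearMap.adjoint_inner_right]
  rw [ofReal_cost_optimal hT hS hK hQ hτ, toL2_freeY hT hS hK hτ, ← hm, h1, h2, h4, map_add,
    inner_add_left, inner_add_right, inner_add_right, h3, ← Complex.add_conj]
  ring

/-- The operator on `Y_τ` whose quadratic form is the optimal cost. -/
theorem exists_costOp (hT : 0 ≤ T) (hS : IsC0Semigroup S) (hK : IntegrableOn K (Ioc 0 T))
    (hQ : Q.IsPositive) {τ : ℝ} (hτ : τ ∈ Icc 0 T) :
    ∃ P : Y H τ →L[ℂ] Y H τ, ∀ X : Y H τ,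
      (P X).fst = costOp0 T S K B Q τ X.fst
        + (∫ s in (0 : ℝ)..τ, costOp1 T S K B Q τ s (X.snd s)) ∧
      (∀ᵐ q ∂(volume.restrict (Ioc 0 τ)), (P X).snd q =
        ContinuousLinearMap.adjoint (costOp1 T S K B Q τ q) X.fst
          + ∫ s in (0 : ℝ)..τ, costOp2 T S K B Q τ s q (X.snd s)) ∧
      (cost T Q τ (ctrlY T S K B Q τ X) (stateY T S K B Q τ X) : ℂ) = inner ℂ X (P X) := by
  have hN := continuous_memOp hT hS hK hτ
  obtain ⟨m, hm⟩ := exists_kernel_clm (V := H) hτ.1 hN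
  set E := freeOp T S K τ with hE
  set C := costL2 T S K B Q τ with hC
  set f : Y H τ →L[ℂ] L2 H τ T :=
    E.comp (WithLp.fstL 2 ℂ H (L2 H 0 τ)) + m.comp (WithLp.sndL 2 ℂ H (L2 H 0 τ)) with hf
  refine ⟨((WithLp.prodContinuousLinearEquiv 2 ℂ H (L2 H 0 τ)).symm :
      (H × L2 H 0 τ) →L[ℂ] Y H τ).comp
    (((ContinuousLinearMap.adjoint E).comp (C.comp f)).prod
      ((ContinuousLinearMap.adjoint m).comp (C.comp f))), fun X => ?_⟩
  have hy := L2.intervalIntegrable hτ.1 X.snd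
  have hfX : f X = E X.fst + m X.snd := rfl
  refine ⟨?_, ?_, ?_⟩
  · change ContinuousLinearMap.adjoint E (C (f X)) = _
    rw [integral_costOp1 hT hS hK hτ hy, ← hm, hfX, map_add, map_add]
    rfl
  · change ∀ᵐ q ∂_, ContinuousLinearMap.adjoint m (C (f X)) q = _
    filter_upwards [adjoint_kernel_clm hτ.1 hN hm (C (f X))] with q hq
    rw [hq, integral_costOp2 hT hS hK hτ q hy, ← hm, hfX, map_add, map_add]
    congr 1
    refine ext_inner_left ℂ fun z => ?_
    rw [ContinuousLinearMap.adjoint_inner_right, ContinuousLinearMap.adjoint_inner_right, costOp1]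
    simp only [ContinuousLinearMap.comp_apply, ContinuousLinearMap.adjoint_inner_left]
    rw [inner_costL2_symm hQ]
  · rw [ofReal_cost_optimal hT hS hK hQ hτ, toL2_freeY hT hS hK hτ, ← hm, ← hE, ← hfX, ← hC]
    conv_lhs => rw [hfX]
    rw [inner_add_left, WithLp.prod_inner_apply]
    change _ = inner ℂ X.fst (ContinuousLinearMap.adjoint E (C (f X)))
      + inner ℂ X.snd (ContinuousLinearMap.adjoint m (C (f X)))
    rw [ContinuousLinearMap.adjoint_inner_right, ContinuousLinearMap.adjoint_inner_right, hfX]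

/-- The operator with kernel `P₂` is `m^* C m`, where `m` takes a history to its free response and
`C` is the operator `costL2`. -/
theorem exists_memCostOp (hT : 0 ≤ T) (hS : IsC0Semigroup S) (hK : IntegrableOn K (Ioc 0 T))
    (B : U →L[ℂ] H) (hQ : Q.IsPositive) {τ : ℝ} (hτ : τ ∈ Icc 0 T) :
    ∃ P : L2 H 0 τ →L[ℂ] L2 H 0 τ,
      (∀ ξ : L2 H 0 τ, ∀ᵐ q ∂(volume.restrict (Ioc 0 τ)),
        P ξ q = ∫ s in (0 : ℝ)..τ, costOp2 T S K B Q τ s q (ξ s)) ∧ P.IsPositive := by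
  have hN := continuous_memOp hT hS hK hτ
  obtain ⟨m, hm⟩ := exists_kernel_clm (V := H) hτ.1 hN
  refine ⟨(ContinuousLinearMap.adjoint m).comp ((costL2 T S K B Q τ).comp m), fun ξ => ?_,
    (isPositive_costL2 hQ τ).adjoint_conj m⟩
  filter_upwards [adjoint_kernel_clm hτ.1 hN hm (costL2 T S K B Q τ (m ξ))] with q hq
  rw [integral_costOp2 hT hS hK hτ q (L2.intervalIntegrable hτ.1 ξ), ← hm, ← hq]
  rfl

/-! ### The feedback law -/

/-- The initial value of the costate is the adjoint of `x ↦ F(·,τ) x`, applied to the image of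
the free response under the cost operator. -/
theorem costate_eq (hT : 0 ≤ T) (hS : IsC0Semigroup S) (hK : IntegrableOn K (Ioc 0 T))
    (hQ : Q.IsPositive) {τ : ℝ} (hτ : τ ∈ Icc 0 T) {f : ℝ → H} (hf : ContinuousOn f (Icc τ T)) :
    costate (famF T S K) T (fun p => Q (optState T S K B Q τ f p)) τ
      = ContinuousLinearMap.adjoint (freeOp T S K τ) (costL2 T S K B Q τ (toL2 τ T f)) := by
  refine ext_inner_left ℂ fun y => ?_
  rw [ContinuousLinearMap.adjoint_inner_right, freeOp_apply hT hS hK hτ,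
    inner_costL2 hT hS hK B Q hτ hf (freeResp_continuousOn hT hS hK τ y _),
    inner_costate (strongCont_famF hT hS hK) hτ.2
      ((optSys hT hS hK B hQ hτ hf).contQW.intervalIntegrable_of_Icc hτ.2)]

theorem costate_congr {F : ℝ → H →L[ℂ] H} (hF : StrongCont F) {v w : ℝ → H} {σ : ℝ}
    (hσ : σ ≤ T) (hv : IntervalIntegrable v volume σ T) (hw : IntervalIntegrable w volume σ T)
    (h : ∀ p ∈ Ioc σ T, v p = w p) : costate F T v σ = costate F T w σ := by
  refine ext_inner_left ℂ fun y => ?_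
  rw [inner_costate hF hσ hv, inner_costate hF hσ hw]
  exact intervalIntegral_congr_Ioc hσ fun p hp => by rw [h p hp]

/-- The feedback law. By the flow property the optimal control at the time `t` is the initial value
of the optimal control restarted at `t`, which is given by the costate. -/
theorem ctrlY_feedback (hT : 0 ≤ T) (hS : IsC0Semigroup S) (hK : IntegrableOn K (Ioc 0 T))
    (hQ : Q.IsPositive) {τ t : ℝ} (hτ : τ ∈ Icc 0 T) (ht : t ∈ Icc τ T) (X : Y H τ) :
    ctrlY T S K B Q τ X t
      = -(ContinuousLinearMap.adjoint B (costOp0 T S K B Q t (stateY T S K B Q τ X t)))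
        - ∫ s in (0 : ℝ)..t, ContinuousLinearMap.adjoint B
            (costOp1 T S K B Q t s (extHist X (stateY T S K B Q τ X) s)) := by
  have hF := strongCont_famF hT hS hK
  have ht0 : t ∈ Icc 0 T := ⟨hτ.1.trans ht.1, ht.2⟩
  obtain ⟨Φ, hΦ⟩ := exists_evolution hT hS hK B Q hτ ht
  obtain ⟨h1, h2⟩ := hΦ X
  set X' := Φ X
  have h := optSysY (B := B) hT hS hK hQ hτ X
  have h' := optSysY (B := B) hT hS hK hQ ht0 X'
  have e1 : ∫ s in (0 : ℝ)..t, ContinuousLinearMap.adjoint B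
      (costOp1 T S K B Q t s (extHist X (stateY T S K B Q τ X) s))
      = ContinuousLinearMap.adjoint B (∫ s in (0 : ℝ)..t, costOp1 T S K B Q t s (X'.snd s)) := by
    rw [← ContinuousLinearMap.intervalIntegral_comp_comm _
      (intervalIntegrable_costOp1 hT hS hK ht0 (L2.intervalIntegrable ht0.1 X'.snd))]
    refine intervalIntegral_congr_ae_Ioc ht0.1 ?_
    filter_upwards [h2] with s hs
    rw [hs]
  rw [e1, ← h1, ← neg_add', ← map_add, h.ctrl t ht]
  congr 2
  rw [costate_congr hF ht.2 (w := fun p => Q (stateY T S K B Q t X' p))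
    ((h.contQW.mono (Icc_subset_Icc_left ht.1)).intervalIntegrable_of_Icc ht.2)
    (h'.contQW.intervalIntegrable_of_Icc ht.2) fun p hp => by
      rw [stateY_flow hT hS hK hQ hτ ht h1 h2 (Ioc_subset_Icc_self hp)]]
  unfold stateY
  rw [costate_eq hT hS hK hQ ht0 (freeY_continuousOn hT hS hK ht0 X'), toL2_freeY hT hS hK ht0,
    integral_costOp1 hT hS hK ht0 (L2.intervalIntegrable ht0.1 X'.snd), map_add, map_add]
  rfl

end

section

variable {H U : Type*} [NormedAddCommGroup H] [InnerProductSpace ℂ H] [CompleteSpace H]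
  [NormedAddCommGroup U] [InnerProductSpace ℂ U] [CompleteSpace U]
  {T a t : ℝ} {F G : ℝ → H →L[ℂ] H} {B : U →L[ℂ] H} {Q : H →L[ℂ] H}

/-! ### First order increments -/

theorem exists_pos_mul_le (c : ℝ) (hc : 0 ≤ c) {ε : ℝ} (hε : 0 < ε) :
    ∃ η, 0 < η ∧ η ≤ 1 ∧ η * c ≤ ε := by
  refine ⟨min 1 (ε / (c + 1)), by positivity, min_le_left _ _, ?_⟩
  calc min 1 (ε / (c + 1)) * c ≤ ε / (c + 1) * (c + 1) := by
        gcongr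
        · exact min_le_right _ _
        · linarith
    _ = ε := by field_simp

theorem eventually_abs_sub_le (s : Set ℝ) (t : ℝ) {η : ℝ} (hη : 0 < η) :
    ∀ᶠ r in 𝓝[s] t, |r - t| ≤ η := by
  filter_upwards [nhdsWithin_le_nhds (Metric.closedBall_mem_nhds t hη)] with r hr
  exact hr

theorem max_sub_min_eq (r t : ℝ) : max r t - min r t = |r - t| := max_sub_min_eq_abs' r t

/-- The functions `φ_r` converge to `c` in the mean over the interval between `r` and `t`, as
`r → t` in `[a,T]`. -/
def MeanTendsto {E : Type*} [NormedAddCommGroup E] (a T t : ℝ) (φ : ℝ → ℝ → E) (c : E) : Prop :=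
  ∀ ε > 0, ∀ᶠ r in 𝓝[Icc a T] t, ∫ σ in (min r t)..(max r t), ‖φ r σ - c‖ ≤ ε * |r - t|

theorem MeanTendsto.of_uniform {E : Type*} [NormedAddCommGroup E] {φ : ℝ → ℝ → E} {c : E}
    (h : ∀ ε > 0, ∀ᶠ r in 𝓝[Icc a T] t, ∀ σ ∈ Icc (min r t) (max r t), ‖φ r σ - c‖ ≤ ε) :
    MeanTendsto a T t φ c := by
  intro ε hε
  filter_upwards [h ε hε] with r hr
  have := intervalIntegral.norm_integral_le_of_norm_le_const (a := min r t) (b := max r t)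
    (f := fun σ => ‖φ r σ - c‖) (C := ε) (fun σ hσ => by
      rw [uIoc_of_le min_le_max] at hσ
      rw [norm_norm]
      exact hr σ (Ioc_subset_Icc_self hσ))
  rw [max_sub_min_eq, abs_abs] at this
  exact (le_abs_self _).trans this

/-- The convolution over a short interval, to first order and uniformly in the later time. -/
theorem conv_increment (hF : StrongCont F) (ht : t ∈ Icc a T) {φ : ℝ → ℝ → H} {c : H}
    (hφi : ∀ r ∈ Icc a T, IntervalIntegrable (φ r) volume (min r t) (max r t))
    (hφ : MeanTendsto a T t φ c) {ε : ℝ} (hε : 0 < ε) :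
    ∀ᶠ r in 𝓝[Icc a T] t, ∀ p ∈ Icc (max r t) T,
      ‖(∫ σ in (min r t)..(max r t), F (p - σ) (φ r σ)) - |r - t| • F (p - t) c‖
        ≤ ε * |r - t| := by
  obtain ⟨C, hC0, hC⟩ := hF.bdd
  obtain ⟨η, hη, -, hηC⟩ := exists_pos_mul_le (C + 1) (by positivity) hε
  have huc := (isCompact_Icc (a := 0) (b := T - a)).uniformContinuousOn_of_continuous
    (hF.cont c).continuousOn
  obtain ⟨d, hd, hdc⟩ := Metric.uniformContinuousOn_iff_le.1 huc η hη
  filter_upwards [hφ η hη, eventually_abs_sub_le _ t hd, self_mem_nhdsWithin] with r h1 h2 hr p hp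
  have hmm : min r t ≤ max r t := min_le_max
  have hma : a ≤ min r t := le_min hr.1 ht.1
  have i1 := hF.intervalIntegrable_conv (hφi r hr) p
  have i2 : IntervalIntegrable (fun σ => F (p - σ) c) volume (min r t) (max r t) :=
    hF.intervalIntegrable_conv intervalIntegrable_const p
  have e : (∫ σ in (min r t)..(max r t), F (p - σ) (φ r σ)) - |r - t| • F (p - t) c
      = (∫ σ in (min r t)..(max r t), F (p - σ) (φ r σ - c))
        + ∫ σ in (min r t)..(max r t), (F (p - σ) c - F (p - t) c) := by
    simp only [map_sub]
    rw [intervalIntegral.integral_sub i1 i2, intervalIntegral.integral_sub i2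
      intervalIntegrable_const, intervalIntegral.integral_const, max_sub_min_eq]
    abel
  rw [e]
  refine (norm_add_le _ _).trans ?_
  have b1 := norm_conv_le hC hmm ((hφi r hr).sub (intervalIntegrable_const (c := c)))
    (fun σ => p - σ)
  have b2 := intervalIntegral.norm_integral_le_of_norm_le_const (a := min r t) (b := max r t)
    (f := fun σ => F (p - σ) c - F (p - t) c) (C := η) (fun σ hσ => by
      rw [uIoc_of_le hmm] at hσ
      rw [← dist_eq_norm]
      refine hdc _ ⟨by linarith [hσ.2, hp.1], by linarith [hσ.1, hp.2]⟩ _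
        ⟨by linarith [le_max_right r t, hp.1], by linarith [ht.1, hp.2]⟩ ?_
      rw [Real.dist_eq, show p - σ - (p - t) = t - σ by ring]
      refine le_trans ?_ h2
      have := max_sub_min_eq r t
      have := min_le_right r t
      have := le_max_right r t
      exact abs_le.2 ⟨by linarith [hσ.2], by linarith [hσ.1]⟩)
  rw [max_sub_min_eq, abs_abs] at b2
  calc _ ≤ C * (η * |r - t|) + η * |r - t| :=
        add_le_add (b1.trans (mul_le_mul_of_nonneg_left h1 hC0)) b2
    _ = η * (C + 1) * |r - t| := by ring
    _ ≤ ε * |r - t| := by gcongr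

theorem inner_real_smul_left (h : ℝ) (x y : H) :
    (inner ℂ (h • x) y : ℂ) = (h : ℂ) * inner ℂ x y := by
  rw [← Complex.coe_smul, inner_smul_left, Complex.conj_ofReal]

/-- The pairing of a first order increment with a convergent family. -/
theorem pairing_increment (ht : t ∈ Icc a T) {α β : ℝ → ℝ → H} {α₀ β₀ : ℝ → H}
    (hα : ∀ ε > 0, ∀ᶠ r in 𝓝[Icc a T] t, ∀ p ∈ Icc (max r t) T,
      ‖α r p - |r - t| • α₀ p‖ ≤ ε * |r - t|)
    (hβ : ∀ ε > 0, ∀ᶠ r in 𝓝[Icc a T] t, ∀ p ∈ Icc (max r t) T, ‖β r p - β₀ p‖ ≤ ε)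
    (cα : ∀ r ∈ Icc a T, ContinuousOn (α r) (Icc (max r t) T))
    (cβ : ∀ r ∈ Icc a T, ContinuousOn (β r) (Icc (max r t) T))
    (cα₀ : ContinuousOn α₀ (Icc t T)) (cβ₀ : ContinuousOn β₀ (Icc t T)) {ε : ℝ} (hε : 0 < ε) :
    ∀ᶠ r in 𝓝[Icc a T] t, ‖(∫ p in (max r t)..T, (inner ℂ (α r p) (β r p) : ℂ))
      - ((|r - t| : ℝ) : ℂ) * ∫ p in t..T, (inner ℂ (α₀ p) (β₀ p) : ℂ)‖ ≤ ε * |r - t| := by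
  obtain ⟨A, hA⟩ := isCompact_Icc.exists_bound_of_continuousOn cα₀
  obtain ⟨D, hD⟩ := isCompact_Icc.exists_bound_of_continuousOn cβ₀
  have hA0 : 0 ≤ A := (norm_nonneg _).trans (hA t ⟨le_rfl, ht.2⟩)
  have hD0 : 0 ≤ D := (norm_nonneg _).trans (hD t ⟨le_rfl, ht.2⟩)
  have hTt : 0 ≤ T - t := by linarith [ht.2]
  obtain ⟨η, hη, hη1, hηε⟩ := exists_pos_mul_le ((T - t) * (D + 1 + A) + A * D) (by positivity) hε
  filter_upwards [hα η hη, hβ η hη, eventually_abs_sub_le _ t hη, self_mem_nhdsWithin]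
    with r h1 h2 h3 hr
  have hmT : max r t ≤ T := max_le hr.2 ht.2
  have htm : t ≤ max r t := le_max_right _ _
  have hs : Icc (max r t) T ⊆ Icc t T := Icc_subset_Icc_left htm
  have i0 := cα₀.intervalIntegrable_inner ht.2 cβ₀
  have i1 := (cα r hr).intervalIntegrable_inner hmT (cβ r hr)
  have i2 := (cα₀.mono hs).intervalIntegrable_inner hmT (cβ₀.mono hs)
  have i3 : IntervalIntegrable (fun p => (inner ℂ (α₀ p) (β₀ p) : ℂ)) volume t (max r t) :=
    intervalIntegrable_init i0 ⟨htm, hmT⟩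
  have e : (∫ p in (max r t)..T, (inner ℂ (α r p) (β r p) : ℂ))
      - ((|r - t| : ℝ) : ℂ) * ∫ p in t..T, (inner ℂ (α₀ p) (β₀ p) : ℂ)
      = (∫ p in (max r t)..T, ((inner ℂ (α r p) (β r p) : ℂ)
          - ((|r - t| : ℝ) : ℂ) * inner ℂ (α₀ p) (β₀ p)))
        - ((|r - t| : ℝ) : ℂ) * ∫ p in t..(max r t), (inner ℂ (α₀ p) (β₀ p) : ℂ) := by
    rw [intervalIntegral.integral_sub i1 (i2.const_mul _), intervalIntegral.integral_const_mul,
      ← intervalIntegral.integral_add_adjacent_intervals i3 i2]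
    ring
  rw [e]
  refine (norm_sub_le _ _).trans ?_
  have hh0 := abs_nonneg (r - t)
  have b1 := intervalIntegral.norm_integral_le_of_norm_le_const (a := max r t) (b := T)
    (f := fun p => (inner ℂ (α r p) (β r p) : ℂ) - ((|r - t| : ℝ) : ℂ) * inner ℂ (α₀ p) (β₀ p))
    (C := η * |r - t| * (D + 1 + A)) (fun p hp => by
      rw [uIoc_of_le hmT] at hp
      have hp := Ioc_subset_Icc_self hp
      have e2 : (inner ℂ (α r p) (β r p) : ℂ) - ((|r - t| : ℝ) : ℂ) * inner ℂ (α₀ p) (β₀ p)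
          = inner ℂ (α r p - |r - t| • α₀ p) (β r p)
            + ((|r - t| : ℝ) : ℂ) * inner ℂ (α₀ p) (β r p - β₀ p) := by
        rw [inner_sub_left, inner_sub_right, inner_real_smul_left]
        ring
      have hβn : ‖β r p‖ ≤ D + 1 := by
        have := norm_add_le (β r p - β₀ p) (β₀ p)
        rw [sub_add_cancel] at this
        linarith [h2 p hp, hD p (hs hp)]
      rw [e2]
      refine (norm_add_le _ _).trans ?_
      rw [norm_mul, Complex.norm_real, Real.norm_eq_abs, abs_abs]
      calc _ ≤ (η * |r - t|) * (D + 1) + |r - t| * (A * η) := by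
            gcongr
            · refine (norm_inner_le_norm _ _).trans ?_
              gcongr
              exact h1 p hp
            · refine (norm_inner_le_norm _ _).trans ?_
              gcongr
              exacts [hA p (hs hp), h2 p hp]
        _ = _ := by ring)
  have b2 := intervalIntegral.norm_integral_le_of_norm_le_const (a := t) (b := max r t)
    (f := fun p => (inner ℂ (α₀ p) (β₀ p) : ℂ)) (C := A * D) (fun p hp => by
      rw [uIoc_of_le htm] at hp
      have hp' : p ∈ Icc t T := ⟨hp.1.le, hp.2.trans hmT⟩
      refine (norm_inner_le_norm _ _).trans ?_
      gcongr
      exacts [hA p hp', hD p hp'])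
  rw [abs_of_nonneg (sub_nonneg.2 hmT)] at b1
  rw [abs_of_nonneg (sub_nonneg.2 htm)] at b2
  have hmax : max r t - t ≤ |r - t| := by
    linarith [min_le_right r t, max_sub_min_eq r t]
  rw [norm_mul, Complex.norm_real, Real.norm_eq_abs, abs_abs]
  calc _ ≤ η * |r - t| * (D + 1 + A) * (T - t) + |r - t| * (A * D * η) := by
        gcongr
        · refine b1.trans ?_
          gcongr
        · refine b2.trans ?_
          gcongr
          exact hmax.trans h3
    _ = η * ((T - t) * (D + 1 + A) + A * D) * |r - t| := by ring
    _ ≤ ε * |r - t| := by gcongr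

/-! ### The dependence of the optimality system on the initial time -/

/-- The form `∫ ⟨g, Q w_f⟩` is symmetric. -/
theorem OptSys.symm (hF : StrongCont F) {τ : ℝ} (hτ : τ ≤ T) {f g : ℝ → H} {u v : ℝ → U}
    {w z : ℝ → H} (hf : OptSys T F B Q τ f u w) (hg : OptSys T F B Q τ g v z)
    (hQ : Q.IsPositive) :
    ∫ p in τ..T, (inner ℂ (g p) (Q (w p)) : ℂ)
      = starRingEnd ℂ (∫ p in τ..T, (inner ℂ (f p) (Q (z p)) : ℂ)) := by
  rw [← hf.test hF hτ hg.contU (hg.contF hF hτ) hg.state,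
    ← hg.test hF hτ hf.contU (hf.contF hF hτ) hf.state, map_add,
    intervalIntegral_inner_conj u v, intervalIntegral_inner_conj w]
  congr 1
  refine intervalIntegral.integral_congr fun p _ => ?_
  exact (hQ.inner_left_eq_inner_right (z p) (w p)).symm

/-- A family of optimality systems with initial times in `[a,T]`, whose free responses `f_τ` start
from `x₀` and satisfy `-∂f_τ(p)/∂τ = k(τ) F(p-τ) x₁ + G(p-τ) x₂` in the integrated sense. -/
structure OptFamily (T a : ℝ) (F G : ℝ → H →L[ℂ] H) (B : U →L[ℂ] H) (Q : H →L[ℂ] H)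
    (f : ℝ → ℝ → H) (u : ℝ → ℝ → U) (w : ℝ → ℝ → H) (x₀ x₁ x₂ : H) (k : ℝ → ℝ) : Prop where
  int : IntervalIntegrable k volume a T
  diag : ∀ τ ∈ Icc a T, f τ τ = x₀
  incr : ∀ τ ∈ Icc a T, ∀ τ' ∈ Icc τ T, ∀ p ∈ Icc τ' T,
    f τ p - f τ' p = (∫ σ in τ..τ', F (p - σ) ((k σ : ℂ) • x₁)) + ∫ σ in τ..τ', G (p - σ) x₂
  sys : ∀ τ ∈ Icc a T, OptSys T F B Q τ (f τ) (u τ) (w τ)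

/-- The modulus of continuity `∫_τ^τ' (1 + |k|)` of the family. -/
def incrMod (k : ℝ → ℝ) (τ τ' : ℝ) : ℝ := ∫ σ in τ..τ', (1 + ‖k σ‖)

section Family

variable {f : ℝ → ℝ → H} {u : ℝ → ℝ → U} {w : ℝ → ℝ → H} {x₀ x₁ x₂ : H} {k : ℝ → ℝ}

theorem intervalIntegrable_sub_Icc {E : Type*} [NormedAddCommGroup E] {g : ℝ → E} {a b τ τ' : ℝ}
    (hg : IntervalIntegrable g volume a b) (hτ : τ ∈ Icc a b) (hτ' : τ' ∈ Icc τ b) :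
    IntervalIntegrable g volume τ τ' :=
  intervalIntegrable_init (intervalIntegrable_tail hg hτ) hτ'

theorem intervalIntegrable_ofReal_smul {a b : ℝ} (hk : IntervalIntegrable k volume a b) (x : H) :
    IntervalIntegrable (fun σ => (k σ : ℂ) • x) volume a b := by
  rw [intervalIntegrable_iff] at hk ⊢
  exact (hk.ofReal (𝕜 := ℂ)).smul_const x

theorem incrMod_integrable (hk : IntervalIntegrable k volume a T) :
    IntervalIntegrable (fun σ => 1 + ‖k σ‖) volume a T :=
  intervalIntegrable_const.add hk.norm

theorem incrMod_nonneg {τ τ' : ℝ} (h : τ ≤ τ') : 0 ≤ incrMod k τ τ' :=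
  intervalIntegral.integral_nonneg h fun _ _ => by positivity

theorem incrMod_mono (hk : IntervalIntegrable k volume a T) {r r' τ τ' : ℝ} (hτ : τ ∈ Icc a T)
    (hτ' : τ' ∈ Icc τ T) (h1 : τ ≤ r) (h2 : r ≤ r') (h3 : r' ≤ τ') :
    incrMod k r r' ≤ incrMod k τ τ' :=
  intervalIntegral.integral_mono_interval h1 h2 h3 (ae_of_all _ fun _ => by positivity)
    (intervalIntegrable_sub_Icc (incrMod_integrable hk) hτ hτ')

theorem sub_le_incrMod (hk : IntervalIntegrable k volume a T) {τ τ' : ℝ} (hτ : τ ∈ Icc a T)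
    (hτ' : τ' ∈ Icc τ T) : τ' - τ ≤ incrMod k τ τ' := by
  have := intervalIntegral.integral_mono_on hτ'.1 (intervalIntegrable_const (c := (1 : ℝ)))
    (intervalIntegrable_sub_Icc (incrMod_integrable hk) hτ hτ')
    (fun σ _ => le_add_of_nonneg_right (norm_nonneg (k σ)))
  simpa [incrMod] using this

/-- The modulus of continuity tends to zero, by the continuity of the integral. -/
theorem eventually_incrMod_le (hk : IntervalIntegrable k volume a T) (ht : t ∈ Icc a T) {ε : ℝ}
    (hε : 0 < ε) : ∀ᶠ r in 𝓝[Icc a T] t, incrMod k (min r t) (max r t) ≤ ε := by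
  have haT := ht.1.trans ht.2
  have hi := incrMod_integrable hk
  have hc := intervalIntegral.continuousOn_primitive_interval' hi
    (show t ∈ uIcc a T by rwa [uIcc_of_le haT])
  rw [uIcc_of_le haT] at hc
  have h0 := (hc t ht).tendsto
  rw [intervalIntegral.integral_same] at h0
  filter_upwards [h0 (Metric.closedBall_mem_nhds 0 hε)] with r hr
  have hr' : |incrMod k t r| ≤ ε := by
    simpa [incrMod, Real.norm_eq_abs] using hr
  rcases le_total r t with h | h
  · rw [min_eq_left h, max_eq_right h]
    rw [incrMod, intervalIntegral.integral_symm, abs_neg] at hr'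
    exact (le_abs_self _).trans hr'
  · rw [min_eq_right h, max_eq_left h]
    exact (le_abs_self _).trans hr'

/-- Bounds for a family of optimality systems, uniform in the initial time, and the modulus of
continuity `incrMod`. They follow from the stability of the optimality system. -/
theorem OptFamily.exists_bound (hF : StrongCont F) (hG : StrongCont G) (hQ : Q.IsPositive)
    (ha : 0 ≤ a) (haT : a ≤ T) (h : OptFamily T a F G B Q f u w x₀ x₁ x₂ k) :
    ∃ C, 0 ≤ C ∧ ∀ τ ∈ Icc a T,
      (∀ p ∈ Icc τ T, ‖f τ p‖ ≤ C ∧ ‖u τ p‖ ≤ C ∧ ‖w τ p‖ ≤ C) ∧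
      ∀ τ' ∈ Icc τ T,
        (∀ p ∈ Icc τ' T, ‖f τ p - f τ' p‖ ≤ C * incrMod k τ τ' ∧
          ‖u τ p - u τ' p‖ ≤ C * incrMod k τ τ' ∧ ‖w τ p - w τ' p‖ ≤ C * incrMod k τ τ') ∧
        ∀ p ∈ Icc τ τ', ‖f τ p - x₀‖ ≤ C * incrMod k τ τ' ∧
          ‖w τ p - x₀‖ ≤ C * incrMod k τ τ' := by
  have hT0 : 0 ≤ T := ha.trans haT
  obtain ⟨cF, hF0, hFc⟩ := hF.bdd
  obtain ⟨cG, hG0, hGc⟩ := hG.bdd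
  obtain ⟨c₁, hc₁0, hc₁⟩ := OptSys.exists_bound hF hQ T hT0 B
  obtain ⟨c₂, hc₂0, hc₂⟩ := OptSys.exists_compare hF hQ T hT0 B
  set d : ℝ := cF * ‖x₁‖ + cG * ‖x₂‖ with hd
  have hd0 : 0 ≤ d := by positivity
  set m : ℝ := ‖x₀‖ + d * incrMod k a T with hm
  have hm0 : 0 ≤ m := add_nonneg (norm_nonneg _) (mul_nonneg hd0 (incrMod_nonneg haT))
  set M : ℝ := (1 + c₁) * m with hM
  have hM0 : 0 ≤ M := by positivity
  -- the increments of the free responses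
  have hinc : ∀ τ ∈ Icc a T, ∀ τ' ∈ Icc τ T, ∀ p ∈ Icc τ' T,
      ‖f τ p - f τ' p‖ ≤ d * incrMod k τ τ' := by
    intro τ hτ τ' hτ' p hp
    have hk := intervalIntegrable_sub_Icc h.int hτ hτ'
    rw [h.incr τ hτ τ' hτ' p hp]
    have h1 := norm_conv_le hFc hτ'.1 (φ := fun σ => (k σ : ℂ) • x₁)
      (intervalIntegrable_ofReal_smul hk x₁) (fun σ => p - σ)
    have h2 := norm_conv_le hGc hτ'.1 (intervalIntegrable_const (c := x₂)) (fun σ => p - σ)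
    have h3 : ∫ σ in τ..τ', ‖(k σ : ℂ) • x₁‖ ≤ incrMod k τ τ' * ‖x₁‖ := by
      rw [incrMod, ← intervalIntegral.integral_mul_const]
      refine intervalIntegral.integral_mono_on hτ'.1 ?_ ?_ fun σ _ => ?_
      · simp only [norm_smul, Complex.norm_real]
        exact hk.norm.mul_const _
      · exact (intervalIntegrable_sub_Icc (incrMod_integrable h.int) hτ hτ').mul_const _
      · rw [norm_smul, Complex.norm_real]
        gcongr
        linarith
    have h4 : ∫ _σ in τ..τ', ‖x₂‖ ≤ incrMod k τ τ' * ‖x₂‖ := by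
      rw [intervalIntegral.integral_const, smul_eq_mul]
      gcongr
      exact sub_le_incrMod h.int hτ hτ'
    calc _ ≤ cF * (incrMod k τ τ' * ‖x₁‖) + cG * (incrMod k τ τ' * ‖x₂‖) :=
          (norm_add_le _ _).trans (add_le_add (h1.trans (by gcongr)) (h2.trans (by gcongr)))
      _ = d * incrMod k τ τ' := by rw [hd]; ring
  have hstart : ∀ τ ∈ Icc a T, ∀ p ∈ Icc τ T, ‖f τ p - x₀‖ ≤ d * incrMod k τ p := by
    intro τ hτ p hp
    have := hinc τ hτ p hp p ⟨le_rfl, hp.2⟩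
    rwa [h.diag p ⟨hτ.1.trans hp.1, hp.2⟩] at this
  have hfm : ∀ τ ∈ Icc a T, ∀ p ∈ Icc τ T, ‖f τ p‖ ≤ m := by
    intro τ hτ p hp
    have h1 := hstart τ hτ p hp
    have h2 : incrMod k τ p ≤ incrMod k a T :=
      incrMod_mono h.int ⟨le_rfl, haT⟩ ⟨haT, le_rfl⟩ hτ.1 hp.1 hp.2
    calc ‖f τ p‖ = ‖x₀ + (f τ p - x₀)‖ := by congr 1; abel
      _ ≤ ‖x₀‖ + d * incrMod k a T :=
        (norm_add_le _ _).trans (by gcongr; exact h1.trans (by gcongr))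
  have huw : ∀ τ ∈ Icc a T, ∀ p ∈ Icc τ T, ‖u τ p‖ ≤ M ∧ ‖w τ p‖ ≤ M := by
    intro τ hτ p hp
    have := hc₁ τ ⟨ha.trans hτ.1, hτ.2⟩ _ _ _ (h.sys τ hτ) m hm0 (hfm τ hτ) p hp
    have hle : c₁ * m ≤ M := by rw [hM]; nlinarith
    exact ⟨this.1.trans hle, this.2.trans hle⟩
  have hb0 : 0 ≤ cF * (‖B‖ * M) := by positivity
  refine ⟨M + d + c₂ * (d + M) + cF * (‖B‖ * M), by positivity, fun τ hτ => ⟨fun p hp => ?_,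
    fun τ' hτ' => ⟨fun p hp => ?_, fun p hp => ?_⟩⟩⟩
  · have hs : M ≤ M + d + c₂ * (d + M) + cF * (‖B‖ * M) := by
      have : 0 ≤ c₂ * (d + M) := by positivity
      linarith
    have hmM : m ≤ M := by rw [hM]; nlinarith
    exact ⟨(hfm τ hτ p hp).trans (hmM.trans hs), (huw τ hτ p hp).1.trans hs,
      (huw τ hτ p hp).2.trans hs⟩
  · have hk0 : 0 ≤ incrMod k τ τ' := incrMod_nonneg hτ'.1
    have hτ'a : τ' ∈ Icc a T := ⟨hτ.1.trans hτ'.1, hτ'.2⟩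
    have h1 := hc₂ τ ⟨ha.trans hτ.1, hτ.2⟩ τ' hτ' _ _ _ _ _ _ (h.sys τ hτ) (h.sys τ' hτ'a)
      (d * incrMod k τ τ') M (by positivity) hM0 (hinc τ hτ τ' hτ')
      (fun q hq => (huw τ hτ q hq).1) p hp
    have h2 : c₂ * (d * incrMod k τ τ' + M * (τ' - τ)) ≤ c₂ * (d + M) * incrMod k τ τ' := by
      have h3 := sub_le_incrMod h.int hτ hτ'
      calc _ ≤ c₂ * (d * incrMod k τ τ' + M * incrMod k τ τ') := by gcongr
        _ = _ := by ring
    have hs1 : d ≤ M + d + c₂ * (d + M) + cF * (‖B‖ * M) := by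
      have : 0 ≤ c₂ * (d + M) := by positivity
      linarith
    have hs2 : c₂ * (d + M) ≤ M + d + c₂ * (d + M) + cF * (‖B‖ * M) := by linarith
    exact ⟨(hinc τ hτ τ' hτ' p hp).trans (by gcongr), (h1.1.trans h2).trans (by gcongr),
      (h1.2.trans h2).trans (by gcongr)⟩
  · have hk0 : 0 ≤ incrMod k τ τ' := incrMod_nonneg hτ'.1
    have hpT : p ∈ Icc τ T := ⟨hp.1, hp.2.trans hτ'.2⟩
    have h1 := hstart τ hτ p hpT
    have h2 : incrMod k τ p ≤ incrMod k τ τ' := incrMod_mono h.int hτ hτ' le_rfl hp.1 hp.2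
    have h3 : ‖f τ p - x₀‖ ≤ d * incrMod k τ τ' := h1.trans (by gcongr)
    have hs1 : d ≤ M + d + c₂ * (d + M) + cF * (‖B‖ * M) := by
      have : 0 ≤ c₂ * (d + M) := by positivity
      linarith
    have hs2 : d + cF * (‖B‖ * M) ≤ M + d + c₂ * (d + M) + cF * (‖B‖ * M) := by
      have : 0 ≤ c₂ * (d + M) := by positivity
      linarith
    refine ⟨h3.trans (by gcongr), ?_⟩
    have hsys := h.sys τ hτ
    have hBi : IntervalIntegrable (fun s => B (u τ s)) volume τ p :=
      (hsys.contBU.mono (Icc_subset_Icc_right hpT.2)).intervalIntegrable_of_Icc hp.1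
    have h4 := norm_conv_le hFc hp.1 hBi (fun s => p - s)
    have h5 : ∫ s in τ..p, ‖B (u τ s)‖ ≤ ∫ _s in τ..p, ‖B‖ * M :=
      intervalIntegral.integral_mono_on hp.1 hBi.norm intervalIntegrable_const fun s hs =>
        (B.le_opNorm _).trans (by gcongr; exact (huw τ hτ s ⟨hs.1, hs.2.trans hpT.2⟩).1)
    rw [intervalIntegral.integral_const, smul_eq_mul] at h5
    have h6 : p - τ ≤ incrMod k τ τ' := (sub_le_incrMod h.int hτ hpT).trans h2
    rw [hsys.state p hpT, add_sub_right_comm]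
    calc _ ≤ d * incrMod k τ τ' + cF * (incrMod k τ τ' * (‖B‖ * M)) := by
          refine (norm_add_le _ _).trans (add_le_add h3 (h4.trans ?_))
          gcongr
          exact h5.trans (by gcongr)
      _ = (d + cF * (‖B‖ * M)) * incrMod k τ τ' := by ring
      _ ≤ _ := by gcongr

end Family

end

section

variable {H U : Type*} [NormedAddCommGroup H] [InnerProductSpace ℂ H] [CompleteSpace H]
  [NormedAddCommGroup U] [InnerProductSpace ℂ U] [CompleteSpace U]
  {T a t : ℝ} {F G : ℝ → H →L[ℂ] H} {B : U →L[ℂ] H} {Q : H →L[ℂ] H}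
  {f g : ℝ → ℝ → H} {u v : ℝ → ℝ → U} {w z : ℝ → ℝ → H} {x₀ x₁ x₂ y₀ y₁ y₂ : H} {k l : ℝ → ℝ}

/-! ### Differentiation of the optimal cost in the initial time -/

/-- The optimal cost form `τ ↦ ∫_τ^T ⟨Q w_τ, g_τ⟩` of two families of free responses, where `w_τ`
is the optimal state of the first one. -/
def costForm (T : ℝ) (Q : H →L[ℂ] H) (g w : ℝ → ℝ → H) (τ : ℝ) : ℂ :=
  ∫ p in τ..T, inner ℂ (g τ p) (Q (w τ p))

theorem OptFamily.state_self (h : OptFamily T a F G B Q f u w x₀ x₁ x₂ k) {τ : ℝ}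
    (hτ : τ ∈ Icc a T) : w τ τ = x₀ := by
  rw [(h.sys τ hτ).state τ ⟨le_rfl, hτ.2⟩, intervalIntegral.integral_same, add_zero, h.diag τ hτ]

/-- The increment of the cost form. By the symmetry of the form, the increment of the optimal state
is traded for the increment of the free response. -/
theorem costForm_sub (hF : StrongCont F) (hQ : Q.IsPositive)
    (hf : OptFamily T a F G B Q f u w x₀ x₁ x₂ k) (hg : OptFamily T a F G B Q g v z y₀ y₁ y₂ l)
    {τ τ' : ℝ} (hτ : τ ∈ Icc a T) (hτ' : τ' ∈ Icc τ T) :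
    costForm T Q g w τ - costForm T Q g w τ'
      = (∫ p in τ..τ', (inner ℂ (g τ p) (Q (w τ p)) : ℂ))
        + (∫ p in τ'..T, (inner ℂ (g τ p - g τ' p) (Q (w τ p)) : ℂ))
        + starRingEnd ℂ (∫ p in τ'..T, (inner ℂ
          ((f τ p + ∫ σ in τ..τ', F (p - σ) (B (u τ σ))) - f τ' p) (Q (z τ' p)) : ℂ)) := by
  have hτ'a : τ' ∈ Icc a T := ⟨hτ.1.trans hτ'.1, hτ'.2⟩
  have hs := Icc_subset_Icc_left (b := T) hτ'.1
  have h1 := (hf.sys τ hτ).restrict hF hτ'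
  have h2 := hf.sys τ' hτ'a
  have h3 := hg.sys τ hτ
  have h4 := hg.sys τ' hτ'a
  have cg := h3.contF hF hτ.2
  have cg' := h4.contF hF hτ'.2
  have i1 := cg.intervalIntegrable_inner hτ.2 (hf.sys τ hτ).contQW
  -- The symmetry of the form on `[τ',T]`, for the restriction of the earlier system and for the
  -- later one: this removes the increment of the optimal state.
  have e1 := h1.symm hF hτ'.2 h4 hQ
  have e2 := h2.symm hF hτ'.2 h4 hQ
  have e3 : ∫ p in τ'..T, (inner ℂ (g τ p - g τ' p) (Q (w τ p)) : ℂ)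
      = (∫ p in τ'..T, (inner ℂ (g τ p) (Q (w τ p)) : ℂ))
        - ∫ p in τ'..T, (inner ℂ (g τ' p) (Q (w τ p)) : ℂ) := by
    rw [← intervalIntegral.integral_sub (intervalIntegrable_tail i1 hτ')
      (cg'.intervalIntegrable_inner hτ'.2 h1.contQW)]
    simp only [inner_sub_left]
  have e4 : ∫ p in τ'..T, (inner ℂ
      ((f τ p + ∫ σ in τ..τ', F (p - σ) (B (u τ σ))) - f τ' p) (Q (z τ' p)) : ℂ)
      = (∫ p in τ'..T, (inner ℂ (f τ p + ∫ σ in τ..τ', F (p - σ) (B (u τ σ))) (Q (z τ' p)) : ℂ))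
        - ∫ p in τ'..T, (inner ℂ (f τ' p) (Q (z τ' p)) : ℂ) := by
    rw [← intervalIntegral.integral_sub
      ((h1.contF hF hτ'.2).intervalIntegrable_inner hτ'.2 h4.contQW)
      ((h2.contF hF hτ'.2).intervalIntegrable_inner hτ'.2 h4.contQW)]
    simp only [inner_sub_left]
  rw [e3, e4, map_sub, ← e1, ← e2, costForm, costForm,
    ← intervalIntegral.integral_add_adjacent_intervals (intervalIntegrable_init i1 hτ')
      (intervalIntegrable_tail i1 hτ')]
  ring

/-- A function whose increments are bounded by those of an indefinite integral is absolutely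
continuous. -/
theorem absolutelyContinuousOnInterval_of_norm_sub_le {V : ℝ → ℂ} {m : ℝ → ℝ} (haT : a ≤ T)
    (hm : IntervalIntegrable m volume a T)
    (h : ∀ τ ∈ Icc a T, ∀ τ' ∈ Icc τ T, ‖V τ - V τ'‖ ≤ ∫ σ in τ..τ', m σ) :
    AbsolutelyContinuousOnInterval V a T := by
  have hac := hm.absolutelyContinuousOnInterval_intervalIntegral (c := a)
    (by rw [uIcc_of_le haT]; exact ⟨le_rfl, haT⟩)
  have hle : ∀ x ∈ Icc a T, ∀ y ∈ Icc a T, dist (V x) (V y)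
      ≤ dist (∫ σ in a..x, m σ) (∫ σ in a..y, m σ) := by
    have key : ∀ x ∈ Icc a T, ∀ y ∈ Icc x T, dist (V x) (V y)
        ≤ dist (∫ σ in a..x, m σ) (∫ σ in a..y, m σ) := by
      intro x hx y hy
      have hya : y ∈ Icc a T := ⟨hx.1.trans hy.1, hy.2⟩
      rw [dist_comm (∫ σ in a..x, m σ), dist_eq_norm, dist_eq_norm,
        intervalIntegral.integral_interval_sub_left (intervalIntegrable_init hm hya)
          (intervalIntegrable_init hm hx)]
      exact (h x hx y hy).trans (le_abs_self _)
    intro x hx y hy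
    rcases le_total x y with hxy | hxy
    · exact key x hx y ⟨hxy, hy.2⟩
    · rw [dist_comm, dist_comm (∫ σ in a..x, m σ)]
      exact key y hy x ⟨hxy, hx.2⟩
  refine squeeze_zero' (Eventually.of_forall fun E => Finset.sum_nonneg fun _ _ => dist_nonneg)
    ?_ hac
  filter_upwards [mem_inf_of_right (mem_principal_self _)] with E hE
  refine Finset.sum_le_sum fun i hi => ?_
  have := hE.1 i hi
  rw [uIcc_of_le haT] at this
  exact hle _ this.1 _ this.2

/-- The cost form is absolutely continuous in the initial time. -/
theorem absolutelyContinuous_costForm (hF : StrongCont F) (hG : StrongCont G) (hQ : Q.IsPositive)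
    (ha : 0 ≤ a) (haT : a ≤ T) (hf : OptFamily T a F G B Q f u w x₀ x₁ x₂ k)
    (hg : OptFamily T a F G B Q g v z y₀ y₁ y₂ l) :
    AbsolutelyContinuousOnInterval (costForm T Q g w) a T := by
  obtain ⟨cF, hF0, hFc⟩ := hF.bdd
  obtain ⟨C, hC0, hC⟩ := hf.exists_bound hF hG hQ ha haT
  obtain ⟨D, hD0, hD⟩ := hg.exists_bound hF hG hQ ha haT
  set c₁ : ℝ := D * (‖Q‖ * C) with hc₁
  set c₂ : ℝ := T * ((C + cF * (‖B‖ * C)) * (‖Q‖ * D)) with hc₂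
  have hT0 : 0 ≤ T := ha.trans haT
  refine absolutelyContinuousOnInterval_of_norm_sub_le haT
    (m := fun σ => (c₁ + c₂) * (1 + ‖k σ‖) + T * c₁ * (1 + ‖l σ‖))
    (((incrMod_integrable hf.int).const_mul _).add ((incrMod_integrable hg.int).const_mul _))
    fun τ hτ τ' hτ' => ?_
  have hτ'a : τ' ∈ Icc a T := ⟨hτ.1.trans hτ'.1, hτ'.2⟩
  have hTτ : T - τ' ≤ T := by linarith [hτ'a.1]
  have hTτ0 : 0 ≤ T - τ' := by linarith [hτ'.2]
  have hk0 : 0 ≤ incrMod k τ τ' := incrMod_nonneg hτ'.1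
  have hl0 : 0 ≤ incrMod l τ τ' := incrMod_nonneg hτ'.1
  have hkh : τ' - τ ≤ incrMod k τ τ' := sub_le_incrMod hf.int hτ hτ'
  have hc₁0 : 0 ≤ c₁ := by positivity
  rw [intervalIntegral.integral_add
    ((intervalIntegrable_sub_Icc (incrMod_integrable hf.int) hτ hτ').const_mul _)
    ((intervalIntegrable_sub_Icc (incrMod_integrable hg.int) hτ hτ').const_mul _),
    intervalIntegral.integral_const_mul, intervalIntegral.integral_const_mul,
    costForm_sub hF hQ hf hg hτ hτ']
  change _ ≤ (c₁ + c₂) * incrMod k τ τ' + T * c₁ * incrMod l τ τ'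
  have hQw : ∀ p ∈ Icc τ T, ‖Q (w τ p)‖ ≤ ‖Q‖ * C := fun p hp =>
    (Q.le_opNorm _).trans (by gcongr; exact ((hC τ hτ).1 p hp).2.2)
  have b1 := intervalIntegral.norm_integral_le_of_norm_le_const (a := τ) (b := τ')
    (f := fun p => (inner ℂ (g τ p) (Q (w τ p)) : ℂ)) (C := c₁) (fun p hp => by
      rw [uIoc_of_le hτ'.1] at hp
      have hp' : p ∈ Icc τ T := ⟨hp.1.le, hp.2.trans hτ'.2⟩
      refine (norm_inner_le_norm _ _).trans ?_
      rw [hc₁]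
      gcongr
      exacts [((hD τ hτ).1 p hp').1, hQw p hp'])
  have b2 := intervalIntegral.norm_integral_le_of_norm_le_const (a := τ') (b := T)
    (f := fun p => (inner ℂ (g τ p - g τ' p) (Q (w τ p)) : ℂ))
    (C := D * incrMod l τ τ' * (‖Q‖ * C)) (fun p hp => by
      rw [uIoc_of_le hτ'.2] at hp
      have hp' := Ioc_subset_Icc_self hp
      refine (norm_inner_le_norm _ _).trans ?_
      gcongr
      exacts [(((hD τ hτ).2 τ' hτ').1 p hp').1, hQw p ⟨hτ'.1.trans hp'.1, hp'.2⟩])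
  have hBi : IntervalIntegrable (fun s => B (u τ s)) volume τ τ' :=
    ((hf.sys τ hτ).contBU.mono (Icc_subset_Icc_right hτ'.2)).intervalIntegrable_of_Icc hτ'.1
  have b3 := intervalIntegral.norm_integral_le_of_norm_le_const (a := τ') (b := T)
    (f := fun p => (inner ℂ ((f τ p + ∫ σ in τ..τ', F (p - σ) (B (u τ σ))) - f τ' p)
      (Q (z τ' p)) : ℂ))
    (C := ((C + cF * (‖B‖ * C)) * incrMod k τ τ') * (‖Q‖ * D)) (fun p hp => by
      rw [uIoc_of_le hτ'.2] at hp
      have hp' := Ioc_subset_Icc_self hp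
      refine (norm_inner_le_norm _ _).trans ?_
      have h4 := norm_conv_le hFc hτ'.1 hBi (fun s => p - s)
      have h5 : ∫ s in τ..τ', ‖B (u τ s)‖ ≤ ∫ _s in τ..τ', ‖B‖ * C :=
        intervalIntegral.integral_mono_on hτ'.1 hBi.norm intervalIntegrable_const fun s hs =>
          (B.le_opNorm _).trans (by
            gcongr; exact ((hC τ hτ).1 s ⟨hs.1, hs.2.trans hτ'.2⟩).2.1)
      rw [intervalIntegral.integral_const, smul_eq_mul] at h5
      gcongr
      · rw [add_sub_right_comm]
        calc _ ≤ C * incrMod k τ τ' + cF * (incrMod k τ τ' * (‖B‖ * C)) := by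
              refine (norm_add_le _ _).trans (add_le_add
                (((hC τ hτ).2 τ' hτ').1 p hp').1 (h4.trans ?_))
              gcongr
              exact h5.trans (by gcongr)
          _ = _ := by ring
      · exact (Q.le_opNorm _).trans (by gcongr; exact ((hD τ' hτ'a).1 p hp').2.2))
  rw [abs_of_nonneg (by linarith [hτ'.1])] at b1
  rw [abs_of_nonneg hTτ0] at b2 b3
  refine (norm_add₃_le).trans ?_
  rw [RCLike.norm_conj]
  calc _ ≤ c₁ * incrMod k τ τ' + D * incrMod l τ τ' * (‖Q‖ * C) * T
        + ((C + cF * (‖B‖ * C)) * incrMod k τ τ') * (‖Q‖ * D) * T := by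
        refine add_le_add_three (b1.trans ?_) (b2.trans ?_) (b3.trans ?_) <;> gcongr
    _ = _ := by rw [hc₁, hc₂]; ring

/-- The optimal states depend continuously on the initial time, uniformly on the common interval.
Here the earlier of `r` and `t` is the initial time. -/
theorem OptFamily.eventually_state_min (hF : StrongCont F) (hG : StrongCont G)
    (hQ : Q.IsPositive) (ha : 0 ≤ a) (ht : t ∈ Icc a T)
    (h : OptFamily T a F G B Q f u w x₀ x₁ x₂ k) {ε : ℝ} (hε : 0 < ε) :
    ∀ᶠ r in 𝓝[Icc a T] t, ∀ p ∈ Icc (max r t) T, ‖w (min r t) p - w t p‖ ≤ ε := by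
  obtain ⟨C, hC0, hC⟩ := h.exists_bound hF hG hQ ha (ht.1.trans ht.2)
  obtain ⟨η, hη, -, hηε⟩ := exists_pos_mul_le C hC0 hε
  filter_upwards [eventually_incrMod_le h.int ht hη, self_mem_nhdsWithin] with r h1 hr p hp
  have hm : min r t ∈ Icc a T := ⟨le_min hr.1 ht.1, (min_le_right _ _).trans ht.2⟩
  have hmono : incrMod k (min r t) t ≤ incrMod k (min r t) (max r t) :=
    incrMod_mono h.int hm ⟨min_le_max, max_le hr.2 ht.2⟩ le_rfl (min_le_right _ _)
      (le_max_right _ _)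
  calc _ ≤ C * incrMod k (min r t) t := (((hC _ hm).2 t ⟨min_le_right _ _, ht.2⟩).1 p
        ⟨(le_max_right _ _).trans hp.1, hp.2⟩).2.2
    _ ≤ C * η := by gcongr; exact hmono.trans h1
    _ ≤ ε := by rwa [mul_comm]

/-- The counterpart of `OptFamily.eventually_state_min` for the later of `r` and `t`. -/
theorem OptFamily.eventually_state_max (hF : StrongCont F) (hG : StrongCont G)
    (hQ : Q.IsPositive) (ha : 0 ≤ a) (ht : t ∈ Icc a T)
    (h : OptFamily T a F G B Q f u w x₀ x₁ x₂ k) {ε : ℝ} (hε : 0 < ε) :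
    ∀ᶠ r in 𝓝[Icc a T] t, ∀ p ∈ Icc (max r t) T, ‖w (max r t) p - w t p‖ ≤ ε := by
  obtain ⟨C, hC0, hC⟩ := h.exists_bound hF hG hQ ha (ht.1.trans ht.2)
  obtain ⟨η, hη, -, hηε⟩ := exists_pos_mul_le C hC0 hε
  filter_upwards [eventually_incrMod_le h.int ht hη, self_mem_nhdsWithin] with r h1 hr p hp
  have hm : min r t ∈ Icc a T := ⟨le_min hr.1 ht.1, (min_le_right _ _).trans ht.2⟩
  have hmono : incrMod k t (max r t) ≤ incrMod k (min r t) (max r t) :=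
    incrMod_mono h.int hm ⟨min_le_max, max_le hr.2 ht.2⟩ (min_le_right _ _) (le_max_right _ _)
      le_rfl
  rw [norm_sub_rev]
  calc _ ≤ C * incrMod k t (max r t) := (((hC t ht).2 (max r t)
        ⟨le_max_right _ _, max_le hr.2 ht.2⟩).1 p hp).2.2
    _ ≤ C * η := by gcongr; exact hmono.trans h1
    _ ≤ ε := by rwa [mul_comm]

/-- Near the initial time, the free response and the optimal state are close to `x₀`. -/
theorem OptFamily.eventually_init (hF : StrongCont F) (hG : StrongCont G)
    (hQ : Q.IsPositive) (ha : 0 ≤ a) (ht : t ∈ Icc a T)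
    (h : OptFamily T a F G B Q f u w x₀ x₁ x₂ k) {ε : ℝ} (hε : 0 < ε) :
    ∀ᶠ r in 𝓝[Icc a T] t, ∀ p ∈ Icc (min r t) (max r t),
      ‖f (min r t) p - x₀‖ ≤ ε ∧ ‖w (min r t) p - x₀‖ ≤ ε := by
  obtain ⟨C, hC0, hC⟩ := h.exists_bound hF hG hQ ha (ht.1.trans ht.2)
  obtain ⟨η, hη, -, hηε⟩ := exists_pos_mul_le C hC0 hε
  filter_upwards [eventually_incrMod_le h.int ht hη, self_mem_nhdsWithin] with r h1 hr p hp
  have hm : min r t ∈ Icc a T := ⟨le_min hr.1 ht.1, (min_le_right _ _).trans ht.2⟩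
  have h2 := ((hC _ hm).2 (max r t) ⟨min_le_max, max_le hr.2 ht.2⟩).2 p hp
  have h3 : C * incrMod k (min r t) (max r t) ≤ ε := by
    calc _ ≤ C * η := by gcongr
      _ ≤ ε := by rwa [mul_comm]
  exact ⟨h2.1.trans h3, h2.2.trans h3⟩

/-- The optimal controls are equicontinuous at the diagonal. The optimal states, extended by
`x₀` to earlier times, converge uniformly, and the costate of a fixed function is continuous in
norm. -/
theorem OptFamily.eventually_ctrl (hF : StrongCont F) (hG : StrongCont G)
    (hQ : Q.IsPositive) (ha : 0 ≤ a) (ht : t ∈ Icc a T)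
    (h : OptFamily T a F G B Q f u w x₀ x₁ x₂ k) {ε : ℝ} (hε : 0 < ε) :
    ∀ᶠ r in 𝓝[Icc a T] t, ∀ σ ∈ Icc (min r t) (max r t), ‖u (min r t) σ - u t t‖ ≤ ε := by
  have haT := ht.1.trans ht.2
  obtain ⟨cF, hF0, hFc⟩ := hF.bdd
  obtain ⟨C, hC0, hC⟩ := h.exists_bound hF hG hQ ha haT
  set ζ : ℝ → H := fun p => w t (clq t T p) with hζ
  have hζc : Continuous ζ :=
    (h.sys t ht).contW.comp_continuous (continuous_clq t T) (clq_mem ht.2)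
  have hQζ : Continuous fun p => Q (ζ p) := Q.continuous.comp hζc
  have hcc : ContinuousOn (costate F T fun p => Q (ζ p)) (Icc a T) :=
    costate_continuousOn hF haT hQζ.continuousOn
  obtain ⟨η, hη, -, hηε⟩ := exists_pos_mul_le (‖B‖ * (cF * (T * (‖Q‖ * C)) + 1))
    (by have := ha.trans haT; positivity) hε
  obtain ⟨d', hd', hdc⟩ := Metric.continuousWithinAt_iff.1 (hcc t ht) η hη
  have hd := half_pos hd'
  filter_upwards [eventually_incrMod_le h.int ht hη, eventually_abs_sub_le _ t hd,
    self_mem_nhdsWithin] with r h1 h2 hr σ hσ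
  set τ := min r t with hτdef
  have hm : τ ∈ Icc a T := ⟨le_min hr.1 ht.1, (min_le_right _ _).trans ht.2⟩
  have hτt : τ ≤ t := min_le_right _ _
  have hσT : σ ≤ T := hσ.2.trans (max_le hr.2 ht.2)
  have hmono : incrMod k τ t ≤ η :=
    (incrMod_mono h.int hm ⟨min_le_max, max_le hr.2 ht.2⟩ le_rfl (min_le_right _ _)
      (le_max_right _ _)).trans h1
  have hwζ : ∀ p ∈ Icc τ T, ‖w τ p - ζ p‖ ≤ C * η := by
    intro p hp
    have h3 := (hC τ hm).2 t ⟨hτt, ht.2⟩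
    rcases le_total t p with htp | htp
    · rw [hζ]
      simp only
      rw [clq_of_mem ⟨htp, hp.2⟩]
      exact (h3.1 p ⟨htp, hp.2⟩).2.2.trans (by gcongr)
    · have e : ζ p = x₀ := by
        rw [hζ]
        simp only
        rw [clq, min_eq_right hp.2, max_eq_left htp, h.state_self ht]
      rw [e]
      exact (h3.2 p ⟨hp.1, htp⟩).2.trans (by gcongr)
  have hsub : Icc σ T ⊆ Icc τ T := Icc_subset_Icc_left hσ.1
  have i1 : IntervalIntegrable (fun p => Q (w τ p)) volume σ T :=
    ((h.sys τ hm).contQW.mono hsub).intervalIntegrable_of_Icc hσT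
  have i2 : IntervalIntegrable (fun p => Q (ζ p)) volume σ T := hQζ.intervalIntegrable _ _
  have b1 : ‖costate F T (fun p => Q (w τ p)) σ - costate F T (fun p => Q (ζ p)) σ‖
      ≤ cF * (T * (‖Q‖ * (C * η))) := by
    rw [← costate_sub hF hσT i1 i2]
    refine (norm_costate_le hF hFc hσT (i1.sub i2)).trans ?_
    gcongr
    have : ∫ p in σ..T, ‖Q (w τ p) - Q (ζ p)‖ ≤ ∫ _p in σ..T, ‖Q‖ * (C * η) :=
      intervalIntegral.integral_mono_on hσT (i1.sub i2).norm intervalIntegrable_const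
        fun p hp => by
          rw [← map_sub]
          exact (Q.le_opNorm _).trans (by gcongr; exact hwζ p (hsub hp))
    rw [intervalIntegral.integral_const, smul_eq_mul] at this
    refine this.trans ?_
    gcongr
    linarith [hm.1, hσ.1]
  have b2 : ‖costate F T (fun p => Q (ζ p)) σ - costate F T (fun p => Q (ζ p)) t‖ ≤ η := by
    rw [← dist_eq_norm]
    refine (hdc ⟨hm.1.trans hσ.1, hσT⟩ ?_).le
    rw [Real.dist_eq]
    refine lt_of_le_of_lt (le_trans ?_ h2) (half_lt_self hd')
    have e1 := max_sub_min_eq r t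
    have e2 := le_max_right r t
    exact abs_le.2 ⟨by linarith [hσ.1], by linarith [hσ.2]⟩
  have e : costate F T (fun p => Q (w t p)) t = costate F T (fun p => Q (ζ p)) t :=
    costate_congr hF ht.2 ((h.sys t ht).contQW.intervalIntegrable_of_Icc ht.2)
      (hQζ.intervalIntegrable _ _) fun p hp => by
        rw [hζ]
        simp only
        rw [clq_of_mem (Ioc_subset_Icc_self hp)]
  rw [(h.sys τ hm).ctrl σ ⟨hσ.1, hσT⟩, (h.sys t ht).ctrl t ⟨le_rfl, ht.2⟩, e, neg_sub_neg,
    ← map_sub]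
  refine (ContinuousLinearMap.le_opNorm _ _).trans ?_
  rw [LinearIsometryEquiv.norm_map]
  calc _ ≤ ‖B‖ * (cF * (T * (‖Q‖ * (C * η))) + η) := by
        gcongr
        rw [norm_sub_rev, ← sub_add_sub_cancel _ (costate F T (fun p => Q (ζ p)) σ)]
        exact (norm_add_le _ _).trans (add_le_add b1 b2)
    _ = η * (‖B‖ * (cF * (T * (‖Q‖ * C)) + 1)) := by ring
    _ ≤ ε := hηε

/-- The free response to first order in the initial time. -/
theorem OptFamily.eventually_incr (hF : StrongCont F) (hG : StrongCont G) (ht : t ∈ Icc a T)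
    (h : OptFamily T a F G B Q f u w x₀ x₁ x₂ k)
    (hk : MeanTendsto a T t (fun _ σ => (k σ : ℂ) • x₁) ((k t : ℂ) • x₁)) {ε : ℝ} (hε : 0 < ε) :
    ∀ᶠ r in 𝓝[Icc a T] t, ∀ p ∈ Icc (max r t) T,
      ‖(f (min r t) p - f (max r t) p)
        - |r - t| • (F (p - t) ((k t : ℂ) • x₁) + G (p - t) x₂)‖ ≤ ε * |r - t| := by
  have hG2 : MeanTendsto a T t (fun _ _ => x₂) x₂ :=
    MeanTendsto.of_uniform fun ε hε => Eventually.of_forall fun r σ _ => by simpa using hε.le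
  filter_upwards [conv_increment hF ht (fun r hr => intervalIntegrable_ofReal_smul
      (intervalIntegrable_sub_Icc h.int ⟨le_min hr.1 ht.1, (min_le_right _ _).trans ht.2⟩
        ⟨min_le_max, max_le hr.2 ht.2⟩) x₁) hk (half_pos hε),
    conv_increment hG ht (fun r _ => intervalIntegrable_const) hG2 (half_pos hε),
    self_mem_nhdsWithin] with r h1 h2 hr p hp
  rw [h.incr _ ⟨le_min hr.1 ht.1, (min_le_right _ _).trans ht.2⟩ _
    ⟨min_le_max, max_le hr.2 ht.2⟩ p hp, smul_add, add_sub_add_comm]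
  refine (norm_add_le _ _).trans ((add_le_add (h1 p hp) (h2 p hp)).trans (le_of_eq ?_))
  ring

/-- The derivative of the cost form in the initial time: the three terms of `costForm_sub`, to first
order. Only the convergence of the kernels in the mean is needed at `t`. -/
theorem hasDerivWithinAt_costForm (hF : StrongCont F) (hG : StrongCont G) (hQ : Q.IsPositive)
    (ha : 0 ≤ a) (ht : t ∈ Icc a T) (hf : OptFamily T a F G B Q f u w x₀ x₁ x₂ k)
    (hg : OptFamily T a F G B Q g v z y₀ y₁ y₂ l)
    (hk : MeanTendsto a T t (fun _ σ => (k σ : ℂ) • x₁) ((k t : ℂ) • x₁))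
    (hl : MeanTendsto a T t (fun _ σ => (l σ : ℂ) • y₁) ((l t : ℂ) • y₁)) :
    HasDerivWithinAt (costForm T Q g w)
      (-(inner ℂ y₀ (Q x₀)
        + (∫ p in t..T, (inner ℂ (F (p - t) ((l t : ℂ) • y₁) + G (p - t) y₂) (Q (w t p)) : ℂ))
        + starRingEnd ℂ (∫ p in t..T, (inner ℂ ((F (p - t) ((k t : ℂ) • x₁) + G (p - t) x₂)
          + F (p - t) (B (u t t))) (Q (z t p)) : ℂ)))) (Icc a T) t := by
  have haT := ht.1.trans ht.2
  have hmin : ∀ r ∈ Icc a T, min r t ∈ Icc a T := fun r hr =>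
    ⟨le_min hr.1 ht.1, (min_le_right _ _).trans ht.2⟩
  have hmax : ∀ r ∈ Icc a T, max r t ∈ Icc (min r t) T := fun r hr =>
    ⟨min_le_max, max_le hr.2 ht.2⟩
  have hmaxa : ∀ r ∈ Icc a T, max r t ∈ Icc a T := fun r hr =>
    ⟨(hmin r hr).1.trans (hmax r hr).1, (hmax r hr).2⟩
  have hFx : ∀ (x : H) (s : Set ℝ), ContinuousOn (fun p => F (p - t) x) s := fun x s =>
    (hF.comp_continuous (by fun_prop) continuous_const).continuousOn
  have hGx : ∀ (x : H) (s : Set ℝ), ContinuousOn (fun p => G (p - t) x) s := fun x s =>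
    (hG.comp_continuous (by fun_prop) continuous_const).continuousOn
  have hQn : ∀ {A : ℝ → ℝ → H} {A₀ : ℝ → H}, (∀ ε > 0, ∀ᶠ r in 𝓝[Icc a T] t,
      ∀ p ∈ Icc (max r t) T, ‖A r p - A₀ p‖ ≤ ε) → ∀ ε > 0, ∀ᶠ r in 𝓝[Icc a T] t,
      ∀ p ∈ Icc (max r t) T, ‖Q (A r p) - Q (A₀ p)‖ ≤ ε := by
    intro A A₀ hA ε hε
    obtain ⟨η, hη, -, hηε⟩ := exists_pos_mul_le ‖Q‖ (norm_nonneg _) hε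
    filter_upwards [hA η hη] with r hr p hp
    rw [← map_sub]
    refine (Q.le_opNorm _).trans ?_
    calc ‖Q‖ * ‖A r p - A₀ p‖ ≤ ‖Q‖ * η := by gcongr; exact hr p hp
      _ ≤ ε := by rwa [mul_comm]
  -- The boundary term: both factors are close to their values on the diagonal.
  have p1 : ∀ ε > 0, ∀ᶠ r in 𝓝[Icc a T] t,
      ‖(∫ p in (min r t)..(max r t), (inner ℂ (g (min r t) p) (Q (w (min r t) p)) : ℂ))
        - ((|r - t| : ℝ) : ℂ) * inner ℂ y₀ (Q x₀)‖ ≤ ε * |r - t| := by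
    intro ε hε
    obtain ⟨η, hη, hη1, hηε⟩ := exists_pos_mul_le (‖Q‖ * (‖x₀‖ + 1) + ‖y₀‖ * ‖Q‖)
      (by positivity) hε
    filter_upwards [hf.eventually_init hF hG hQ ha ht hη, hg.eventually_init hF hG hQ ha ht hη,
      self_mem_nhdsWithin] with r h1 h2 hr
    have hs : Icc (min r t) (max r t) ⊆ Icc (min r t) T := Icc_subset_Icc_right (hmax r hr).2
    have i1 := (((hg.sys _ (hmin r hr)).contF hF (hmin r hr).2).mono hs).intervalIntegrable_inner
      min_le_max ((hf.sys _ (hmin r hr)).contQW.mono hs)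
    have e : ((|r - t| : ℝ) : ℂ) * inner ℂ y₀ (Q x₀)
        = ∫ _p in (min r t)..(max r t), (inner ℂ y₀ (Q x₀) : ℂ) := by
      rw [intervalIntegral.integral_const, max_sub_min_eq, Complex.real_smul]
    rw [e, ← intervalIntegral.integral_sub i1 intervalIntegrable_const]
    have := intervalIntegral.norm_integral_le_of_norm_le_const (a := min r t) (b := max r t)
      (f := fun p => (inner ℂ (g (min r t) p) (Q (w (min r t) p)) : ℂ) - inner ℂ y₀ (Q x₀))
      (C := ε) (fun p hp => by
        rw [uIoc_of_le min_le_max] at hp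
        have hp := Ioc_subset_Icc_self hp
        have e2 : (inner ℂ (g (min r t) p) (Q (w (min r t) p)) : ℂ) - inner ℂ y₀ (Q x₀)
            = inner ℂ (g (min r t) p - y₀) (Q (w (min r t) p))
              + inner ℂ y₀ (Q (w (min r t) p - x₀)) := by
          rw [inner_sub_left, map_sub, inner_sub_right]; ring
        have hw : ‖w (min r t) p‖ ≤ ‖x₀‖ + 1 := by
          have := norm_add_le (w (min r t) p - x₀) x₀
          rw [sub_add_cancel] at this
          linarith [(h1 p hp).2]
        rw [e2]
        calc _ ≤ η * (‖Q‖ * (‖x₀‖ + 1)) + ‖y₀‖ * (‖Q‖ * η) := by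
              refine (norm_add_le _ _).trans (add_le_add ?_ ?_) <;>
                refine (norm_inner_le_norm _ _).trans ?_ <;> gcongr
              · exact (h2 p hp).1
              · exact (Q.le_opNorm _).trans (by gcongr)
              · exact (Q.le_opNorm _).trans (by gcongr; exact (h1 p hp).2)
          _ = η * (‖Q‖ * (‖x₀‖ + 1) + ‖y₀‖ * ‖Q‖) := by ring
          _ ≤ ε := hηε)
    rwa [max_sub_min_eq, abs_abs] at this
  -- The increment of `g`.
  have p2 := fun (ε : ℝ) (hε : 0 < ε) => pairing_increment (ε := ε) ht
    (α := fun r p => g (min r t) p - g (max r t) p)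
    (α₀ := fun p => F (p - t) ((l t : ℂ) • y₁) + G (p - t) y₂)
    (β := fun r p => Q (w (min r t) p)) (β₀ := fun p => Q (w t p))
    (fun ε hε => hg.eventually_incr hF hG ht hl hε)
    (hQn fun ε hε => hf.eventually_state_min hF hG hQ ha ht hε)
    (fun r hr => (((hg.sys _ (hmin r hr)).contF hF (hmin r hr).2).mono
      (Icc_subset_Icc_left min_le_max)).sub
      ((hg.sys _ (hmaxa r hr)).contF hF (hmaxa r hr).2))
    (fun r hr => (hf.sys _ (hmin r hr)).contQW.mono (Icc_subset_Icc_left min_le_max))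
    ((hFx _ _).add (hGx _ _)) (hf.sys t ht).contQW hε
  -- The increment of `f`, and the control used between the two initial times.
  have p3 := fun (ε : ℝ) (hε : 0 < ε) => pairing_increment (ε := ε) ht
    (α := fun r p => (f (min r t) p + ∫ σ in (min r t)..(max r t), F (p - σ) (B (u (min r t) σ)))
      - f (max r t) p)
    (α₀ := fun p => (F (p - t) ((k t : ℂ) • x₁) + G (p - t) x₂) + F (p - t) (B (u t t)))
    (β := fun r p => Q (z (max r t) p)) (β₀ := fun p => Q (z t p))
    (fun ε hε => by
      have hm : MeanTendsto a T t (fun r σ => B (u (min r t) σ)) (B (u t t)) :=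
        MeanTendsto.of_uniform fun ε hε => by
          obtain ⟨η, hη, -, hηε⟩ := exists_pos_mul_le ‖B‖ (norm_nonneg _) hε
          filter_upwards [hf.eventually_ctrl hF hG hQ ha ht hη] with r hr σ hσ
          rw [← map_sub]
          refine (B.le_opNorm _).trans ?_
          calc _ ≤ ‖B‖ * η := by gcongr; exact hr σ hσ
            _ ≤ ε := by rwa [mul_comm]
      filter_upwards [hf.eventually_incr hF hG ht hk (half_pos hε),
        conv_increment hF ht (fun r hr => ((hf.sys _ (hmin r hr)).contBU.mono
          (Icc_subset_Icc_right (hmax r hr).2)).intervalIntegrable_of_Icc min_le_max) hm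
          (half_pos hε)] with r h1 h2 p hp
      rw [smul_add, add_sub_right_comm, add_sub_add_comm]
      refine (norm_add_le _ _).trans ((add_le_add (h1 p hp) (h2 p hp)).trans (le_of_eq ?_))
      ring)
    (hQn fun ε hε => hg.eventually_state_max hF hG hQ ha ht hε)
    (fun r hr => (((hf.sys _ (hmin r hr)).restrict hF (hmax r hr)).contF hF (hmax r hr).2).sub
      ((hf.sys _ (hmaxa r hr)).contF hF (hmaxa r hr).2))
    (fun r hr => (hg.sys _ (hmaxa r hr)).contQW)
    (((hFx _ _).add (hGx _ _)).add (hFx _ _)) (hg.sys t ht).contQW hε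
  set L₁ : ℂ := inner ℂ y₀ (Q x₀) with hL₁
  set L₂ : ℂ := ∫ p in t..T, inner ℂ (F (p - t) ((l t : ℂ) • y₁) + G (p - t) y₂) (Q (w t p))
    with hL₂
  set L₃ : ℂ := ∫ p in t..T, inner ℂ ((F (p - t) ((k t : ℂ) • x₁) + G (p - t) x₂)
    + F (p - t) (B (u t t))) (Q (z t p)) with hL₃
  have key : ∀ ε > 0, ∀ᶠ r in 𝓝[Icc a T] t,
      ‖(costForm T Q g w (min r t) - costForm T Q g w (max r t))
        - ((|r - t| : ℝ) : ℂ) * (L₁ + L₂ + starRingEnd ℂ L₃)‖ ≤ ε * |r - t| := by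
    intro ε hε
    filter_upwards [p1 (ε / 3) (by positivity), p2 (ε / 3) (by positivity),
      p3 (ε / 3) (by positivity), self_mem_nhdsWithin] with r h1 h2 h3 hr
    rw [costForm_sub hF hQ hf hg (hmin r hr) (hmax r hr)]
    rw [← RCLike.norm_conj, map_sub, map_mul, Complex.conj_ofReal] at h3
    refine le_trans (le_of_eq ?_) ((norm_add₃_le).trans
      ((add_le_add_three h1 h2 h3).trans (le_of_eq ?_)))
    · congr 1
      ring
    · ring
  rw [hasDerivWithinAt_iff_isLittleO, Asymptotics.isLittleO_iff]
  intro ε hε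
  filter_upwards [key ε hε] with r hr
  rw [Real.norm_eq_abs]
  refine le_trans (le_of_eq ?_) hr
  rcases le_total r t with h | h
  · rw [min_eq_left h, max_eq_right h, abs_of_nonpos (by linarith), Complex.real_smul]
    congr 1
    push_cast
    ring
  · rw [min_eq_right h, max_eq_left h, abs_of_nonneg (by linarith), Complex.real_smul,
      ← norm_neg]
    congr 1
    push_cast
    ring

end

section

variable {H U : Type*} [NormedAddCommGroup H] [InnerProductSpace ℂ H] [CompleteSpace H]
  [NormedAddCommGroup U] [InnerProductSpace ℂ U] [CompleteSpace U]
  {T a t : ℝ} {S : ℝ → H →L[ℂ] H} {K : ℝ → ℝ} {B : U →L[ℂ] H} {Q : H →L[ℂ] H}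

/-! ### The differential equations of the optimal cost operators -/

/-- The derivative of the optimal cost form in terms of the initial values of the costates. -/
theorem hasDerivWithinAt_costForm_costate {F G : ℝ → H →L[ℂ] H} (hF : StrongCont F)
    (hG : StrongCont G) (hQ : Q.IsPositive) (ha : 0 ≤ a) (ht : t ∈ Icc a T)
    {f g : ℝ → ℝ → H} {u v : ℝ → ℝ → U} {w z : ℝ → ℝ → H} {x₀ x₁ x₂ y₀ y₁ y₂ : H} {k l : ℝ → ℝ}
    (hf : OptFamily T a F G B Q f u w x₀ x₁ x₂ k) (hg : OptFamily T a F G B Q g v z y₀ y₁ y₂ l)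
    (hk : MeanTendsto a T t (fun _ σ => (k σ : ℂ) • x₁) ((k t : ℂ) • x₁))
    (hl : MeanTendsto a T t (fun _ σ => (l σ : ℂ) • y₁) ((l t : ℂ) • y₁)) {p q : H}
    (hp : costate F T (fun r => Q (w t r)) t = p) (hq : costate F T (fun r => Q (z t r)) t = q) :
    HasDerivWithinAt (costForm T Q g w)
      (-(inner ℂ y₀ (Q x₀) + inner ℂ ((l t : ℂ) • y₁) p
        + (∫ r in t..T, (inner ℂ (G (r - t) y₂) (Q (w t r)) : ℂ))
        + inner ℂ q ((k t : ℂ) • x₁)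
        + starRingEnd ℂ (∫ r in t..T, (inner ℂ (G (r - t) x₂) (Q (z t r)) : ℂ))
        - inner ℂ (ContinuousLinearMap.adjoint B q) (ContinuousLinearMap.adjoint B p)))
      (Icc a T) t := by
  have iw := (hf.sys t ht).contQW.intervalIntegrable_of_Icc (μ := volume) ht.2
  have iz := (hg.sys t ht).contQW.intervalIntegrable_of_Icc (μ := volume) ht.2
  convert hasDerivWithinAt_costForm hF hG hQ ha ht hf hg hk hl using 2
  have e1 : ∫ r in t..T, (inner ℂ (F (r - t) ((l t : ℂ) • y₁) + G (r - t) y₂) (Q (w t r)) : ℂ)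
      = inner ℂ ((l t : ℂ) • y₁) p + ∫ r in t..T, (inner ℂ (G (r - t) y₂) (Q (w t r)) : ℂ) := by
    rw [← hp, inner_costate hF ht.2 iw, ← intervalIntegral.integral_add
      (intervalIntegrable_inner_family hF t iw _) (intervalIntegrable_inner_family hG t iw _)]
    simp only [inner_add_left]
  have e2 : ∫ r in t..T, (inner ℂ ((F (r - t) ((k t : ℂ) • x₁) + G (r - t) x₂)
      + F (r - t) (B (u t t))) (Q (z t r)) : ℂ)
      = inner ℂ ((k t : ℂ) • x₁) q + (∫ r in t..T, (inner ℂ (G (r - t) x₂) (Q (z t r)) : ℂ))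
        + inner ℂ (B (u t t)) q := by
    rw [← hq, inner_costate hF ht.2 iz, inner_costate hF ht.2 iz, ← intervalIntegral.integral_add
      (intervalIntegrable_inner_family hF t iz _) (intervalIntegrable_inner_family hG t iz _),
      ← intervalIntegral.integral_add ((intervalIntegrable_inner_family hF t iz _).add
        (intervalIntegrable_inner_family hG t iz _)) (intervalIntegrable_inner_family hF t iz _)]
    simp only [inner_add_left]
  have e3 : (inner ℂ q (B (u t t)) : ℂ)
      = -inner ℂ (ContinuousLinearMap.adjoint B q) (ContinuousLinearMap.adjoint B p) := by
    rw [← ContinuousLinearMap.adjoint_inner_left, (hf.sys t ht).ctrl t ⟨le_rfl, ht.2⟩, hp,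
      inner_neg_right]
  rw [e1, e2, map_add, map_add, inner_conj_symm, inner_conj_symm, e3]
  ring

theorem strongCont_neg_kerR (hT : 0 ≤ T) (hS : IsC0Semigroup S) (hK : IntegrableOn K (Ioc 0 T)) :
    StrongCont fun r => -(kerR S K (clp T r)) := by
  have h := strongCont_kerR hT hS hK
  obtain ⟨C, hC0, hC⟩ := h.bdd
  exact ⟨fun x => (h.cont x).neg, C, hC0, fun r => by rw [norm_neg]; exact hC r⟩

/-- The free responses `F(·,τ) x` to a present state `x` in the domain of the generator. -/
theorem optFamily_free (hT : 0 ≤ T) (hS : IsC0Semigroup S) (hK : IntegrableOn K (Ioc 0 T))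
    (B : U →L[ℂ] H) (hQ : Q.IsPositive) {A : H →ₗ.[ℂ] H} (hA : IsGenerator S A) (x : A.domain)
    (ha : 0 ≤ a) :
    OptFamily T a (famF T S K) (fun r => -(kerR S K (clp T r))) B Q
      (fun τ p => famF T S K (p - τ) x)
      (fun τ => optCtrl T S K B Q τ fun p => famF T S K (p - τ) x)
      (fun τ => optState T S K B Q τ fun p => famF T S K (p - τ) x)
      x (A x) x (fun _ => 1) where
  int := intervalIntegrable_const
  diag τ _ := by simp only [sub_self, famF_zero hT hS hK, ContinuousLinearMap.id_apply]
  sys τ hτ := optSys hT hS hK B hQ ⟨ha.trans hτ.1, hτ.2⟩ (freeResp_continuousOn hT hS hK τ _ _)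
  incr τ hτ τ' hτ' p hp := by
    have hF := strongCont_famF hT hS hK
    have hR := strongCont_kerR hT hS hK
    have h0 : 0 ≤ τ := ha.trans hτ.1
    have hc : Continuous fun s => famF T S K s (A x) - kerR S K (clp T s) x :=
      (hF.cont _).sub (hR.cont _)
    rw [famF_generator hT hS hK hA x ⟨by linarith [hτ'.1, hp.1], by linarith [hp.2]⟩,
      famF_generator hT hS hK hA x ⟨by linarith [hp.1], by linarith [hp.2, hτ'.1]⟩,
      add_sub_add_left_eq_sub, intervalIntegral.integral_interval_sub_left
        (hc.intervalIntegrable _ _) (hc.intervalIntegrable _ _),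
      ← intervalIntegral.integral_comp_sub_left
        (fun s => famF T S K s (A x) - kerR S K (clp T s) x),
      ← intervalIntegral.integral_add]
    · refine intervalIntegral.integral_congr fun σ _ => ?_
      simp [sub_eq_add_neg]
    · exact (hF.comp_continuous (by fun_prop) continuous_const).intervalIntegrable _ _
    · exact ((strongCont_neg_kerR hT hS hK).comp_continuous (by fun_prop)
        continuous_const).intervalIntegrable _ _

theorem intervalIntegrable_kernel_shift (hK : IntegrableOn K (Ioc 0 T)) {s : ℝ} (hs : 0 ≤ s)
    (hsa : s ≤ a) (haT : a ≤ T) : IntervalIntegrable (fun σ => K (σ - s)) volume a T := by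
  have h : IntervalIntegrable K volume (a - s) (T - s) := by
    rw [intervalIntegrable_iff_integrableOn_Ioc_of_le (by linarith)]
    exact hK.mono_set (Ioc_subset_Ioc (by linarith) (by linarith))
  simpa using h.comp_sub_right s

/-- The free responses `M(·,s,τ) x` to a value `x` of the history at time `s`. -/
theorem optFamily_mem (hT : 0 ≤ T) (hS : IsC0Semigroup S) (hK : IntegrableOn K (Ioc 0 T))
    (B : U →L[ℂ] H) (hQ : Q.IsPositive) {s : ℝ} (hs : 0 ≤ s) (hsa : s ≤ a) (haT : a ≤ T) (x : H) :
    OptFamily T a (famF T S K) (fun r => -(kerR S K (clp T r))) B Q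
      (fun τ => memResp T S K τ s x)
      (fun τ => optCtrl T S K B Q τ (memResp T S K τ s x))
      (fun τ => optState T S K B Q τ (memResp T S K τ s x))
      0 x 0 (fun σ => K (σ - s)) where
  int := intervalIntegrable_kernel_shift hK hs hsa haT
  diag τ _ := by simp only [memResp, intervalIntegral.integral_same]
  sys τ hτ := optSys hT hS hK B hQ ⟨(hs.trans hsa).trans hτ.1, hτ.2⟩
    (memResp_continuousOn hT hS hK τ s x)
  incr τ hτ τ' hτ' p hp := by
    have hF := strongCont_famF hT hS hK
    have hi : ∀ c d : ℝ, IntervalIntegrable (fun r => famF T S K (p - r)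
        ((kerK T K (r - s) : ℂ) • x)) volume c d := fun c d =>
      hF.intervalIntegrable_conv (intervalIntegrable_kerK_smul hK s c d x) p
    simp only [map_zero, intervalIntegral.integral_zero, add_zero, memResp]
    rw [intervalIntegral.integral_interval_sub_interval_comm (hi _ _) (hi _ _) (hi _ _),
      intervalIntegral.integral_same, sub_zero]
    -- The extension `kerK` vanishes at `0`, so it agrees with `K` on half-open intervals only.
    refine intervalIntegral_congr_Ioc hτ'.1 fun σ hσ => ?_
    rw [kerK_of_mem ⟨by linarith [hσ.1, hτ.1], by linarith [hσ.2, hτ'.2]⟩]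

theorem meanTendsto_one (x : H) :
    MeanTendsto a T t (fun _ _ => ((1 : ℝ) : ℂ) • x) (((1 : ℝ) : ℂ) • x) :=
  MeanTendsto.of_uniform fun ε hε => Eventually.of_forall fun r σ _ => by simpa using hε.le

/-- At a Lebesgue point the kernel is close to its value in the mean, on one-sided intervals
too. -/
theorem IsLebesguePt.meanTendsto (hK : IntegrableOn K (Ioc 0 T)) {s : ℝ} (hs : 0 ≤ s)
    (hsa : s ≤ a) (ht : t ∈ Icc a T) (h : IsLebesguePt T K (t - s)) (x : H) :
    MeanTendsto a T t (fun _ σ => (K (σ - s) : ℂ) • x) ((K (t - s) : ℂ) • x) := by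
  intro ε hε
  obtain ⟨η, hη, -, hηε⟩ := exists_pos_mul_le ‖x‖ (norm_nonneg _) hε
  have h1 : ∀ᶠ δ in 𝓝[>] (0 : ℝ),
      ∫ y in Icc 0 T ∩ Icc (t - s - δ) (t - s + δ), |K y - K (t - s)| ≤ η * δ := by
    filter_upwards [h (Iio_mem_nhds hη), self_mem_nhdsWithin] with δ hδ hδ0
    have hδ0 : 0 < δ := hδ0
    have hδ : δ⁻¹ * _ < η := hδ
    rw [inv_mul_lt_iff₀ hδ0] at hδ
    linarith
  obtain ⟨d, hd, hdη⟩ := mem_nhdsGT_iff_exists_Ioo_subset.1 h1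
  have hd : 0 < d := hd
  filter_upwards [eventually_abs_sub_le _ t (half_pos hd), self_mem_nhdsWithin] with r hr hra
  rcases eq_or_ne r t with rfl | hne
  · simp
  have hpos : 0 < |r - t| := abs_pos.2 (sub_ne_zero.2 hne)
  have h2 := hdη ⟨hpos, by linarith⟩
  simp only [mem_ofPred_eq] at h2
  have hmm := max_sub_min_eq r t
  have hm1 : a ≤ min r t := le_min hra.1 ht.1
  have hm2 : max r t ≤ T := max_le hra.2 ht.2
  have hb1 : min r t ≤ t := min_le_right _ _
  have hb2 : t ≤ max r t := le_max_right _ _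
  have hKc : IntegrableOn K (Icc 0 T) := (integrableOn_Icc_iff_integrableOn_Ioc (by simp)).2 hK
  have h3 : ∫ σ in (min r t)..(max r t), |K (σ - s) - K (t - s)| ≤ η * |r - t| := by
    rw [intervalIntegral.integral_comp_sub_right (fun y => |K y - K (t - s)|),
      intervalIntegral.integral_of_le (by linarith)]
    refine le_trans (setIntegral_mono_set ?_ (ae_of_all _ fun _ => abs_nonneg _)
      (Eventually.of_forall ?_)) h2
    · exact IntegrableOn.mono_set (t := Icc 0 T)
        (hKc.sub (integrableOn_const (C := K (t - s)) (by simp))).abs inter_subset_left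
    · intro y hy
      exact ⟨⟨by linarith [hy.1], by linarith [hy.2]⟩, by linarith [hy.1], by linarith [hy.2]⟩
  calc ∫ σ in (min r t)..(max r t), ‖(K (σ - s) : ℂ) • x - (K (t - s) : ℂ) • x‖
      = (∫ σ in (min r t)..(max r t), |K (σ - s) - K (t - s)|) * ‖x‖ := by
        rw [← intervalIntegral.integral_mul_const]
        refine intervalIntegral.integral_congr fun σ _ => ?_
        rw [← sub_smul, norm_smul, ← Complex.ofReal_sub, Complex.norm_real, Real.norm_eq_abs]
    _ ≤ η * |r - t| * ‖x‖ := by gcongr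
    _ = η * ‖x‖ * |r - t| := by ring
    _ ≤ ε * |r - t| := by gcongr

/-- The initial value of the costate for the free response `F(·,t) x` is `P₀(t) x`. -/
theorem costate_free (hT : 0 ≤ T) (hS : IsC0Semigroup S) (hK : IntegrableOn K (Ioc 0 T))
    (hQ : Q.IsPositive) (ht : t ∈ Icc 0 T) (x : H) :
    costate (famF T S K) T
      (fun p => Q (optState T S K B Q t (fun p => famF T S K (p - t) x) p)) t
      = costOp0 T S K B Q t x := by
  rw [costate_eq hT hS hK hQ ht (freeResp_continuousOn hT hS hK t x _),
    ← freeOp_apply hT hS hK ht]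
  rfl

/-- The initial value of the costate for the free response `M(·,s,t) x` is `P₁(t,s) x`. -/
theorem costate_mem (hT : 0 ≤ T) (hS : IsC0Semigroup S) (hK : IntegrableOn K (Ioc 0 T))
    (hQ : Q.IsPositive) (ht : t ∈ Icc 0 T) (s : ℝ) (x : H) :
    costate (famF T S K) T (fun p => Q (optState T S K B Q t (memResp T S K t s x) p)) t
      = costOp1 T S K B Q t s x := by
  rw [costate_eq hT hS hK hQ ht (memResp_continuousOn hT hS hK t s x),
    ← memOp_apply hT hS hK ht]
  rfl

/-- The kernel `-R(·-t)` is the response to the value of the history at the initial time. -/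
theorem integral_neg_kerR (hT : 0 ≤ T) (hS : IsC0Semigroup S) (hK : IntegrableOn K (Ioc 0 T))
    (ht : t ∈ Icc 0 T) {f : ℝ → H} (hf : ContinuousOn f (Icc t T)) (y : H) :
    ∫ p in t..T, (inner ℂ ((-(kerR S K (clp T (p - t)))) y) (Q (optState T S K B Q t f p)) : ℂ)
      = inner ℂ (memOp T S K t t y) (costL2 T S K B Q t (toL2 t T f)) := by
  rw [memOp_apply hT hS hK ht, inner_costL2 hT hS hK B Q ht hf
    (memResp_continuousOn hT hS hK t t y)]
  refine intervalIntegral_congr_Ioc ht.2 fun p hp => ?_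
  rw [← opM_eq_memResp hT hS hK ⟨ht.1, le_rfl⟩ (Ioc_subset_Icc_self hp),
    opM_diag hT hS hK ht.1 hp.1.le hp.2, neg_apply]

theorem integral_neg_kerR_free (hT : 0 ≤ T) (hS : IsC0Semigroup S)
    (hK : IntegrableOn K (Ioc 0 T)) (hQ : Q.IsPositive) (ht : t ∈ Icc 0 T) (x y : H) :
    ∫ p in t..T, (inner ℂ ((-(kerR S K (clp T (p - t)))) y)
        (Q (optState T S K B Q t (fun p => famF T S K (p - t) x) p)) : ℂ)
      = inner ℂ (costOp1 T S K B Q t t y) x := by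
  rw [integral_neg_kerR hT hS hK ht (freeResp_continuousOn hT hS hK t x _),
    ← inner_costL2_symm hQ, ← freeOp_apply hT hS hK ht, costOp1,
    ContinuousLinearMap.comp_apply, ContinuousLinearMap.adjoint_inner_left,
    ContinuousLinearMap.comp_apply]

theorem integral_neg_kerR_mem (hT : 0 ≤ T) (hS : IsC0Semigroup S)
    (hK : IntegrableOn K (Ioc 0 T)) (ht : t ∈ Icc 0 T) (s : ℝ) (x y : H) :
    ∫ p in t..T, (inner ℂ ((-(kerR S K (clp T (p - t)))) y)
        (Q (optState T S K B Q t (memResp T S K t s x) p)) : ℂ)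
      = inner ℂ y (costOp2 T S K B Q t s t x) := by
  rw [integral_neg_kerR hT hS hK ht (memResp_continuousOn hT hS hK t s x),
    ← memOp_apply hT hS hK ht, costOp2, ContinuousLinearMap.comp_apply,
    ContinuousLinearMap.adjoint_inner_right, ContinuousLinearMap.comp_apply]

/-- The form of `P₀` is the cost form of two families of free responses to a present state. -/
theorem costForm_free_free (hT : 0 ≤ T) (hS : IsC0Semigroup S) (hK : IntegrableOn K (Ioc 0 T))
    (x y : H) : EqOn (fun r => inner ℂ y (costOp0 T S K B Q r x))
      (costForm T Q (fun τ p => famF T S K (p - τ) y)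
        (fun τ => optState T S K B Q τ fun p => famF T S K (p - τ) x)) (Icc 0 T) := by
  intro r hr
  simp only
  rw [inner_costOp0 hT hS hK hr, inner_costL2 hT hS hK B Q hr
    (freeResp_continuousOn hT hS hK r x _) (freeResp_continuousOn hT hS hK r y _), costForm]

theorem costForm_free_mem (hT : 0 ≤ T) (hS : IsC0Semigroup S) (hK : IntegrableOn K (Ioc 0 T))
    (s : ℝ) (x y : H) : EqOn (fun r => inner ℂ y (costOp1 T S K B Q r s x))
      (costForm T Q (fun τ p => famF T S K (p - τ) y)
        (fun τ => optState T S K B Q τ (memResp T S K τ s x))) (Icc 0 T) := by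
  intro r hr
  simp only
  rw [inner_costOp1 hT hS hK hr, inner_costL2 hT hS hK B Q hr
    (memResp_continuousOn hT hS hK r s x) (freeResp_continuousOn hT hS hK r y _), costForm]

theorem costForm_mem_mem (hT : 0 ≤ T) (hS : IsC0Semigroup S) (hK : IntegrableOn K (Ioc 0 T))
    (s q : ℝ) (x y : H) : EqOn (fun r => inner ℂ y (costOp2 T S K B Q r s q x))
      (costForm T Q (fun τ => memResp T S K τ q y)
        (fun τ => optState T S K B Q τ (memResp T S K τ s x))) (Icc 0 T) := by
  intro r hr
  simp only
  rw [inner_costOp2 hT hS hK hr, inner_costL2 hT hS hK B Q hr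
    (memResp_continuousOn hT hS hK r s x) (memResp_continuousOn hT hS hK r q y), costForm]

theorem absolutelyContinuousOnInterval_congr {f g : ℝ → ℂ} {a b : ℝ} (hab : a ≤ b)
    (h : EqOn f g (Icc a b)) (hg : AbsolutelyContinuousOnInterval g a b) :
    AbsolutelyContinuousOnInterval f a b := by
  refine hg.congr' ?_
  filter_upwards [mem_inf_of_right (mem_principal_self _)] with E hE
  refine Finset.sum_congr rfl fun i hi => ?_
  have := hE.1 i hi
  rw [uIcc_of_le hab] at this
  rw [h this.1, h this.2]

/-- The equation for `P₀`. -/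
theorem costOp0_equation (hT : 0 ≤ T) (hS : IsC0Semigroup S) (hK : IntegrableOn K (Ioc 0 T))
    (hQ : Q.IsPositive) {A : H →ₗ.[ℂ] H} (hA : IsGenerator S A) (x y : A.domain) :
    AbsolutelyContinuousOnInterval (fun r => inner ℂ (y : H) (costOp0 T S K B Q r x)) 0 T ∧
    ∀ t ∈ Icc 0 T, ∃ d : ℂ,
      HasDerivWithinAt (fun r => inner ℂ (y : H) (costOp0 T S K B Q r x)) d (Icc 0 T) t ∧
      d + inner ℂ (A y) (costOp0 T S K B Q t x) + inner ℂ (costOp0 T S K B Q t y) (A x)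
        + inner ℂ (y : H) (Q x)
        - inner ℂ (ContinuousLinearMap.adjoint B (costOp0 T S K B Q t y))
          (ContinuousLinearMap.adjoint B (costOp0 T S K B Q t x))
        + inner ℂ (y : H) (costOp1 T S K B Q t t x)
        + inner ℂ (costOp1 T S K B Q t t y) (x : H) = 0 := by
  have hF := strongCont_famF hT hS hK
  have hG := strongCont_neg_kerR hT hS hK
  have he := costForm_free_free (B := B) (Q := Q) hT hS hK (x : H) (y : H)
  have hf := optFamily_free hT hS hK B hQ hA x le_rfl
  have hg := optFamily_free hT hS hK B hQ hA y le_rfl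
  refine ⟨absolutelyContinuousOnInterval_congr hT he
    (absolutelyContinuous_costForm hF hG hQ le_rfl hT hf hg), fun t ht => ⟨_,
    (hasDerivWithinAt_costForm_costate hF hG hQ le_rfl ht hf hg (meanTendsto_one _)
      (meanTendsto_one _) (costate_free hT hS hK hQ ht x)
      (costate_free hT hS hK hQ ht y)).congr he (he ht), ?_⟩⟩
  rw [integral_neg_kerR_free hT hS hK hQ ht, integral_neg_kerR_free hT hS hK hQ ht,
    inner_conj_symm]
  simp only [Complex.ofReal_one, one_smul]
  ring

/-- The equation for `P₁`. -/
theorem costOp1_equation (hT : 0 ≤ T) (hS : IsC0Semigroup S) (hK : IntegrableOn K (Ioc 0 T))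
    (hQ : Q.IsPositive) {A : H →ₗ.[ℂ] H} (hA : IsGenerator S A) (x : H) (y : A.domain) {s : ℝ}
    (hs : s ∈ Icc 0 T) :
    AbsolutelyContinuousOnInterval (fun r => inner ℂ (y : H) (costOp1 T S K B Q r s x)) s T ∧
    ∀ t ∈ Icc s T, IsLebesguePt T K (t - s) → ∃ d : ℂ,
      HasDerivWithinAt (fun r => inner ℂ (y : H) (costOp1 T S K B Q r s x)) d (Icc s T) t ∧
      d + inner ℂ (A y) (costOp1 T S K B Q t s x)
        + inner ℂ (costOp0 T S K B Q t y) ((K (t - s) : ℂ) • x)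
        + inner ℂ (y : H) (costOp2 T S K B Q t s t x)
        - inner ℂ (ContinuousLinearMap.adjoint B (costOp0 T S K B Q t y))
          (ContinuousLinearMap.adjoint B (costOp1 T S K B Q t s x)) = 0 := by
  have hF := strongCont_famF hT hS hK
  have hG := strongCont_neg_kerR hT hS hK
  have he := (costForm_free_mem (B := B) (Q := Q) hT hS hK s x (y : H)).mono
    (Icc_subset_Icc_left hs.1)
  have hf := optFamily_mem hT hS hK B hQ hs.1 le_rfl hs.2 x
  have hg := optFamily_free hT hS hK B hQ hA y hs.1
  refine ⟨absolutelyContinuousOnInterval_congr hs.2 he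
    (absolutelyContinuous_costForm hF hG hQ hs.1 hs.2 hf hg), fun t ht hL => ⟨_,
    (hasDerivWithinAt_costForm_costate hF hG hQ hs.1 ht hf hg
      (hL.meanTendsto hK hs.1 le_rfl ht x) (meanTendsto_one _)
      (costate_mem hT hS hK hQ ⟨hs.1.trans ht.1, ht.2⟩ s x)
      (costate_free hT hS hK hQ ⟨hs.1.trans ht.1, ht.2⟩ y)).congr he (he ht), ?_⟩⟩
  rw [integral_neg_kerR_mem hT hS hK ⟨hs.1.trans ht.1, ht.2⟩]
  simp only [Complex.ofReal_one, one_smul, map_zero, inner_zero_left, inner_zero_right,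
    intervalIntegral.integral_zero]
  ring

/-- The equation for `P₂`. -/
theorem costOp2_equation (hT : 0 ≤ T) (hS : IsC0Semigroup S) (hK : IntegrableOn K (Ioc 0 T))
    (hQ : Q.IsPositive) (x y : H) {s q : ℝ} (hs : s ∈ Icc 0 T) (hq : q ∈ Icc 0 T) :
    AbsolutelyContinuousOnInterval (fun r => inner ℂ y (costOp2 T S K B Q r s q x))
      (max s q) T ∧
    ∀ t ∈ Icc (max s q) T, IsLebesguePt T K (t - s) → IsLebesguePt T K (t - q) → ∃ d : ℂ,
      HasDerivWithinAt (fun r => inner ℂ y (costOp2 T S K B Q r s q x)) d (Icc (max s q) T) t ∧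
      d + inner ℂ ((K (t - q) : ℂ) • y) (costOp1 T S K B Q t s x)
        + inner ℂ (costOp1 T S K B Q t q y) ((K (t - s) : ℂ) • x)
        - inner ℂ (ContinuousLinearMap.adjoint B (costOp1 T S K B Q t q y))
          (ContinuousLinearMap.adjoint B (costOp1 T S K B Q t s x)) = 0 := by
  have hF := strongCont_famF hT hS hK
  have hG := strongCont_neg_kerR hT hS hK
  have h0 : 0 ≤ max s q := hs.1.trans (le_max_left _ _)
  have hmT : max s q ≤ T := max_le hs.2 hq.2
  have he := (costForm_mem_mem (B := B) (Q := Q) hT hS hK s q x y).mono (Icc_subset_Icc_left h0)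
  have hf := optFamily_mem hT hS hK B hQ hs.1 (le_max_left s q) hmT x
  have hg := optFamily_mem hT hS hK B hQ hq.1 (le_max_right s q) hmT y
  refine ⟨absolutelyContinuousOnInterval_congr hmT he
    (absolutelyContinuous_costForm hF hG hQ h0 hmT hf hg), fun t ht hLs hLq => ⟨_,
    (hasDerivWithinAt_costForm_costate hF hG hQ h0 ht hf hg
      (hLs.meanTendsto hK hs.1 (le_max_left _ _) ht x)
      (hLq.meanTendsto hK hq.1 (le_max_right _ _) ht y)
      (costate_mem hT hS hK hQ ⟨h0.trans ht.1, ht.2⟩ s x)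
      (costate_mem hT hS hK hQ ⟨h0.trans ht.1, ht.2⟩ q y)).congr he (he ht), ?_⟩⟩
  simp only [map_zero, inner_zero_left, inner_zero_right, intervalIntegral.integral_zero]
  ring

end

end VolterraLQ

end

theorem theorem1p1 {H U : Type*}
    [NormedAddCommGroup H] [InnerProductSpace ℂ H] [CompleteSpace H]
    [TopologicalSpace.SeparableSpace H]
    [NormedAddCommGroup U] [InnerProductSpace ℂ U] [CompleteSpace U]
    [TopologicalSpace.SeparableSpace U]
    (T : ℝ) (hT : 0 < T)
    (A : H →ₗ.[ℂ] H) (S : ℝ → H →L[ℂ] H) (hS : IsC0Semigroup S) (hA : IsGenerator S A)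
    (K : ℝ → ℝ) (hK : MemLp K 2 (volume.restrict (Ioc 0 T)))
    (B : U →L[ℂ] H) (Q : H →L[ℂ] H) (hQ : IsSelfAdjoint Q) (hQ0 : Q.IsPositive) :
    ∃ (uhat : (τ : ℝ) → Y H τ → ℝ → U) (what : (τ : ℝ) → Y H τ → ℝ → H),
      -- S1: well-posedness of the state equation; unique optimal pair, continuous in time
      (∀ τ ∈ Ioo 0 T, ∀ X : Y H τ,
        (∀ u : ℝ → U, MemLp u 2 (volume.restrict (Ioc τ T)) →
          ∃ w, IsMildSolution T S K B τ X u w ∧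
            ∀ w', IsMildSolution T S K B τ X u w' → w' =ᵐ[volume.restrict (Ioc τ T)] w) ∧
        ContinuousOn (uhat τ X) (Icc τ T) ∧ ContinuousOn (what τ X) (Icc τ T) ∧
        IsOptimalPair T S K B Q τ X (uhat τ X) (what τ X) ∧
        ∀ (u : ℝ → U) (w : ℝ → H), IsOptimalPair T S K B Q τ X u w →
          u =ᵐ[volume.restrict (Ioc τ T)] uhat τ X ∧
          w =ᵐ[volume.restrict (Ioc τ T)] what τ X) ∧
      -- S2: the optimal evolution map is a bounded linear evolution operator
      (∃ Φ : (t τ : ℝ) → (Y H τ →L[ℂ] Y H t),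
        (∀ τ ∈ Ioo 0 T, ∀ t ∈ Icc τ T, ∀ X : Y H τ,
          (Φ t τ X).fst = what τ X t ∧
          (Φ t τ X).snd =ᵐ[volume.restrict (Ioc 0 t)] extHist X (what τ X)) ∧
        (∀ t ∈ Ioc 0 T, Φ t t = ContinuousLinearMap.id ℂ (Y H t)) ∧
        (∀ τ τ₁ t : ℝ, 0 < τ → τ ≤ τ₁ → τ₁ ≤ t → t ≤ T →
          Φ t τ = (Φ t τ₁).comp (Φ τ₁ τ))) ∧
      ∃ (P0 : ℝ → H →L[ℂ] H) (P1 : ℝ → ℝ → H →L[ℂ] H) (P2 : ℝ → ℝ → ℝ → H →L[ℂ] H),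
        -- the operators are given by their explicit expressions
        (∀ t ∈ Icc 0 T, IsP0 T S K B Q t (P0 t)) ∧
        (∀ t ∈ Icc 0 T, ∀ s ∈ Icc 0 t, IsP1 T S K B Q t s (P1 t s)) ∧
        (∀ t ∈ Icc 0 T, ∀ s ∈ Icc 0 t, ∀ q ∈ Icc 0 t, IsP2 T S K B Q t s q (P2 t s q)) ∧
        -- S3: the optimal cost is the quadratic form built from `P0`, `P1`, `P2`
        (∀ τ ∈ Ioo 0 T,
          (∀ X : Y H τ,
            (cost T Q τ (uhat τ X) (what τ X) : ℂ) =
              inner ℂ X.fst (P0 τ X.fst)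
              + ((2 * (∫ s in (0 : ℝ)..τ, inner ℂ X.fst (P1 τ s (X.snd s))).re : ℝ) : ℂ)
              + ∫ q in (0 : ℝ)..τ, ∫ s in (0 : ℝ)..τ,
                  inner ℂ (X.snd q) (P2 τ s q (X.snd s))) ∧
          (∃ P : Y H τ →L[ℂ] Y H τ, ∀ X : Y H τ,
            (P X).fst = P0 τ X.fst + (∫ s in (0 : ℝ)..τ, P1 τ s (X.snd s)) ∧
            (∀ᵐ q ∂(volume.restrict (Ioc 0 τ)), (P X).snd q =
              adjoint (P1 τ q) X.fst + ∫ s in (0 : ℝ)..τ, P2 τ s q (X.snd s)) ∧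
            (cost T Q τ (uhat τ X) (what τ X) : ℂ) = inner ℂ X (P X)) ∧
          (IsSelfAdjoint (P0 τ) ∧ (P0 τ).IsPositive) ∧
          (∃ P2op : L2 H 0 τ →L[ℂ] L2 H 0 τ,
            (∀ ξ : L2 H 0 τ, ∀ᵐ q ∂(volume.restrict (Ioc 0 τ)),
              P2op ξ q = ∫ s in (0 : ℝ)..τ, P2 τ s q (ξ s)) ∧
            IsSelfAdjoint P2op ∧ P2op.IsPositive)) ∧
        -- S4: the feedback representation of the optimal control
        (∀ τ ∈ Ioo 0 T, ∀ X : Y H τ, ∀ t ∈ Icc τ T,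
          uhat τ X t = - adjoint B (P0 t (what τ X t))
            - ∫ s in (0 : ℝ)..t, adjoint B (P1 t s (extHist X (what τ X) s))) ∧
        -- S5: the coupled system of quadratic differential equations
        (∀ x y : A.domain,
          AbsolutelyContinuousOnInterval (fun r => inner ℂ (y : H) (P0 r x)) 0 T ∧
          ∀ t ∈ Ico 0 T, ∃ d : ℂ,
            HasDerivWithinAt (fun r => inner ℂ (y : H) (P0 r x)) d (Icc 0 T) t ∧
            d + inner ℂ (A y) (P0 t x) + inner ℂ (P0 t y) (A x) + inner ℂ (y : H) (Q x)
              - inner ℂ (adjoint B (P0 t y)) (adjoint B (P0 t x))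
              + inner ℂ (y : H) (P1 t t x) + inner ℂ (P1 t t y) (x : H) = 0) ∧
        (∀ x y : A.domain, ∀ s ∈ Ico 0 T,
          AbsolutelyContinuousOnInterval (fun r => inner ℂ (y : H) (P1 r s x)) s T ∧
          ∀ t ∈ Ico s T, IsLebesguePt T K (t - s) → ∃ d : ℂ,
            HasDerivWithinAt (fun r => inner ℂ (y : H) (P1 r s x)) d (Icc s T) t ∧
            d + inner ℂ (A y) (P1 t s x) + inner ℂ (P0 t y) ((K (t - s) : ℂ) • (x : H))
              + inner ℂ (y : H) (P2 t s t x)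
              - inner ℂ (adjoint B (P0 t y)) (adjoint B (P1 t s x)) = 0) ∧
        (∀ x y : A.domain, ∀ s ∈ Ico 0 T, ∀ q ∈ Ico 0 T,
          AbsolutelyContinuousOnInterval (fun r => inner ℂ (y : H) (P2 r s q x)) (max s q) T ∧
          ∀ t ∈ Ico (max s q) T, IsLebesguePt T K (t - s) → IsLebesguePt T K (t - q) → ∃ d : ℂ,
            HasDerivWithinAt (fun r => inner ℂ (y : H) (P2 r s q x)) d (Icc (max s q) T) t ∧
            d + inner ℂ ((K (t - q) : ℂ) • (y : H)) (P1 t s x)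
              + inner ℂ (P1 t q y) ((K (t - s) : ℂ) • (x : H))
              - inner ℂ (adjoint B (P1 t q y)) (adjoint B (P1 t s x)) = 0) ∧
        -- final conditions
        P0 T = 0 ∧ (∀ s ∈ Icc 0 T, P1 T s = 0) ∧
        (∀ s ∈ Icc 0 T, ∀ q ∈ Icc 0 T, P2 T s q = 0) := by
  have hT0 := hT.le
  have hKi : IntegrableOn K (Ioc 0 T) := hK.integrable one_le_two
  have hIoo : ∀ {τ : ℝ}, τ ∈ Ioo 0 T → τ ∈ Icc 0 T := fun h => Ioo_subset_Icc_self h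
  have hIco : ∀ {τ : ℝ}, τ ∈ Ico 0 T → τ ∈ Icc 0 T := fun h => Ico_subset_Icc_self h
  have hTT : T ∈ Icc 0 T := ⟨hT0, le_rfl⟩
  refine ⟨ctrlY T S K B Q, stateY T S K B Q, fun τ hτ X => ?_, ?_, costOp0 T S K B Q,
    costOp1 T S K B Q, costOp2 T S K B Q, fun t ht => isP0_costOp0 hT0 hS hKi hQ0 ht,
    fun t ht s hs => isP1_costOp1 hT0 hS hKi hQ0 ht hs,
    fun t ht s hs q hq => isP2_costOp2 hT0 hS hKi hQ0 ht hs hq, fun τ hτ => ?_,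
    fun τ hτ X t ht => ctrlY_feedback hT0 hS hKi hQ0 (hIoo hτ) ht X, fun x y => ?_,
    fun x y s hs => ?_, fun x y s hs q hq => ?_, ?_, fun s hs => ?_, fun s hs q hq => ?_⟩
  · have h := optSysY (B := B) hT0 hS hKi hQ0 (hIoo hτ) X
    exact ⟨fun u hu => exists_unique_mild hT0 hS hKi (hIoo hτ) X hu, h.contU, h.contW,
      isOptimalPair hT0 hS hKi hQ0 (hIoo hτ) X,
      fun u w huw => huw.ae_eq hT0 hS hKi hQ0 (hIoo hτ)⟩
  · obtain ⟨Φ, h1, h2, h3⟩ := exists_evolution_family hT0 hS hKi B hQ0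
    exact ⟨Φ, fun τ hτ => h1 τ (hIoo hτ), fun t ht => h2 t (Ioc_subset_Icc_self ht),
      fun τ τ₁ t h0 => h3 τ τ₁ t h0.le⟩
  · obtain ⟨P, hP, hpos⟩ := exists_memCostOp hT0 hS hKi B hQ0 (hIoo hτ)
    have hP0 := isPositive_costOp0 (T := T) (S := S) (K := K) (B := B) hQ0 τ
    exact ⟨fun X => cost_eq_form hT0 hS hKi hQ0 (hIoo hτ) X,
      exists_costOp hT0 hS hKi hQ0 (hIoo hτ), ⟨hP0.isSelfAdjoint, hP0⟩,
      P, hP, hpos.isSelfAdjoint, hpos⟩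
  · obtain ⟨h1, h2⟩ := costOp0_equation (B := B) hT0 hS hKi hQ0 hA x y
    exact ⟨h1, fun t ht => h2 t (hIco ht)⟩
  · obtain ⟨h1, h2⟩ := costOp1_equation (B := B) hT0 hS hKi hQ0 hA x y (hIco hs)
    exact ⟨h1, fun t ht => h2 t (Ico_subset_Icc_self ht)⟩
  · obtain ⟨h1, h2⟩ := costOp2_equation (B := B) hT0 hS hKi hQ0 x y (hIco hs) (hIco hq)
    exact ⟨h1, fun t ht => h2 t (Ico_subset_Icc_self ht)⟩
  · ext x
    refine ext_inner_left ℂ fun y => ?_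
    rw [(isP0_costOp0 hT0 hS hKi hQ0 hTT x y).2, intervalIntegral.integral_same]
    simp
  · ext x
    refine ext_inner_left ℂ fun y => ?_
    rw [(isP1_costOp1 hT0 hS hKi hQ0 hTT hs x y).2, intervalIntegral.integral_same]
    simp
  · ext x
    refine ext_inner_left ℂ fun y => ?_
    rw [(isP2_costOp2 hT0 hS hKi hQ0 hTT hs hq x y).2, intervalIntegral.integral_same]
    simp
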